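/- **Setting.** Let $M\ge 1$, $N=2M+1$, $L\ge 1$ and $m\ge 0$ be integers, $r\in\mathbb Z$ (a boundary condition modulo $N$), $\omega=e^{2\pi i/N}$, $q=\omega^{M}$ (so $q^{2}=\omega^{-1}$, $q^N=1$), and $q^{1/2}:=q^{M+1}$. Write $\equiv$ for congruence modulo $N$ and $[k]=\frac{q^k-q^{-k}}{q-q^{-1}}$, $[k]!=[1]\cdots[k]$. On $\mathbb C^N$ with basis $|\sigma\rangle$, $\sigma\in\mathbb Z/N$, let $X|\sigma\rangle=|\sigma+1\rangle$, $Z|\sigma\rangle=\omega^\sigma|\sigma\rangle$, $\widehat Z=X$, $\widehat X=Z^{-1}$, $\widehat Z^{1/2}:=\widehat Z^{M+1}$, and $\widehat{|k}\rangle=N^{-1/2}\sum_\sigma\omega^{-k\sigma}|\sigma\rangle$. For $Q\in\mathbb Z$ let $V_{r,Q}\subset\bigotimes^L\mathbb C^N$ be the subspace on which $X_1\cdots X_L=\omega^Q$. The superintegrable $\tau^{(2)}$-model is $\tau^{(2)}(t)=A(\omega t)+\omega^rD(\omega t)$, where $\begin{pmatrix}A(t)&B(t)\\C(t)&D(t)\end{pmatrix}$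 is the monodromy matrix (ordered product over sites $1,\dots,L$) of $$\begin{pmatrix}1-tX&(1-\omega^{1+m}X)Z\\-t(1-\omega^mX)Z^{-1}&-t+\omega^{1+2m}X\end{pmatrix}.$$ The XXZ chain is $\mathcal T(s)=\mathcal A(s)+q^{-2r}\mathcal D(s)$ $(s\neq0)$, where $\mathcal A,\mathcal B,\mathcal C,\mathcal D$ are the monodromy entries of $$\begin{pmatrix}q^{1+2m}sK^{-1/2}-s^{-1}K^{1/2}&(q-q^{-1})e^-\\(q-q^{-1})e^+&sK^{1/2}-q^{-1-2m}s^{-1}K^{-1/2}\end{pmatrix},$$ with $K^{1/2}=q^{1/2+m}\widehat Z^{-1/2}$, $e^+=q^{-1/2}\frac{q^{-m}\widehat Z^{1/2}-q^m\widehat Z^{-1/2}}{q-q^{-1}}\widehat X$, $e^-=q^{1/2}\frac{q^{1+m}\widehat Z^{-1/2}-q^{-1-m}\widehat Z^{1/2}}{q-q^{-1}}\widehat X^{-1}$. On the chain, $K^{1/2}$ denotes $\bigotimes_\ell K_\ell^{1/2}$. With $\rho=q^{-2m-1}$ and $n\ge0$ put $$\mathcal B_\pm^{(n)}=\sum_{0\le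 k_i<N,\ k_1+\cdots+k_L=n}\frac{\beta_\pm(k)}{[k_1]!\cdots[k_L]!}\bigotimes_{i=1}^LK_i^{\pm\frac12(\sum_{j<i}k_j-\sum_{j>i}k_j)}(e_i^-)^{k_i},$$ $$\mathcal C_\pm^{(n)}=\sum_{0\le k_i<N,\ k_1+\cdots+k_L=n}\frac{\gamma_\pm(k)}{[k_1]!\cdots[k_L]!}\bigotimes_{i=1}^LK_i^{\mp\frac12(\sum_{j<i}k_j-\sum_{j>i}k_j)}(e_i^+)^{k_i},$$ where $\beta_+=\prod_i\rho^{-\sum_{j>i}k_j}$, $\beta_-=\prod_i\rho^{\sum_{j<i}k_j}$, $\gamma_+=\prod_i\rho^{-\sum_{j<i}k_j}$, $\gamma_-=\prod_i\rho^{\sum_{j>i}k_j}$. **Statement.** (1) $K^{1/2},e^\pm$ form a $U_q(sl_2)$-representation: $K^{1/2}e^\pm K^{-1/2}=q^{\pm1}e^\pm$, $[e^+,e^-]=\frac{K-K^{-1}}{q-q^{-1}}$; it has spin $\frac{N-1}2$: for $\mathbf e^k=\widehat{|k-m}\rangle$, $0\le k\le N-1$, one has $K^{1/2}\mathbf e^k=q^{k-\frac{N-1}2}\mathbf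 e^k$, $e^+\mathbf e^k=q^{-1/2}[N-1-k]\mathbf e^{k+1}$, $e^-\mathbf e^k=q^{1/2}[k]\mathbf e^{k-1}$. (2) For all $s\ne0$, $\tau^{(2)}(s^2)=(-q^{-1}s)^LK^{-1/2}\mathcal T(q^{-1}s)$. (3) For all $s\neq 0$ and $t=s^2$: $A(t)=(-s)^LK^{-1/2}\mathcal A(s)$, $D(t)=(-s)^LK^{-1/2}\mathcal D(s)$, $B(t)=(-s)^{L-1}q^{-1}K^{-1/2}\mathcal B(s)$, $C(t)=(-s)^{L+1}qK^{-1/2}\mathcal C(s)$. (4) Let $v_1,\dots,v_J\neq0$, $F(t)=\prod_j(1+\omega v_jt)$, $s_j^2=-(\omega v_j)^{-1}$, $f_{a,b}=\frac{a^2q^2-b^2}{q(a^2-b^2)}$ and $P_a,P_b\in\mathbb Z$. A vector $\psi$ satisfies $$\tau^{(2)}(t)\psi=\Big(\omega^{-P_a}(1-\omega^{-m}t)^L\tfrac{F(t)}{F(\omega t)}+\omega^{P_b}(1-\omega^{1-m}t)^L\tfrac{F(\omega^2t)}{F(\omega t)}\Big)\psi$$ for all $t$ with $F(\omega t)\neq0$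 if and only if $$(-s)^LK^{-1/2}\mathcal T(s)\psi=\Big(q^{2P_a+J}(1-q^{2m+2}s^2)^L\prod_if_{s,s_i}+q^{-2P_b-J}(1-q^{2m}s^2)^L\prod_if_{s_i,s}\Big)\psi$$ for all $s\ne0$ with $s^2\notin\{s_i^2\}$. The Bethe equations $$\Big(\frac{v_i+\omega^{-1-m}}{v_i+\omega^{-2-m}}\Big)^L=-\omega^{-P_a-P_b}\prod_{j=1}^J\frac{v_i-\omega^{-1}v_j}{v_i-\omega v_j}\quad(1\le i\le J)$$ hold (with nonzero denominators) if and only if $$\Big(\frac{1-q^{2m+2}s_j^2}{1-q^{2m}s_j^2}\Big)^L=-q^{-2(P_a+P_b+J)}\prod_{i=1}^J\frac{q^2s_i^2-s_j^2}{s_i^2-q^2s_j^2}\quad(1\le j\le J)$$ hold (with nonzero denominators). If moreover $0\ne\psi\in V_{r,Q}$ satisfies the first relation, then $P_b-P_a\equiv(1+2m)L+Q+r$. (5) For every $Q$, the operators $\tau^{(2)}(t)$ (all $t$) and $\mathcal T(s)$ (all $s\neq0$) preserve $V_{r,Q}$, and so do the following products, with which they commute on $V_{r,Q}$, for non-negative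 integers with the stated residues: $\mathcal C_+^{(n_+')}\mathcal B_+^{(n_+)}$, $\mathcal B_+^{(p_+')}\mathcal C_+^{(p_+)}$, $\mathcal C_-^{(n_-')}\mathcal B_-^{(n_-)}$, $\mathcal B_-^{(p_-')}\mathcal C_-^{(p_-)}$, where $n_+\equiv n_+'\equiv-p_+\equiv-p_+'\equiv Q-r$ and $n_-\equiv n_-'\equiv-p_-\equiv-p_-'\equiv(1+2m)L+Q+r$. (6) Suppose $2r+(2m+1)L\equiv0$ and let $n,n''\geq 0$ with $n\equiv-n''\equiv Q+L(m-M)$. Then $K=q^{2n}$ on $V_{r,Q}$, and each of the operators $\mathcal O=\mathcal C_+^{(n'')}\mathcal B_-^{(n)}$, $\mathcal C_-^{(n'')}\mathcal B_+^{(n)}$, $\mathcal B_-^{(n)}\mathcal C_+^{(n'')}$, $\mathcal B_+^{(n)}\mathcal C_-^{(n'')}$ maps $V_{r,Q}$ to $V_{r,2r-Q}$ and satisfies, on $V_{r,Q}$, $\mathcal T(s)\mathcal O=\mathcal O\mathcal T(s)$ for all $s\ne0$ and $\tau^{(2)}(t)\mathcal O=q^{2n}\,\mathcal O\,\tau^{(2)}(t)$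 for all $t$. In particular, if $Q\equiv r$ (equivalently $n\equiv0$), then $\mathcal O$, $\mathcal T(s)$ and $\tau^{(2)}(t)$ preserve $V_{r,Q}$ and $\mathcal O$ commutes there with both $\tau^{(2)}(t)$ and $\mathcal T(s)$. -/

import Mathlib

namespace TauXXZ

noncomputable section

/-! Throughout, the number of spin states is the odd number `N = 2 * M + 1`. -/

/-- Local spin values, the integers modulo `N = 2 M + 1`. -/
abbrev Spin (M : ℕ) := ZMod (2 * M + 1)

/-- Spin configurations of a chain of `L` sites. -/
abbrev Conf (M L : ℕ) := Fin L → Spin M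

/-- Operators on the local quantum space `ℂ^N`, as matrices in the canonical basis `|σ⟩`. -/
abbrev LocOp (M : ℕ) := Matrix (Spin M) (Spin M) ℂ

/-- Operators on the quantum space `⨂^L ℂ^N`, as matrices in the canonical basis
`|σ₁, …, σ_L⟩`. -/
abbrev ChainOp (M L : ℕ) := Matrix (Conf M L) (Conf M L) ℂ

/-- `ω = exp (2 π i / N)`. -/
def omega (M : ℕ) : ℂ := Complex.exp (2 * Real.pi * Complex.I / ((2 * M + 1 : ℕ) : ℂ))

/-- `q = ω ^ M = ω ^ (-1/2)`. -/
def q (M : ℕ) : ℂ := omega M ^ M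

/-- `q ^ (1/2)`, the square root of `q` which is an `N`-th root of unity
(`q ^ N = 1` and `M + 1 = (N + 1) / 2`). -/
def qHalf (M : ℕ) : ℂ := q M ^ (M + 1)

/-- The `q`-integer `[n]`. -/
def qInt (M : ℕ) (n : ℤ) : ℂ := (q M ^ n - q M ^ (-n)) / (q M - (q M)⁻¹)

/-- The `q`-factorial `[n]! = [1] ⋯ [n]`. -/
def qFact (M n : ℕ) : ℂ := ∏ i ∈ Finset.range n, qInt M ((i : ℤ) + 1)

/-! ### Weyl operators -/

/-- `X |σ⟩ = |σ + 1⟩`. -/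
def weylX (M : ℕ) : LocOp M := Matrix.of fun a b => if a = b + 1 then 1 else 0

/-- `Z |σ⟩ = ω ^ σ |σ⟩`. -/
def weylZ (M : ℕ) : LocOp M := Matrix.diagonal fun a => omega M ^ a.val

/-- `Ẑ`, the diagonal Weyl operator of the Fourier basis; it is `X`. -/
def weylZhat (M : ℕ) : LocOp M := weylX M

/-- `X̂`, the shift operator of the Fourier basis; it is `Z⁻¹`. -/
def weylXhat (M : ℕ) : LocOp M := (weylZ M)⁻¹

/-- `Ẑ ^ (1/2)`, the square root of `Ẑ` with `N`-th power one (eigenvalue `q ^ (-k)` on `|k̂⟩`). -/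
def weylZhatHalf (M : ℕ) : LocOp M := weylZhat M ^ (M + 1)

/-- The Fourier basis vector `|k̂⟩`. -/
def fourierKet (M : ℕ) (k : Spin M) : Spin M → ℂ :=
  fun σ => ((Real.sqrt (2 * M + 1 : ℕ) : ℝ) : ℂ)⁻¹ * omega M ^ (-((k * σ).val : ℤ))

/-! ### Operators on the chain -/

/-- The tensor product `O₁ ⊗ ⋯ ⊗ O_L`. -/
def tensor {M L : ℕ} (O : Fin L → LocOp M) : ChainOp M L :=
  Matrix.of fun σ τ => ∏ i, O i (σ i) (τ i)

/-- The local operator `O` acting at the site `i`. -/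
def site {M L : ℕ} (i : Fin L) (O : LocOp M) : ChainOp M L :=
  tensor (Function.update (fun _ => 1) i O)

/-- The monodromy matrix `L₁ L₂ ⋯ L_L` of a homogeneous chain with given local `L`-operator. -/
def monodromy {M : ℕ} (L : ℕ) (loc : Matrix (Fin 2) (Fin 2) (LocOp M)) :
    Matrix (Fin 2) (Fin 2) (ChainOp M L) :=
  (List.ofFn fun i : Fin L => loc.map (site i)).prod

/-- The charge-`Q` subspace, on which `X = X₁ ⋯ X_L` is `ω ^ Q`. -/
def chargeSpace (M L : ℕ) (Q : ℤ) : Submodule ℂ (Conf M L → ℂ) :=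
  LinearMap.ker (Matrix.mulVecLin (tensor (L := L) fun _ => weylX M) -
    (omega M ^ Q) • (LinearMap.id : (Conf M L → ℂ) →ₗ[ℂ] (Conf M L → ℂ)))

/-! ### The superintegrable `τ⁽²⁾`-model -/

/-- The superintegrable `L`-operator of the `τ⁽²⁾`-model. -/
def tauL (M m : ℕ) (t : ℂ) : Matrix (Fin 2) (Fin 2) (LocOp M) :=
  !![1 - t • weylX M, (1 - omega M ^ (1 + m) • weylX M) * weylZ M;
     (-t) • ((1 - omega M ^ m • weylX M) * (weylZ M)⁻¹),
     (-t) • (1 : LocOp M) + omega M ^ (1 + 2 * m) • weylX M]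

/-- The monodromy matrix of the `τ⁽²⁾`-model, with entries `A(t), B(t), C(t), D(t)`. -/
def tauMon (M L m : ℕ) (t : ℂ) : Matrix (Fin 2) (Fin 2) (ChainOp M L) :=
  monodromy L (tauL M m t)

/-- `τ⁽²⁾(t) = A(ω t) + ω ^ r D(ω t)`. -/
def tau2 (M L m : ℕ) (r : ℤ) (t : ℂ) : ChainOp M L :=
  tauMon M L m (omega M * t) 0 0 + omega M ^ r • tauMon M L m (omega M * t) 1 1

/-! ### The XXZ chain -/

/-- `K ^ (1/2) = q ^ (1/2 + m) Ẑ ^ (-1/2)` on `ℂ^N`. -/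
def kHalf (M m : ℕ) : LocOp M := (qHalf M * q M ^ m) • (weylZhatHalf M)⁻¹

/-- `e⁺ = q ^ (-1/2) (q ^ (-m) Ẑ ^ (1/2) - q ^ m Ẑ ^ (-1/2)) X̂ / (q - q⁻¹)` on `ℂ^N`. -/
def ePlus (M m : ℕ) : LocOp M :=
  ((qHalf M)⁻¹ / (q M - (q M)⁻¹)) •
    ((((q M)⁻¹ ^ m) • weylZhatHalf M - (q M ^ m) • (weylZhatHalf M)⁻¹) * weylXhat M)

/-- `e⁻ = q ^ (1/2) (q ^ (1 + m) Ẑ ^ (-1/2) - q ^ (-1 - m) Ẑ ^ (1/2)) X̂⁻¹ / (q - q⁻¹)`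
on `ℂ^N`. -/
def eMinus (M m : ℕ) : LocOp M :=
  (qHalf M / (q M - (q M)⁻¹)) •
    (((q M ^ (1 + m)) • (weylZhatHalf M)⁻¹ - ((q M)⁻¹ ^ (1 + m)) • weylZhatHalf M) *
      (weylXhat M)⁻¹)

/-- The `L`-operator of the XXZ chain (meaningful for `s ≠ 0`). -/
def xxzL (M m : ℕ) (s : ℂ) : Matrix (Fin 2) (Fin 2) (LocOp M) :=
  !![(q M ^ (1 + 2 * m) * s) • (kHalf M m)⁻¹ - s⁻¹ • kHalf M m, (q M - (q M)⁻¹) • eMinus M m;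
     (q M - (q M)⁻¹) • ePlus M m, s • kHalf M m - ((q M)⁻¹ ^ (1 + 2 * m) * s⁻¹) • (kHalf M m)⁻¹]

/-- The monodromy matrix of the XXZ chain, with entries `𝓐(s), 𝓑(s), 𝓒(s), 𝓓(s)`. -/
def xxzMon (M L m : ℕ) (s : ℂ) : Matrix (Fin 2) (Fin 2) (ChainOp M L) :=
  monodromy L (xxzL M m s)

/-- The transfer matrix `𝓣(s) = 𝓐(s) + q ^ (-2 r) 𝓓(s)`. -/
def xxzT (M L m : ℕ) (r : ℤ) (s : ℂ) : ChainOp M L :=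
  xxzMon M L m s 0 0 + q M ^ (-2 * r) • xxzMon M L m s 1 1

/-- `K ^ (1/2)` on the chain: the tensor product of the local operators `K ^ (1/2)`. -/
def kHalfTot (M L m : ℕ) : ChainOp M L := tensor fun _ => kHalf M m

/-! ### Normalized powers -/

/-- `ρ = q ^ (-2 m - 1)`. -/
def rho (M m : ℕ) : ℂ := (q M)⁻¹ ^ (2 * m + 1)

/-- `∑_{j < i} k_j`. -/
def below {M L : ℕ} (k : Fin L → Fin (2 * M + 1)) (i : Fin L) : ℤ :=
  ∑ j ∈ Finset.univ.filter (fun j => j < i), ((k j : ℕ) : ℤ)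

/-- `∑_{j > i} k_j`. -/
def above {M L : ℕ} (k : Fin L → Fin (2 * M + 1)) (i : Fin L) : ℤ :=
  ∑ j ∈ Finset.univ.filter (fun j => i < j), ((k j : ℕ) : ℤ)

/-- The sum over all `0 ≤ k_i < N` with `k_1 + ⋯ + k_L = n` of
`([k_1]! ⋯ [k_L]!)⁻¹ ⨂_i O k i`. -/
def powerSum {M L : ℕ} (n : ℕ) (O : (Fin L → Fin (2 * M + 1)) → Fin L → LocOp M) :
    ChainOp M L :=
  ∑ k ∈ Finset.univ.filter (fun k : Fin L → Fin (2 * M + 1) => ∑ i, (k i : ℕ) = n),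
    (∏ i, qFact M (k i))⁻¹ • tensor (O k)

/-- `𝓑₊⁽ⁿ⁾`, the limit of `𝓑₊ ^ n / [n]!` at the root of unity `q`. -/
def bPlus (M L m n : ℕ) : ChainOp M L :=
  powerSum n fun k i =>
    (rho M m ^ (-above k i)) • (kHalf M m ^ (below k i - above k i) * eMinus M m ^ (k i : ℕ))

/-- `𝓑₋⁽ⁿ⁾`. -/
def bMinus (M L m n : ℕ) : ChainOp M L :=
  powerSum n fun k i =>
    (rho M m ^ below k i) • (kHalf M m ^ (-(below k i - above k i)) * eMinus M m ^ (k i : ℕ))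

/-- `𝓒₊⁽ⁿ⁾`. -/
def cPlus (M L m n : ℕ) : ChainOp M L :=
  powerSum n fun k i =>
    (rho M m ^ (-below k i)) • (kHalf M m ^ (-(below k i - above k i)) * ePlus M m ^ (k i : ℕ))

/-- `𝓒₋⁽ⁿ⁾`. -/
def cMinus (M L m n : ℕ) : ChainOp M L :=
  powerSum n fun k i =>
    (rho M m ^ above k i) • (kHalf M m ^ (below k i - above k i) * ePlus M m ^ (k i : ℕ))

/-! ### Eigenvalue relations and Bethe equations -/

/-- `F(t) = ∏_j (1 + ω v_j t)`. -/
def betheF (M : ℕ) {J : ℕ} (v : Fin J → ℂ) (t : ℂ) : ℂ := ∏ j, (1 + omega M * v j * t)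

/-- `f_{a, b} = (a² q² - b²) / (q (a² - b²))`. -/
def fFun (M : ℕ) (a b : ℂ) : ℂ := (a ^ 2 * q M ^ 2 - b ^ 2) / (q M * (a ^ 2 - b ^ 2))

/-- `ψ` is in the eigenspace of `τ⁽²⁾` for the eigenvalue (as a function of `t`) with quantum
numbers `P_a, P_b` and polynomial `F`; the formula is read where its denominator is not zero. -/
def TauRelation (M L m : ℕ) (r : ℤ) {J : ℕ} (v : Fin J → ℂ) (Pa Pb : ℤ)
    (ψ : Conf M L → ℂ) : Prop :=
  ∀ t : ℂ, betheF M v (omega M * t) ≠ 0 →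
    (tau2 M L m r t).mulVec ψ =
      (omega M ^ (-Pa) * (1 - omega M ^ (-(m : ℤ)) * t) ^ L *
          (betheF M v t / betheF M v (omega M * t)) +
        omega M ^ Pb * (1 - omega M ^ (1 - (m : ℤ)) * t) ^ L *
          (betheF M v (omega M ^ 2 * t) / betheF M v (omega M * t))) • ψ

/-- The corresponding relation for `(-s) ^ L K ^ (-1/2) 𝓣(s)`. -/
def XXZRelation (M L m : ℕ) (r : ℤ) {J : ℕ} (x : Fin J → ℂ) (Pa Pb : ℤ)
    (ψ : Conf M L → ℂ) : Prop :=
  ∀ s : ℂ, s ≠ 0 → (∀ i, s ^ 2 ≠ x i ^ 2) →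
    ((-s) ^ L • ((kHalfTot M L m)⁻¹ * xxzT M L m r s)).mulVec ψ =
      (q M ^ (2 * Pa + J) * (1 - q M ^ (2 * m + 2) * s ^ 2) ^ L * ∏ i, fFun M s (x i) +
        q M ^ (-2 * Pb - J) * (1 - q M ^ (2 * m) * s ^ 2) ^ L * ∏ i, fFun M (x i) s) • ψ

/-- The Bethe equation of the `τ⁽²⁾`-model, with all denominators different from zero. -/
def TauBethe (M L m : ℕ) {J : ℕ} (v : Fin J → ℂ) (Pa Pb : ℤ) : Prop :=
  ∀ i, v i + omega M ^ (-2 - (m : ℤ)) ≠ 0 ∧ (∀ j, v i - omega M * v j ≠ 0) ∧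
    ((v i + omega M ^ (-1 - (m : ℤ))) / (v i + omega M ^ (-2 - (m : ℤ)))) ^ L =
      -omega M ^ (-Pa - Pb) *
        ∏ j, (v i - (omega M)⁻¹ * v j) / (v i - omega M * v j)

/-- The Bethe equation of the XXZ chain, with all denominators different from zero. -/
def XXZBethe (M L m : ℕ) {J : ℕ} (x : Fin J → ℂ) (Pa Pb : ℤ) : Prop :=
  ∀ j, 1 - q M ^ (2 * m) * x j ^ 2 ≠ 0 ∧ (∀ i, x i ^ 2 - q M ^ 2 * x j ^ 2 ≠ 0) ∧
    ((1 - q M ^ (2 * m + 2) * x j ^ 2) / (1 - q M ^ (2 * m) * x j ^ 2)) ^ L =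
      -q M ^ (-2 * (Pa + Pb + J)) *
        ∏ i, (q M ^ 2 * x i ^ 2 - x j ^ 2) / (x i ^ 2 - q M ^ 2 * x j ^ 2)

/-! ### Commutation on subspaces -/

/-- `A` and `B` preserve the subspace `V` and their restrictions to `V` commute. -/
def CommuteOn {M L : ℕ} (V : Submodule ℂ (Conf M L → ℂ)) (A B : ChainOp M L) : Prop :=
  (∀ v ∈ V, A.mulVec v ∈ V) ∧ (∀ v ∈ V, B.mulVec v ∈ V) ∧
    ∀ v ∈ V, A.mulVec (B.mulVec v) = B.mulVec (A.mulVec v)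

/-- `τ⁽²⁾(t)` (for all `t`) and `𝓣(s)` (for all `s ≠ 0`) commute with `B` on the charge-`Q`
subspace. -/
def ModelsCommute (M L m : ℕ) (r Q : ℤ) (B : ChainOp M L) : Prop :=
  (∀ t : ℂ, CommuteOn (chargeSpace M L Q) (tau2 M L m r t) B) ∧
    ∀ s : ℂ, s ≠ 0 → CommuteOn (chargeSpace M L Q) (xxzT M L m r s) B

/-- `B` maps the charge-`Q` subspace to the charge-`Q'` subspace; on the charge-`Q` subspace it
commutes with `𝓣(s)`, and with `τ⁽²⁾(t)` up to the scalar `c`. -/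
def MixedCommute (M L m : ℕ) (r Q Q' : ℤ) (c : ℂ) (B : ChainOp M L) : Prop :=
  (∀ v ∈ chargeSpace M L Q, B.mulVec v ∈ chargeSpace M L Q') ∧
    (∀ s : ℂ, s ≠ 0 → ∀ v ∈ chargeSpace M L Q,
      (xxzT M L m r s).mulVec (B.mulVec v) = B.mulVec ((xxzT M L m r s).mulVec v)) ∧
    ∀ t : ℂ, ∀ v ∈ chargeSpace M L Q,
      (tau2 M L m r t).mulVec (B.mulVec v) = c • B.mulVec ((tau2 M L m r t).mulVec v)

end

end TauXXZ

open TauXXZ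

namespace TauXXZ

/-! ### Roots of unity -/

/-! Comparison of the models. Conjugation by diag(1, -sq) in the auxiliary space turns the XXZ
L-operator at s, multiplied by -s K^(-1/2), into the τ⁽²⁾ L-operator at t = s² (`tauL_eq`). The
conjugation telescopes along the chain (`tauMon_eq`), which gives the identities between monodromy
entries and between transfer matrices. The eigenvalue relations and Bethe equations are translated
by s_j² = -(ω v_j)⁻¹, and continuity in t supplies t = 0, which no s ≠ 0 reaches. The congruence for
P_b - P_a is read off at t = 0, where the relation says that 1 plus a root of unity is a sum of two
roots of unity.

Commuting operators. The XXZ L-operator intertwines the two orders of the coproduct of the divided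
powers e^n/[n]! on a site and on a two-dimensional auxiliary space. By coassociativity this passes
to products (`intertwine_mul`), hence to the monodromy matrix (`monodromy_intertwines`). In entries
it says that A + zD moves through the n-th divided power of the chain, up to a scalar, with z
replaced by z q^(±2n) and with a remainder X (g - z), where g is a multiple of K or K⁻¹
(`Intertwines.exists_transfer_mul`). The charge fixes K, so on V_{r,Q} the remainder vanishes if Q ≡
r (plus operators) or (1+2m)L + Q + r ≡ 0 (minus operators). What is left is a shift of the boundary
condition r. Two powers with opposite shifts compose to an operator commuting with 𝓣(s). If 2r +
(2m+1)L ≡ 0, the two conditions coincide and plus and minus operators can be mixed; the factor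
q^(2n) for τ⁽²⁾ is the effect of K^(-1/2).

Root of unity. As [N] = 0, the powers e^n/[n]! make sense only for n < N. Because e^N = 0, they can
be continued by 0, and all relations survive the truncation (`dividedPowers_of_weyl`). -/

theorem omega_primitive (M : ℕ) : IsPrimitiveRoot (omega M) (2 * M + 1) :=
  Complex.isPrimitiveRoot_exp _ (by omega)

theorem omega_ne_zero (M : ℕ) : omega M ≠ 0 := (omega_primitive M).ne_zero (by omega)

theorem omega_pow_period (M : ℕ) : omega M ^ (2 * M + 1) = 1 := (omega_primitive M).pow_eq_one

theorem q_ne_zero (M : ℕ) : q M ≠ 0 := pow_ne_zero _ (omega_ne_zero M)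

theorem q_pow_period (M : ℕ) : q M ^ (2 * M + 1) = 1 := by
  rw [q, ← pow_mul, mul_comm, pow_mul, omega_pow_period, one_pow]

theorem q_primitive (M : ℕ) : IsPrimitiveRoot (q M) (2 * M + 1) :=
  (omega_primitive M).pow_of_coprime M (by
    rw [show 2 * M + 1 = 1 + M * 2 by ring]; simp)

theorem omega_eq_q_zpow (M : ℕ) : omega M = q M ^ (-2 : ℤ) := by
  have h : omega M * q M ^ 2 = 1 := by
    rw [q, ← pow_mul, ← pow_succ', mul_comm M 2, omega_pow_period]
  rw [zpow_neg]
  exact eq_inv_of_mul_eq_one_left (by exact_mod_cast h)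

theorem omega_zpow (M : ℕ) (n : ℤ) : omega M ^ n = q M ^ (-2 * n) := by
  rw [omega_eq_q_zpow, ← zpow_mul]

theorem q_zpow_congr {M : ℕ} {a b : ℤ} (h : a ≡ b [ZMOD (2 * M + 1 : ℕ)]) :
    q M ^ a = q M ^ b := by
  obtain ⟨c, hc⟩ := h.symm.dvd
  have : a = b + (2 * M + 1 : ℕ) * c := by linarith
  rw [this, zpow_add₀ (q_ne_zero M), zpow_mul, zpow_natCast, q_pow_period, one_zpow, mul_one]

theorem omega_zpow_congr {M : ℕ} {a b : ℤ} (h : a ≡ b [ZMOD (2 * M + 1 : ℕ)]) :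
    omega M ^ a = omega M ^ b := by
  rw [omega_zpow, omega_zpow]
  exact q_zpow_congr (h.mul_left _)

theorem q_zpow_eq_iff {M : ℕ} {a b : ℤ} :
    q M ^ a = q M ^ b ↔ a ≡ b [ZMOD (2 * M + 1 : ℕ)] := by
  refine ⟨fun h => ?_, q_zpow_congr⟩
  have h1 : q M ^ (b - a) = 1 := by
    rw [zpow_sub₀ (q_ne_zero M), h, div_self (zpow_ne_zero _ (q_ne_zero M))]
  rw [Int.modEq_iff_dvd]
  exact ((q_primitive M).zpow_eq_one_iff_dvd _).1 h1

theorem qHalf_ne_zero (M : ℕ) : qHalf M ≠ 0 := pow_ne_zero _ (q_ne_zero M)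

theorem qHalf_sq (M : ℕ) : qHalf M ^ 2 = q M := by
  rw [qHalf, ← pow_mul, show (M + 1) * 2 = (2 * M + 1) + 1 by ring, pow_succ, q_pow_period, one_mul]

theorem q_sub_inv_ne_zero {M : ℕ} (hM : 1 ≤ M) : q M - (q M)⁻¹ ≠ 0 := by
  intro h
  have h1 : q M ^ (1 : ℤ) = q M ^ (-1 : ℤ) := by
    rw [zpow_one, zpow_neg_one]; exact sub_eq_zero.1 h
  have h2 := (q_zpow_eq_iff.1 h1).dvd
  have := Int.le_of_dvd (a := ((2 * M + 1 : ℕ) : ℤ)) (b := 2) (by norm_num) (by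
    have := h2.neg_right; simpa using this)
  omega

theorem sub_mul_qInt {M : ℕ} (hM : 1 ≤ M) (n : ℤ) :
    (q M - (q M)⁻¹) * qInt M n = q M ^ n - q M ^ (-n) := by
  rw [qInt, mul_div_cancel₀ _ (q_sub_inv_ne_zero hM)]

/-- The vanishing of [n] means q^(2n) = 1, and 2 is invertible modulo the odd number N. -/
theorem qInt_eq_zero_iff {M : ℕ} (hM : 1 ≤ M) (n : ℤ) :
    qInt M n = 0 ↔ ((2 * M + 1 : ℕ) : ℤ) ∣ n := by
  rw [qInt, div_eq_zero_iff, or_iff_left (q_sub_inv_ne_zero hM), sub_eq_zero, q_zpow_eq_iff,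
    Int.modEq_iff_dvd]
  have : IsCoprime ((2 * M + 1 : ℕ) : ℤ) (-2) := ⟨1, M, by push_cast; ring⟩
  rw [show -n - n = -2 * n by ring]
  exact ⟨fun h => this.dvd_of_dvd_mul_left h, fun h => h.mul_left _⟩

theorem qFact_succ (M n : ℕ) : qFact M (n + 1) = qFact M n * qInt M ((n : ℤ) + 1) := by
  rw [qFact, Finset.prod_range_succ, ← qFact]

theorem qFact_zero (M : ℕ) : qFact M 0 = 1 := by simp [qFact]

/-- The factor [N] occurs from n = N on. Since 0⁻¹ = 0, the expression `(qFact M n)⁻¹ • e ^ n` is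
then 0, which is the wanted truncation of the divided powers. -/
theorem qFact_eq_zero {M : ℕ} (hM : 1 ≤ M) {n : ℕ} (hn : 2 * M + 1 ≤ n) : qFact M n = 0 :=
  Finset.prod_eq_zero (i := 2 * M) (by simp; omega) (by
    rw [qInt_eq_zero_iff hM]; push_cast; exact dvd_rfl)

theorem qFact_ne_zero {M : ℕ} (hM : 1 ≤ M) {n : ℕ} (hn : n < 2 * M + 1) : qFact M n ≠ 0 :=
  Finset.prod_ne_zero_iff.2 fun i hi => by
    rw [Finset.mem_range] at hi
    rw [Ne, qInt_eq_zero_iff hM]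
    intro h
    have := Int.le_of_dvd (by omega) h
    push_cast at this; omega

/-! ### Weyl operators -/

theorem omega_pow_val_add (M : ℕ) (a b : Spin M) :
    omega M ^ (a + b).val = omega M ^ a.val * omega M ^ b.val := by
  rw [ZMod.val_add, ← pow_add]
  exact (pow_eq_pow_mod _ (omega_pow_period M)).symm

theorem omega_pow_val_natCast (M n : ℕ) : omega M ^ (n : Spin M).val = omega M ^ n := by
  rw [ZMod.val_natCast]
  exact (pow_eq_pow_mod _ (omega_pow_period M)).symm

theorem omega_pow_val_one (M : ℕ) : omega M ^ (1 : Spin M).val = omega M := by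
  simpa using omega_pow_val_natCast M 1

theorem weylX_pow (M n : ℕ) :
    weylX M ^ n = Matrix.of fun a b : Spin M => if a = b + n then 1 else 0 := by
  induction n with
  | zero => ext a b; simp [Matrix.one_apply]
  | succ n ih =>
    ext a b
    rw [pow_succ, ih]
    simp only [Matrix.mul_apply, Matrix.of_apply, weylX, mul_ite, mul_one, mul_zero]
    rw [Finset.sum_ite_eq']
    simp only [Finset.mem_univ, if_true]
    push_cast
    congr 1
    rw [add_assoc, add_comm (1 : Spin M)]

theorem weylX_pow_period (M : ℕ) : weylX M ^ (2 * M + 1) = 1 := by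
  rw [weylX_pow]
  have : ((2 * M + 1 : ℕ) : Spin M) = 0 := ZMod.natCast_self _
  ext a b
  simp only [this, Matrix.of_apply, add_zero, Matrix.one_apply]

theorem weylZ_mul_inv (M : ℕ) :
    weylZ M * Matrix.diagonal (fun a : Spin M => (omega M ^ a.val)⁻¹) = 1 := by
  rw [weylZ, Matrix.diagonal_mul_diagonal]
  simp [omega_ne_zero]

theorem isUnit_weylZ_det (M : ℕ) : IsUnit (weylZ M).det :=
  (Matrix.isUnit_iff_isUnit_det _).1 (IsUnit.of_mul_eq_one _ (weylZ_mul_inv M))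

theorem weylZ_mul_weylX (M : ℕ) : weylZ M * weylX M = omega M • (weylX M * weylZ M) := by
  ext a b
  simp only [weylZ, weylX, Matrix.diagonal_mul, Matrix.smul_apply, Matrix.mul_diagonal,
    Matrix.of_apply, smul_eq_mul]
  split_ifs with h
  · rw [h, omega_pow_val_add, omega_pow_val_one]; ring
  · simp

theorem weylZ_mul_weylX_pow (M n : ℕ) :
    weylZ M * weylX M ^ n = omega M ^ n • (weylX M ^ n * weylZ M) := by
  induction n with
  | zero => simp
  | succ n ih =>
    rw [pow_succ, ← mul_assoc, ih, smul_mul_assoc, mul_assoc, weylZ_mul_weylX, mul_smul_comm,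
      smul_smul, ← mul_assoc, pow_succ]

theorem weylZhatHalf_sq (M : ℕ) : weylZhatHalf M * weylZhatHalf M = weylX M := by
  rw [weylZhatHalf, weylZhat, ← pow_add, show M + 1 + (M + 1) = 2 * M + 1 + 1 by ring, pow_succ,
    weylX_pow_period, one_mul]

theorem weylZhatHalf_mul_pow (M : ℕ) : weylZhatHalf M * weylX M ^ M = 1 := by
  rw [weylZhatHalf, weylZhat, ← pow_add, show M + 1 + M = 2 * M + 1 by ring, weylX_pow_period]

theorem weylZhatHalf_inv (M : ℕ) : (weylZhatHalf M)⁻¹ = weylX M ^ M :=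
  Matrix.inv_eq_right_inv (weylZhatHalf_mul_pow M)

/-! ### The local operators `K ^ (1/2)`, `e⁺`, `e⁻` -/

/-- The scalar `q ^ (1/2 + m)` of `K ^ (1/2)`. -/
noncomputable def kScalar (M m : ℕ) : ℂ := qHalf M * q M ^ m

theorem kScalar_ne_zero (M m : ℕ) : kScalar M m ≠ 0 :=
  mul_ne_zero (qHalf_ne_zero M) (pow_ne_zero _ (q_ne_zero M))

theorem kScalar_sq (M m : ℕ) : kScalar M m ^ 2 = q M ^ (2 * m + 1) := by
  rw [kScalar, mul_pow, qHalf_sq, ← pow_mul, mul_comm m 2, pow_succ']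

theorem kScalar_pow_period (M m : ℕ) : kScalar M m ^ (2 * M + 1) = 1 := by
  rw [kScalar, qHalf, mul_pow, ← pow_mul, ← pow_mul, mul_comm _ (2 * M + 1), mul_comm m, pow_mul,
    pow_mul, q_pow_period, one_pow, one_pow, one_mul]

theorem kHalf_eq (M m : ℕ) : kHalf M m = kScalar M m • (weylZhatHalf M)⁻¹ := rfl

theorem kHalf_mul (M m : ℕ) :
    kHalf M m * ((kScalar M m)⁻¹ • weylZhatHalf M) = 1 := by
  rw [kHalf_eq, weylZhatHalf_inv, smul_mul_smul_comm, mul_inv_cancel₀ (kScalar_ne_zero M m),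
    one_smul]
  exact mul_eq_one_comm.1 (weylZhatHalf_mul_pow M)

theorem isUnit_kHalf_det (M m : ℕ) : IsUnit (kHalf M m).det :=
  (Matrix.isUnit_iff_isUnit_det _).1 (IsUnit.of_mul_eq_one _ (kHalf_mul M m))

theorem kHalf_inv (M m : ℕ) : (kHalf M m)⁻¹ = (kScalar M m)⁻¹ • weylZhatHalf M :=
  Matrix.inv_eq_right_inv (kHalf_mul M m)

theorem kHalf_pow_period (M m : ℕ) : kHalf M m ^ (2 * M + 1) = 1 := by
  rw [kHalf_eq, weylZhatHalf_inv, smul_pow, kScalar_pow_period, one_smul, ← pow_mul,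
    mul_comm M (2 * M + 1), pow_mul, weylX_pow_period, one_pow]

theorem kHalf_mul_weylZ (M m : ℕ) :
    kHalf M m * weylZ M = (q M)⁻¹ • (weylZ M * kHalf M m) := by
  rw [kHalf_eq, weylZhatHalf_inv, mul_smul_comm, weylZ_mul_weylX_pow, ← q, smul_mul_assoc,
    smul_comm (q M)⁻¹, smul_smul (q M)⁻¹, inv_mul_cancel₀ (q_ne_zero M), one_smul]

/-- The scalars q^(1/2) and q^m are absorbed into K^(1/2). In this form the generator depends only
on the Weyl pair K^(1/2), Z, which is all that the divided powers need. -/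
theorem eMinus_eq (M m : ℕ) : eMinus M m =
    (q M - (q M)⁻¹)⁻¹ • ((q M • kHalf M m - (kHalf M m)⁻¹) * weylZ M) := by
  have hh := qHalf_ne_zero M
  have hq := q_ne_zero M
  have h2 := qHalf_sq M
  rw [eMinus, kHalf_inv, kHalf_eq, weylXhat, Matrix.nonsing_inv_nonsing_inv _ (isUnit_weylZ_det M),
    div_eq_mul_inv, mul_comm (qHalf M), ← smul_smul, ← smul_mul_assoc, smul_sub, smul_smul,
    smul_smul, smul_smul, kScalar]
  congr 4
  · rw [← h2]; ring
  · rw [← h2, inv_pow]; field_simp; ring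

theorem ePlus_eq (M m : ℕ) : ePlus M m =
    (q M - (q M)⁻¹)⁻¹ • (((kHalf M m)⁻¹ - (q M)⁻¹ • kHalf M m) * (weylZ M)⁻¹) := by
  have hh := qHalf_ne_zero M
  have hq := q_ne_zero M
  have h2 := qHalf_sq M
  rw [ePlus, kHalf_inv, kHalf_eq, weylXhat,
    div_eq_mul_inv, mul_comm (qHalf M)⁻¹, ← smul_smul, ← smul_mul_assoc, smul_sub, smul_smul,
    smul_smul, smul_smul, kScalar]
  congr 4
  · rw [mul_inv, inv_pow]
  · rw [← h2] at hq ⊢; field_simp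

/-! ### Divided powers -/

/-- The relations between `k = K ^ (1/2)`, its inverse `k'`, the generators `e`, `f` and the divided
powers `E n` of `e`, with deformation parameter `Q`. -/
structure DividedPowers {R : Type*} [Ring R] [Algebra ℂ R] (Q : ℂ) (k k' e f : R) (E : ℕ → R) :
    Prop where
  mul_inv : k * k' = 1
  inv_mul : k' * k = 1
  zero : E 0 = 1
  k_e : k * e = Q⁻¹ • (e * k)
  k_f : k * f = Q • (f * k)
  k_E : ∀ n, k * E n = Q⁻¹ ^ n • (E n * k)
  e_E : ∀ n, (Q - Q⁻¹) • (e * E n) = (Q ^ (n + 1) - Q⁻¹ ^ (n + 1)) • E (n + 1)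
  E_e : ∀ n, E n * e = e * E n
  f_E : ∀ n, f * E (n + 1) = E (n + 1) * f +
    (Q - Q⁻¹)⁻¹ • (E n * (Q⁻¹ ^ n • (k * k) - Q ^ n • (k' * k')))

section

variable {R : Type*} [Ring R] [Algebra ℂ R] {Q : ℂ} {k k' e f : R} {E : ℕ → R}

theorem inv_mul_eq_of_mul_eq {c : ℂ} (hc : c ≠ 0) {k k' x : R} (h1 : k * k' = 1) (h2 : k' * k = 1)
    (h : k * x = c⁻¹ • (x * k)) : k' * x = c • (x * k') := by
  have : k' * (k * x) * k' = c⁻¹ • (k' * x) := by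
    rw [h, mul_smul_comm, smul_mul_assoc, mul_assoc, mul_assoc, h1, mul_one]
  rw [← mul_assoc, h2, one_mul] at this
  rw [this, smul_smul, mul_inv_cancel₀ hc, one_smul]

/-- The relations are invariant under Q ↦ Q⁻¹ with k and k⁻¹ exchanged. This is how the minus
operators are obtained from the computation for the plus operators. -/
theorem DividedPowers.symm (hQ : Q ≠ 0) (h : DividedPowers Q k k' e f E) :
    DividedPowers Q⁻¹ k' k e f E where
  mul_inv := h.inv_mul
  inv_mul := h.mul_inv
  zero := h.zero
  k_e := by rw [inv_inv]; exact inv_mul_eq_of_mul_eq hQ h.mul_inv h.inv_mul h.k_e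
  k_f := inv_mul_eq_of_mul_eq (inv_ne_zero hQ) h.mul_inv h.inv_mul (by rw [inv_inv]; exact h.k_f)
  k_E n := by
    rw [inv_inv]
    exact inv_mul_eq_of_mul_eq (pow_ne_zero n hQ) h.mul_inv h.inv_mul
      (by rw [← inv_pow]; exact h.k_E n)
  e_E n := by
    rw [inv_inv, ← neg_sub Q, ← neg_sub (Q ^ (n + 1)), neg_smul, neg_smul, h.e_E n]
  E_e := h.E_e
  f_E n := by
    rw [inv_inv, h.f_E n, ← neg_sub Q, inv_neg, ← neg_sub (Q⁻¹ ^ n • (k * k)), mul_neg, smul_neg,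
      neg_smul, neg_neg]

/-- The local commutation relations of the monodromy entries with normalized divided powers. -/
theorem DividedPowers.local_relations (h : DividedPowers Q k k' e f E) (hQ : Q ≠ 0)
    (hκ : Q - Q⁻¹ ≠ 0) {a₁ a₂ β d : ℂ} (h1 : a₁ ≠ 0) (h2 : a₂ ≠ 0) (hβ : β ≠ 0) (hd : d ≠ 0)
    {A B C D g : R} {p : ℕ → R} {c : ℂ} (hA : A = a₁ • k' + a₂ • k) (hB : B = β • e)
    (hC : C = ((Q - Q⁻¹) ^ 2 / β) • f) (hD : D = (-a₂⁻¹) • k + (-a₁⁻¹) • k')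
    (hg : g = (-(a₁ * a₂)) • (k' * k')) (hp : ∀ n, p n = d⁻¹ ^ n • (k' ^ n * E n))
    (hc : c = (Q - Q⁻¹) * Q / (a₂ * β * d)) (n : ℕ) :
    A * p (n + 1) + c • (B * (g * p n)) = Q⁻¹ ^ (n + 1) • (p (n + 1) * A) ∧
    B * p (n + 1) = Q⁻¹ ^ (n + 1) • (p (n + 1) * B) ∧
    C * p (n + 1) + c • (D * (g * p n)) = (c * Q ^ n) • (p n * A) + Q ^ (n + 1) • (p (n + 1) * C) ∧
    D * p (n + 1) = (c * Q ^ n) • (p n * B) + Q ^ (n + 1) • (p (n + 1) * D) := by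
  have hs := h.symm hQ
  have hκ2 : Q ^ 2 - 1 ≠ 0 := fun hh => hκ (by
    have : Q - Q⁻¹ = Q⁻¹ * (Q ^ 2 - 1) := by field_simp
    rw [this, hh, mul_zero])
  have hQn : Q ^ n ≠ 0 := pow_ne_zero _ hQ
  have hdn : d ^ n ≠ 0 := pow_ne_zero _ hd
  -- The power k'^n is made an atom u, so that the normal ordering below has fixed rules for moving
  -- k, k', e, f past it.
  obtain ⟨u, hu⟩ : ∃ u, u = k' ^ n := ⟨_, rfl⟩
  have ku : ∀ y, k * (u * y) = u * (k * y) := fun y => by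
    rw [← mul_assoc, ← mul_assoc, hu,
      ((show Commute k k' from h.mul_inv.trans h.inv_mul.symm).pow_right n).eq]
  have k'u : ∀ y, k' * (u * y) = u * (k' * y) := fun y => by
    rw [← mul_assoc, ← mul_assoc, hu, ((Commute.refl k').pow_right n).eq]
  have ek' : e * k' = Q⁻¹ • (k' * e) := by
    rw [hs.k_e, inv_inv, smul_smul, inv_mul_cancel₀ hQ, one_smul]
  have fk' : f * k' = Q • (k' * f) := by
    rw [hs.k_f, smul_smul, mul_inv_cancel₀ hQ, one_smul]
  have eu : e * u = Q⁻¹ ^ n • (u * e) := by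
    rw [hu]; clear * - hQ ek' fk'
    induction n with
    | zero => simp
    | succ n ih =>
      rw [pow_succ, ← mul_assoc, ih, smul_mul_assoc,
        mul_assoc, ek', mul_smul_comm, smul_smul, pow_succ, mul_assoc]
  have fu : f * u = Q ^ n • (u * f) := by
    rw [hu]; clear * - hQ ek' fk'
    induction n with
    | zero => simp
    | succ n ih =>
      rw [pow_succ, ← mul_assoc, ih, smul_mul_assoc,
        mul_assoc, fk', mul_smul_comm, smul_smul, pow_succ, mul_assoc]
  -- With products associated to the right, each exchange rule is also needed in front of a further
  -- factor t.
  have tail : ∀ {x y z w : R} {s : ℂ}, x * y = s • (z * w) → ∀ t, x * (y * t) = s • (z * (w * t)) :=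
    fun hxy t => by rw [← mul_assoc, hxy, smul_mul_assoc, mul_assoc]
  have e_E : e * E n = ((Q - Q⁻¹)⁻¹ * (Q ^ (n + 1) - Q⁻¹ ^ (n + 1))) • E (n + 1) := by
    rw [← smul_smul, ← h.e_E, smul_smul, inv_mul_cancel₀ hκ, one_smul]
  have kk' : ∀ y, k * (k' * y) = y := fun y => by rw [← mul_assoc, h.mul_inv, one_mul]
  have k'k : ∀ y, k' * (k * y) = y := fun y => by rw [← mul_assoc, h.inv_mul, one_mul]
  have kE := h.k_E n
  have kE1 := h.k_E (n + 1)
  have k'E := hs.k_E n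
  have k'E1 := hs.k_E (n + 1)
  have fE := h.f_E n
  have Ee := h.E_e n
  have Ee1 := h.E_e (n + 1)
  subst hA hB hC hD hg hc
  simp only [hp, pow_succ k', ← hu]
  refine ⟨?_, ?_, ?_, ?_⟩
  -- All four relations are proved by normal ordering and comparison of coefficients. Here e E_n in
  -- the term with B produces a multiple of E_(n+1); in the third relation it is the commutator of f
  -- with E_(n+1) that produces terms in E_n.
  · simp only [mul_add, add_mul, smul_mul_assoc, mul_smul_comm, mul_assoc, ku, k'u, tail eu,
      tail ek', e_E, k'E1, h.mul_inv, h.inv_mul, mul_one, smul_add, smul_smul, tail kE1, tail k'E1]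
    match_scalars <;> (simp only [inv_inv, inv_pow, pow_succ]; field_simp; try ring)
  · simp only [smul_mul_assoc, mul_smul_comm, mul_assoc, tail eu, tail ek', Ee1, smul_smul]
    match_scalars
    simp only [inv_pow, pow_succ]; field_simp
  · simp only [mul_add, add_mul, mul_sub, smul_mul_assoc, mul_smul_comm, mul_assoc, ku, k'u,
      tail fu, tail fk', fE, kk', k'k, k'E, smul_add, smul_sub, smul_smul, tail kE, tail k'E]
    match_scalars <;> (simp only [inv_inv, inv_pow, pow_succ]; field_simp; try ring)
  · simp only [mul_add, add_mul, smul_mul_assoc, mul_smul_comm, mul_assoc, ku, k'u,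
      Ee, e_E, k'E1, h.mul_inv, h.inv_mul, mul_one, smul_add, smul_smul, tail kE1, tail k'E1]
    match_scalars <;> (simp only [inv_inv, inv_pow, pow_succ]; field_simp; try ring)

end

/-! ### Nilpotency and divided powers at a root of unity -/

open Polynomial in
-- As N is odd, 2j + 1 runs through all residues modulo N, so the numbers q^(-(2j+1)) are all the
-- N-th roots of unity. The proof counts: an injective family of N roots exhausts them.
theorem prod_X_sub_C_odd_powers (M : ℕ) :
    ∏ j ∈ Finset.range (2 * M + 1), (X - C ((q M ^ (2 * j + 1))⁻¹)) = X ^ (2 * M + 1) - 1 := by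
  rw [X_pow_sub_one_eq_prod (Nat.succ_pos _) (q_primitive M)]
  have hinj : Set.InjOn (fun j : ℕ => (q M ^ (2 * j + 1))⁻¹) (Finset.range (2 * M + 1)) := by
    intro i hi j hj hij
    have h1 : q M ^ ((2 * i + 1 : ℕ) : ℤ) = q M ^ ((2 * j + 1 : ℕ) : ℤ) := by
      rw [zpow_natCast, zpow_natCast]; exact inv_injective hij
    have h2 := (q_zpow_eq_iff.1 h1).dvd
    have h3 : ((2 * M + 1 : ℕ) : ℤ) ∣ (j : ℤ) - i := by
      have : IsCoprime ((2 * M + 1 : ℕ) : ℤ) 2 := ⟨1, -M, by push_cast; ring⟩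
      refine this.dvd_of_dvd_mul_left ?_
      rwa [show 2 * ((j : ℤ) - i) = ((2 * j + 1 : ℕ) : ℤ) - ((2 * i + 1 : ℕ) : ℤ) by
        push_cast; ring]
    simp only [Finset.coe_range, Set.mem_Iio] at hi hj
    have := Int.eq_zero_of_abs_lt_dvd h3 (by rw [abs_lt]; constructor <;> push_cast <;> omega)
    omega
  rw [← Finset.prod_image (s := Finset.range (2 * M + 1))
    (f := fun z => (X : ℂ[X]) - C z) hinj]
  congr 1
  refine Finset.eq_of_subset_of_card_le ?_ ?_
  · intro z hz
    obtain ⟨j, -, rfl⟩ := Finset.mem_image.1 hz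
    rw [mem_nthRootsFinset (Nat.succ_pos _), inv_pow, ← pow_mul, mul_comm, pow_mul, q_pow_period,
      one_pow, inv_one]
  · rw [Finset.card_image_of_injOn hinj, (q_primitive M).card_nthRootsFinset, Finset.card_range]

section

variable {R : Type*} [Ring R] [Algebra ℂ R]

/-- The product of the operators `q ^ (j + 1) k - q ^ (-j) k⁻¹` for `j < n`. -/
noncomputable def weightProd (M : ℕ) (k k' : R) (n : ℕ) : R :=
  ((List.range n).map fun j => q M ^ (j + 1) • k - (q M)⁻¹ ^ j • k').prod

theorem weightProd_succ (M : ℕ) (k k' : R) (n : ℕ) : weightProd M k k' (n + 1) =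
    weightProd M k k' n * (q M ^ (n + 1) • k - (q M)⁻¹ ^ n • k') := by
  rw [weightProd, List.range_succ, List.map_append, List.prod_append]
  simp [weightProd]

open Polynomial in
-- One factor k per term gives (q^(j+1) k - q^(-j) k⁻¹) k = q^(j+1) (k² - q^(-(2j+1))), and all
-- these operators commute.
theorem weightProd_mul_pow {M : ℕ} {k k' : R} (h1 : k * k' = 1) (h2 : k' * k = 1) (n : ℕ) :
    ∃ c : ℂ, weightProd M k k' n * k ^ n = c • aeval (k * k)
      (∏ j ∈ Finset.range n, (X - C ((q M ^ (2 * j + 1))⁻¹))) := by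
  induction n with
  | zero => exact ⟨1, by simp [weightProd]⟩
  | succ n ih =>
    obtain ⟨c, hc⟩ := ih
    have hk : Commute k k' := h1.trans h2.symm
    refine ⟨c * q M ^ (n + 1), ?_⟩
    have hq := q_ne_zero M
    have hfac : (q M ^ (n + 1) • k - (q M)⁻¹ ^ n • k') * k =
        q M ^ (n + 1) • aeval (k * k) (X - C ((q M ^ (2 * n + 1))⁻¹) : ℂ[X]) := by
      rw [sub_mul, smul_mul_assoc, smul_mul_assoc, h2, map_sub, aeval_X, aeval_C, smul_sub,
        Algebra.algebraMap_eq_smul_one, smul_smul]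
      congr 2
      rw [inv_pow, show 2 * n + 1 = n + (n + 1) by ring, pow_add, pow_add]; field_simp; ring
    have hcomm : Commute (q M ^ (n + 1) • k - (q M)⁻¹ ^ n • k') (k ^ n) :=
      ((((Commute.refl k).smul_left _).sub_left (hk.symm.smul_left _)).pow_right n)
    rw [weightProd_succ, pow_succ k, mul_assoc, ← mul_assoc _ (k ^ n) k, hcomm.eq, mul_assoc (k ^ n),
      ← mul_assoc, hc, hfac, Finset.prod_range_succ, map_mul, smul_mul_smul_comm]

/-- For n = N the polynomial in k² is (k²)^N - 1 = 0, while the auxiliary factor k^N is 1. -/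
theorem weightProd_period {M : ℕ} {k k' : R} (h1 : k * k' = 1) (h2 : k' * k = 1)
    (hk : k ^ (2 * M + 1) = 1) : weightProd M k k' (2 * M + 1) = 0 := by
  obtain ⟨c, hc⟩ := weightProd_mul_pow (M := M) h1 h2 (2 * M + 1)
  rw [prod_X_sub_C_odd_powers, hk, mul_one] at hc
  rw [hc]
  simp only [map_sub, map_pow, Polynomial.aeval_X, map_one]
  have : Commute k k := Commute.refl k
  rw [this.mul_pow, hk, mul_one, sub_self, smul_zero]

/-- The operators `e ^ n / [n]!`, with `0` for `n ≥ 2 M + 1`, are divided powers when `e` comes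
from a Weyl pair `k, W` with `k` of order `2 M + 1`. -/
theorem dividedPowers_of_weyl {M : ℕ} (hM : 1 ≤ M) {k k' W e f : R} {η : ℂ} (h1 : k * k' = 1)
    (h2 : k' * k = 1) (hkW : k * W = (q M)⁻¹ • (W * k)) (hk : k ^ (2 * M + 1) = 1)
    (he : e = η • ((q M • k - k') * W)) (hf : k * f = q M • (f * k))
    (hfe : f * e = e * f + (q M - (q M)⁻¹)⁻¹ • (k * k - k' * k')) :
    DividedPowers (q M) k k' e f fun n => (qFact M n)⁻¹ • e ^ n := by
  have hq := q_ne_zero M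
  have hκ := q_sub_inv_ne_zero hM
  have hκ2 : q M ^ 2 - 1 ≠ 0 := fun hh => hκ (by
    have : q M - (q M)⁻¹ = (q M)⁻¹ * (q M ^ 2 - 1) := by field_simp
    rw [this, hh, mul_zero])
  have hck : Commute k k' := h1.trans h2.symm
  have hk'W : k' * W = q M • (W * k') := inv_mul_eq_of_mul_eq hq h1 h2 hkW
  have hWk : W * k = q M • (k * W) := by
    rw [hkW, smul_smul, mul_inv_cancel₀ hq, one_smul]
  have hWk' : W * k' = (q M)⁻¹ • (k' * W) := by
    rw [hk'W, smul_smul, inv_mul_cancel₀ hq, one_smul]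
  have hWnk : ∀ n, W ^ n * k = q M ^ n • (k * W ^ n) := fun n => by
    induction n with
    | zero => simp
    | succ n ih =>
      rw [pow_succ', mul_assoc, ih, mul_smul_comm, ← mul_assoc, hWk, smul_mul_assoc, smul_smul,
        mul_assoc, pow_succ (q M)]
  have hWnk' : ∀ n, W ^ n * k' = (q M)⁻¹ ^ n • (k' * W ^ n) := fun n => by
    induction n with
    | zero => simp
    | succ n ih =>
      rw [pow_succ', mul_assoc, ih, mul_smul_comm, ← mul_assoc, hWk', smul_mul_assoc, smul_smul,
        mul_assoc, pow_succ (q M)⁻¹]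
  have hke : k * e = (q M)⁻¹ • (e * k) := by
    have hc : Commute k (q M • k - k') := ((Commute.refl k).smul_right _).sub_right hck
    rw [he, mul_smul_comm, ← mul_assoc, hc.eq, mul_assoc, hkW, mul_smul_comm, smul_comm,
      smul_mul_assoc, mul_assoc]
  have hk'e : k' * e = q M • (e * k') := inv_mul_eq_of_mul_eq hq h1 h2 hke
  have hken : ∀ n, k * e ^ n = (q M)⁻¹ ^ n • (e ^ n * k) := fun n => by
    induction n with
    | zero => simp
    | succ n ih =>
      rw [pow_succ, ← mul_assoc, ih, smul_mul_assoc, mul_assoc, hke, mul_smul_comm, smul_smul,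
        mul_assoc, pow_succ (q M)⁻¹]
  -- Moving all W to the right collects the weights of the successive factors of e in one product;
  -- this product is 0 for n = N, so e is nilpotent.
  have hpow : ∀ n, e ^ n = η ^ n • (weightProd M k k' n * W ^ n) := fun n => by
    induction n with
    | zero => simp [weightProd]
    | succ n ih =>
      rw [pow_succ, ih, he, smul_mul_smul_comm, ← pow_succ, weightProd_succ, pow_succ W]
      congr 1
      rw [mul_assoc, mul_assoc, ← mul_assoc (W ^ n), mul_sub, mul_smul_comm, hWnk, hWnk',
        smul_smul, ← pow_succ', ← smul_mul_assoc, ← smul_mul_assoc _ k', ← sub_mul, mul_assoc]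
  have hnil : e ^ (2 * M + 1) = 0 := by
    rw [hpow, weightProd_period h1 h2 hk, zero_mul, smul_zero]
  have hnil' : ∀ n, 2 * M + 1 ≤ n → e ^ n = 0 := fun n hn => by
    rw [← Nat.sub_add_cancel hn, pow_add, hnil, mul_zero]
  -- The critical case n = N - 1 of the relation `f_E`: the term with E_N disappears, so the
  -- commutator term must vanish by itself. After W^(2M) is moved through, the bracket splits off
  -- exactly the factor missing from the full product of N weights.
  have htop : e ^ (2 * M) * ((q M)⁻¹ ^ (2 * M) • (k * k) - q M ^ (2 * M) • (k' * k')) = 0 := by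
    have hq1 : q M ^ (2 * M) = (q M)⁻¹ :=
      eq_inv_of_mul_eq_one_left (by rw [← pow_succ, q_pow_period])
    have hq1' : (q M)⁻¹ ^ (2 * M) = q M := by rw [inv_pow, hq1, inv_inv]
    have hW2 : W ^ (2 * M) * (q M • (k * k) - (q M)⁻¹ • (k' * k')) =
        (q M ^ (2 * M + 1) • k - (q M)⁻¹ ^ (2 * M) • k') *
          (((q M)⁻¹ • k + k') * W ^ (2 * M)) := by
      have l1 : W ^ (2 * M) * (k * k) = ((q M)⁻¹ * (q M)⁻¹) • (k * k * W ^ (2 * M)) := by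
        rw [← mul_assoc, hWnk, smul_mul_assoc, mul_assoc, hWnk, mul_smul_comm, smul_smul, hq1,
          mul_assoc]
      have l2 : W ^ (2 * M) * (k' * k') = (q M * q M) • (k' * k' * W ^ (2 * M)) := by
        rw [← mul_assoc, hWnk', smul_mul_assoc, mul_assoc, hWnk', mul_smul_comm, smul_smul, hq1',
          mul_assoc]
      rw [mul_sub, mul_smul_comm, mul_smul_comm, l1, l2, q_pow_period, hq1', one_smul]
      simp only [add_mul, sub_mul, mul_add, smul_mul_assoc, mul_smul_comm, ← mul_assoc, h1, h2,
        one_mul]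
      match_scalars <;> field_simp <;> simp
    rw [hpow, smul_mul_assoc, mul_assoc, hq1', hq1, hW2, ← mul_assoc, ← weightProd_succ,
      weightProd_period h1 h2 hk, zero_mul, smul_zero]
  have hfen : ∀ n : ℕ, f * e ^ (n + 1) = e ^ (n + 1) * f +
      (qInt M ((n : ℤ) + 1) * (q M - (q M)⁻¹)⁻¹) •
        (e ^ n * ((q M)⁻¹ ^ n • (k * k) - q M ^ n • (k' * k'))) := fun n => by
    induction n with
    | zero =>
      have : qInt M 1 = 1 := by rw [qInt]; simp [hκ]
      simp [this, hfe]
    | succ n ih =>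
      have l1 : k * k * e = ((q M)⁻¹ * (q M)⁻¹) • (e * (k * k)) := by
        rw [mul_assoc, hke, mul_smul_comm, ← mul_assoc, hke, smul_mul_assoc, smul_smul, mul_assoc]
      have l2 : k' * k' * e = (q M * q M) • (e * (k' * k')) := by
        rw [mul_assoc, hk'e, mul_smul_comm, ← mul_assoc, hk'e, smul_mul_assoc, smul_smul, mul_assoc]
      rw [pow_succ e (n + 1), ← mul_assoc, ih, add_mul, mul_assoc _ f e, hfe, smul_mul_assoc,
        mul_assoc _ _ e, sub_mul, smul_mul_assoc, smul_mul_assoc, l1, l2]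
      simp only [mul_add, mul_sub, mul_smul_comm, smul_sub, smul_smul, ← mul_assoc, ← pow_succ]
      have e1 := sub_mul_qInt hM ((n : ℤ) + 1)
      have e2 := sub_mul_qInt hM (((n + 1 : ℕ) : ℤ) + 1)
      have z1 : q M ^ ((n : ℤ) + 1) = q M ^ (n + 1) := by exact_mod_cast zpow_natCast (q M) (n + 1)
      have z2 : q M ^ (((n + 1 : ℕ) : ℤ) + 1) = q M ^ (n + 1) * q M := by
        rw [← pow_succ]; exact_mod_cast zpow_natCast (q M) (n + 1 + 1)
      rw [zpow_neg, z1] at e1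
      rw [zpow_neg, z2] at e2
      have f1 : qInt M ((n : ℤ) + 1) =
          (q M - (q M)⁻¹)⁻¹ * (q M ^ (n + 1) - (q M ^ (n + 1))⁻¹) := by
        rw [← e1, inv_mul_cancel_left₀ hκ]
      have f2 : qInt M (((n + 1 : ℕ) : ℤ) + 1) =
          (q M - (q M)⁻¹)⁻¹ * (q M ^ (n + 1) * q M - (q M ^ (n + 1) * q M)⁻¹) := by
        rw [← e2, inv_mul_cancel_left₀ hκ]
      rw [f1, f2]
      have hqn : q M ^ n ≠ 0 := pow_ne_zero _ hq
      match_scalars <;> simp only [inv_pow, pow_succ] <;> field_simp <;> ring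
  -- The scalars 1/[n]! and [n+1]/[n+1]! agree for n + 1 < N. From n + 1 = N on, the equation holds
  -- because e^(n+1) = 0.
  have hsucc : ∀ n : ℕ, (qFact M n)⁻¹ • e ^ (n + 1) =
      qInt M ((n : ℤ) + 1) • (qFact M (n + 1))⁻¹ • e ^ (n + 1) := fun n => by
    rcases lt_or_ge (n + 1) (2 * M + 1) with hn | hn
    · have := qFact_ne_zero hM hn
      rw [qFact_succ] at this ⊢
      rw [smul_smul, mul_inv, mul_comm (qInt M _), mul_assoc,
        inv_mul_cancel₀ (right_ne_zero_of_mul this), mul_one]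
    · rw [hnil' _ hn]; simp
  refine ⟨h1, h2, by simp [qFact_zero], hke, hf, fun n => ?_, fun n => ?_, fun n => ?_,
    fun n => ?_⟩
  · rw [mul_smul_comm, hken, smul_comm, smul_mul_assoc]
  · rw [mul_smul_comm, ← pow_succ', hsucc, smul_smul, sub_mul_qInt hM, zpow_neg, inv_pow]
    norm_cast
  · rw [smul_mul_assoc, mul_smul_comm, ← pow_succ, ← pow_succ']
  · rcases lt_trichotomy (n + 1) (2 * M + 1) with hn | hn | hn
    · have h0 := qFact_ne_zero hM hn
      have h0' := h0
      rw [qFact_succ] at h0'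
      have h3 := right_ne_zero_of_mul h0'
      have h4 := left_ne_zero_of_mul h0'
      rw [mul_smul_comm, hfen, smul_add, smul_mul_assoc, smul_mul_assoc, smul_smul, smul_smul,
        qFact_succ]
      congr 2
      field_simp
    · obtain rfl : n = 2 * M := by omega
      rw [qFact_eq_zero hM le_rfl, smul_mul_assoc, smul_mul_assoc (qFact M (2 * M))⁻¹, htop]
      simp
    · rw [qFact_eq_zero hM hn.le, qFact_eq_zero hM (by omega : 2 * M + 1 ≤ n)]
      simp

end

/-! ### Local U_q(sl₂) relations -/

theorem kHalf_mul_inv (M m : ℕ) : kHalf M m * (kHalf M m)⁻¹ = 1 :=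
  Matrix.mul_nonsing_inv _ (isUnit_kHalf_det M m)

theorem kHalf_inv_mul (M m : ℕ) : (kHalf M m)⁻¹ * kHalf M m = 1 :=
  Matrix.nonsing_inv_mul _ (isUnit_kHalf_det M m)

theorem kHalf_inv_pow_period (M m : ℕ) : (kHalf M m)⁻¹ ^ (2 * M + 1) = 1 := by
  rw [Matrix.inv_pow', kHalf_pow_period, inv_one]

theorem kHalf_inv_mul_weylZ (M m : ℕ) :
    (kHalf M m)⁻¹ * weylZ M = q M • (weylZ M * (kHalf M m)⁻¹) :=
  inv_mul_eq_of_mul_eq (q_ne_zero M) (kHalf_mul_inv M m) (kHalf_inv_mul M m) (kHalf_mul_weylZ M m)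

theorem weylZ_mul_nonsing_inv (M : ℕ) : weylZ M * (weylZ M)⁻¹ = 1 :=
  Matrix.mul_nonsing_inv _ (isUnit_weylZ_det M)

theorem weylZ_inv_mul (M : ℕ) : (weylZ M)⁻¹ * weylZ M = 1 :=
  Matrix.nonsing_inv_mul _ (isUnit_weylZ_det M)

theorem kHalf_inv_mul_weylZ_inv (M m : ℕ) :
    (kHalf M m)⁻¹ * (weylZ M)⁻¹ = (q M)⁻¹ • ((weylZ M)⁻¹ * (kHalf M m)⁻¹) := by
  have h : (weylZ M)⁻¹ * ((kHalf M m)⁻¹ * weylZ M) * (weylZ M)⁻¹ =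
      (weylZ M)⁻¹ * (q M • (weylZ M * (kHalf M m)⁻¹)) * (weylZ M)⁻¹ := by
    rw [kHalf_inv_mul_weylZ]
  rw [mul_smul_comm, smul_mul_assoc, ← mul_assoc _ (weylZ M), weylZ_inv_mul, one_mul, mul_assoc,
    mul_assoc (kHalf M m)⁻¹, weylZ_mul_nonsing_inv, mul_one] at h
  rw [h, smul_smul, inv_mul_cancel₀ (q_ne_zero M), one_smul]

theorem kHalf_mul_weylZ_inv (M m : ℕ) :
    kHalf M m * (weylZ M)⁻¹ = q M • ((weylZ M)⁻¹ * kHalf M m) :=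
  inv_mul_eq_of_mul_eq (q_ne_zero M) (kHalf_inv_mul M m) (kHalf_mul_inv M m)
    (kHalf_inv_mul_weylZ_inv M m)

theorem kHalf_mul_ePlus (M m : ℕ) : kHalf M m * ePlus M m = q M • (ePlus M m * kHalf M m) := by
  rw [ePlus_eq, mul_smul_comm, ← mul_assoc, mul_sub, mul_smul_comm, kHalf_mul_inv, smul_mul_assoc,
    mul_assoc _ (weylZ M)⁻¹, smul_comm (q M), ← mul_smul_comm (q M), ← kHalf_mul_weylZ_inv,
    ← mul_assoc, sub_mul _ _ (kHalf M m), kHalf_inv_mul, smul_mul_assoc]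

theorem kHalf_mul_eMinus (M m : ℕ) :
    kHalf M m * eMinus M m = (q M)⁻¹ • (eMinus M m * kHalf M m) := by
  rw [eMinus_eq, mul_smul_comm, ← mul_assoc, mul_sub, mul_smul_comm, kHalf_mul_inv, smul_mul_assoc,
    mul_assoc _ (weylZ M), smul_comm (q M)⁻¹, ← mul_smul_comm (q M)⁻¹, ← kHalf_mul_weylZ,
    ← mul_assoc, sub_mul _ _ (kHalf M m), kHalf_inv_mul, smul_mul_assoc]

theorem ePlus_mul_eMinus {M : ℕ} (hM : 1 ≤ M) (m : ℕ) :
    ePlus M m * eMinus M m = eMinus M m * ePlus M m + (q M - (q M)⁻¹)⁻¹ •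
      (kHalf M m * kHalf M m - (kHalf M m)⁻¹ * (kHalf M m)⁻¹) := by
  have hq := q_ne_zero M
  have hκ := q_sub_inv_ne_zero hM
  have hκ2 : q M ^ 2 - 1 ≠ 0 := fun hh => hκ (by
    have : q M - (q M)⁻¹ = (q M)⁻¹ * (q M ^ 2 - 1) := by field_simp
    rw [this, hh, mul_zero])
  have tail : ∀ {x y z w : LocOp M} {s : ℂ}, x * y = s • (z * w) →
      ∀ t, x * (y * t) = s • (z * (w * t)) :=
    fun hxy t => by rw [← mul_assoc, hxy, smul_mul_assoc, mul_assoc]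
  have zz : ∀ y, weylZ M * ((weylZ M)⁻¹ * y) = y := fun y => by
    rw [← mul_assoc, weylZ_mul_nonsing_inv, one_mul]
  have zz' : ∀ y, (weylZ M)⁻¹ * (weylZ M * y) = y := fun y => by
    rw [← mul_assoc, weylZ_inv_mul, one_mul]
  rw [ePlus_eq, eMinus_eq]
  simp only [smul_mul_assoc, mul_smul_comm, sub_mul, mul_sub, mul_assoc, smul_sub, smul_smul,
    kHalf_mul_weylZ, kHalf_inv_mul_weylZ, kHalf_mul_weylZ_inv, kHalf_inv_mul_weylZ_inv,
    tail (kHalf_mul_weylZ M m), tail (kHalf_inv_mul_weylZ M m), tail (kHalf_mul_weylZ_inv M m),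
    tail (kHalf_inv_mul_weylZ_inv M m), zz, zz', kHalf_mul_inv, kHalf_inv_mul]
  match_scalars <;> (field_simp; try ring)

/-- The divided powers of `e⁻`. -/
theorem dividedPowers_eMinus {M : ℕ} (hM : 1 ≤ M) (m : ℕ) :
    DividedPowers (q M) (kHalf M m) (kHalf M m)⁻¹ (eMinus M m) (ePlus M m)
      fun n => (qFact M n)⁻¹ • eMinus M m ^ n :=
  dividedPowers_of_weyl hM (kHalf_mul_inv M m) (kHalf_inv_mul M m) (kHalf_mul_weylZ M m)
    (kHalf_pow_period M m) (eMinus_eq M m) (kHalf_mul_ePlus M m) (ePlus_mul_eMinus hM m)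

/-- The divided powers of `e⁺`. -/
theorem dividedPowers_ePlus {M : ℕ} (hM : 1 ≤ M) (m : ℕ) :
    DividedPowers (q M) (kHalf M m)⁻¹ (kHalf M m) (ePlus M m) (eMinus M m)
      fun n => (qFact M n)⁻¹ • ePlus M m ^ n :=
  -- The Weyl pair is now K^(-1/2), Z⁻¹. The extra q⁻¹ in η comes from K^(-1/2) - q⁻¹ K^(1/2) = q⁻¹
  -- (q K^(-1/2) - K^(1/2)).
  dividedPowers_of_weyl (η := (q M - (q M)⁻¹)⁻¹ * (q M)⁻¹) hM (kHalf_inv_mul M m)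
    (kHalf_mul_inv M m)
    (kHalf_inv_mul_weylZ_inv M m) (kHalf_inv_pow_period M m)
    (by
      rw [ePlus_eq, ← smul_smul, ← smul_mul_assoc (q M)⁻¹, smul_sub, smul_smul,
        inv_mul_cancel₀ (q_ne_zero M), one_smul])
    (inv_mul_eq_of_mul_eq (q_ne_zero M) (kHalf_mul_inv M m) (kHalf_inv_mul M m)
      (kHalf_mul_eMinus M m))
    (by
      rw [ePlus_mul_eMinus hM, add_assoc, ← smul_add, sub_add_sub_cancel, sub_self, smul_zero,
        add_zero])

open Finset.HasAntidiagonal (antidiagonal)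

/-! ### Intertwining relations and their coproduct -/

section

variable {R : Type*} [Ring R]

/-- The sequence `p n` completed by one term `p (n - 1)` on the right. -/
def extendRight (G Φ : R) (p : ℕ → R) : ℕ → R
  | 0 => p 0
  | n + 1 => p (n + 1) + G * p n * Φ

/-- The sequence `p n` completed by one term `p (n - 1)` on the left. -/
def extendLeft (Γ Φ : R) (p : ℕ → R) : ℕ → R
  | 0 => p 0
  | n + 1 => Γ ^ (n + 1) * p (n + 1) + Γ ^ n * Φ * p n

/-- The coproduct of two sequences of divided powers. -/
def coproduct (G₁ : R) (p₁ p₂ : ℕ → R) (n : ℕ) : R :=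
  ∑ x ∈ antidiagonal n, G₁ ^ x.2 * p₁ x.1 * p₂ x.2

/-- Coassociativity with the auxiliary factor last. The auxiliary divided powers are 1, Φ, 0, 0, …,
so `extendRight` is itself a coproduct with only two terms; the next two lemmas put the auxiliary
factor in the first and in the middle position. -/
theorem extendRight_coproduct {G₁ G₂ Φ : R} {p₁ p₂ : ℕ → R} (hG₂ : ∀ n, Commute G₂ (p₁ n))
    (hG : Commute G₁ G₂) (n : ℕ) :
    extendRight (G₁ * G₂) Φ (coproduct G₁ p₁ p₂) n =
      ∑ x ∈ antidiagonal n, G₁ ^ x.2 * p₁ x.1 * extendRight G₂ Φ p₂ x.2 := by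
  cases n with
  | zero => simp [extendRight, coproduct]
  | succ n =>
    rw [extendRight, coproduct, coproduct, Finset.Nat.sum_antidiagonal_succ',
      Finset.Nat.sum_antidiagonal_succ', add_assoc, Finset.mul_sum, Finset.sum_mul,
      ← Finset.sum_add_distrib]
    congr 1
    refine Finset.sum_congr rfl fun x _ => ?_
    simp only [extendRight, mul_add]
    congr 1
    have h1 : G₂ * (G₁ ^ x.2 * p₁ x.1) = G₁ ^ x.2 * p₁ x.1 * G₂ := by
      rw [← mul_assoc, (hG.pow_left x.2).eq.symm, mul_assoc, (hG₂ x.1).eq, mul_assoc]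
    rw [mul_assoc G₁ G₂, ← mul_assoc G₂ (_ * _), h1, pow_succ']
    simp only [mul_assoc]

theorem extendLeft_coproduct {G₁ Γ Φ : R} {p₁ p₂ : ℕ → R} (hG : Commute G₁ Γ) (hGΦ : Commute G₁ Φ) (n : ℕ) :
    extendLeft Γ Φ (coproduct G₁ p₁ p₂) n =
      ∑ x ∈ antidiagonal n, (G₁ * Γ) ^ x.2 * extendLeft Γ Φ p₁ x.1 * p₂ x.2 := by
  cases n with
  | zero => simp [extendLeft, coproduct]
  | succ n =>
    rw [extendLeft, coproduct, coproduct, Finset.Nat.sum_antidiagonal_succ,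
      Finset.Nat.sum_antidiagonal_succ, mul_add, add_assoc, Finset.mul_sum, Finset.mul_sum,
      ← Finset.sum_add_distrib]
    congr 1
    · rw [extendLeft, hG.mul_pow, (hG.pow_pow _ _).eq]
      simp only [mul_assoc]
    · refine Finset.sum_congr rfl fun x hx => ?_
      rw [Finset.HasAntidiagonal.mem_antidiagonal] at hx
      simp only [extendLeft, mul_add, add_mul]
      have h0 : ∀ j, Γ ^ (x.2 + j) * G₁ ^ x.2 = (G₁ * Γ) ^ x.2 * Γ ^ j := fun j => by
        rw [hG.mul_pow, mul_assoc, ← pow_add, (hG.pow_pow _ _).eq]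
      congr 1
      · rw [show n + 1 = x.2 + (x.1 + 1) by omega, ← mul_assoc, ← mul_assoc, h0]
        simp only [mul_assoc]
      · rw [show n = x.2 + x.1 by omega, ← mul_assoc, ← mul_assoc, mul_assoc _ Φ,
          (hGΦ.symm.pow_right x.2).eq, ← mul_assoc, h0]
        simp only [mul_assoc]

theorem middle_coproduct {G₁ Γ Φ : R} {p₁ p₂ : ℕ → R} (hΓ : ∀ n, Commute Γ (p₁ n))
    (hG : Commute G₁ Γ) (n : ℕ) :
    ∑ x ∈ antidiagonal n, G₁ ^ x.2 * p₁ x.1 * extendLeft Γ Φ p₂ x.2 =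
      ∑ x ∈ antidiagonal n, (G₁ * Γ) ^ x.2 * extendRight G₁ Φ p₁ x.1 * p₂ x.2 := by
  -- The group-like element of the auxiliary factor acts on another tensor factor than p₁, so it can
  -- join G₁ on the left. Both sides then become the same pair of sums, without Φ and with one Φ.
  have hc : ∀ k l, G₁ ^ l * p₁ k * Γ ^ l = (G₁ * Γ) ^ l * p₁ k := fun k l => by
    rw [mul_assoc, ((hΓ k).pow_left l).symm.eq, ← mul_assoc, hG.mul_pow]
  cases n with
  | zero => simp [extendLeft, extendRight]
  | succ n =>
    have e1 : ∑ x ∈ antidiagonal (n + 1), G₁ ^ x.2 * p₁ x.1 * extendLeft Γ Φ p₂ x.2 =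
        (∑ x ∈ antidiagonal (n + 1), (G₁ * Γ) ^ x.2 * p₁ x.1 * p₂ x.2) +
        ∑ x ∈ antidiagonal n, (G₁ * Γ) ^ x.2 * (G₁ * p₁ x.1 * Φ) * p₂ x.2 := by
      rw [Finset.Nat.sum_antidiagonal_succ', Finset.Nat.sum_antidiagonal_succ', add_assoc,
        ← Finset.sum_add_distrib]
      refine congrArg₂ (· + ·) (by simp [extendLeft]) (Finset.sum_congr rfl fun x _ => ?_)
      rw [extendLeft, mul_add, ← mul_assoc, hc]
      congr 1
      have : (G₁ * Γ) ^ x.2 * (G₁ * p₁ x.1) = G₁ ^ (x.2 + 1) * p₁ x.1 * Γ ^ x.2 := by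
        rw [pow_succ, mul_assoc _ G₁, mul_assoc (G₁ ^ x.2), mul_assoc G₁,
          ((hΓ x.1).pow_left x.2).symm.eq, ← mul_assoc G₁, (hG.pow_right x.2).eq, mul_assoc,
          ← mul_assoc (G₁ ^ x.2), hG.mul_pow]
      rw [← mul_assoc _ (G₁ * _), this]
      simp only [mul_assoc]
    have e2 : ∑ x ∈ antidiagonal (n + 1), (G₁ * Γ) ^ x.2 * extendRight G₁ Φ p₁ x.1 * p₂ x.2 =
        (∑ x ∈ antidiagonal (n + 1), (G₁ * Γ) ^ x.2 * p₁ x.1 * p₂ x.2) +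
        ∑ x ∈ antidiagonal n, (G₁ * Γ) ^ x.2 * (G₁ * p₁ x.1 * Φ) * p₂ x.2 := by
      rw [Finset.Nat.sum_antidiagonal_succ, Finset.Nat.sum_antidiagonal_succ, add_assoc,
        ← Finset.sum_add_distrib]
      refine congrArg₂ (· + ·) (by simp [extendRight]) (Finset.sum_congr rfl fun x _ => ?_)
      rw [extendRight, mul_add, add_mul]
    rw [e1, e2]

/-- The intertwining relation passes to products of monodromy matrices. -/
theorem intertwine_mul {G₁ G₂ Γ Φ M₁ M₂ : R} {p₁ p₂ : ℕ → R}
    (h₁ : ∀ n, M₁ * extendRight G₁ Φ p₁ n = extendLeft Γ Φ p₁ n * M₁)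
    (h₂ : ∀ n, M₂ * extendRight G₂ Φ p₂ n = extendLeft Γ Φ p₂ n * M₂)
    (hG : Commute G₁ G₂) (hGΓ : Commute G₁ Γ) (hGΦ : Commute G₁ Φ) (hGM : Commute G₁ M₂)
    (hpG : ∀ n, Commute G₂ (p₁ n)) (hpΓ : ∀ n, Commute Γ (p₁ n))
    (hpM : ∀ n, Commute M₂ (p₁ n)) (hp₂M : ∀ n, Commute M₁ (p₂ n)) (hM : Commute (G₁ * Γ) M₁) (n : ℕ) :
    M₁ * M₂ * extendRight (G₁ * G₂) Φ (coproduct G₁ p₁ p₂) n =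
      extendLeft Γ Φ (coproduct G₁ p₁ p₂) n * (M₁ * M₂) := by
  rw [extendRight_coproduct hpG hG, extendLeft_coproduct hGΓ hGΦ]
  have e1 : M₂ * ∑ x ∈ antidiagonal n, G₁ ^ x.2 * p₁ x.1 * extendRight G₂ Φ p₂ x.2 =
      (∑ x ∈ antidiagonal n, G₁ ^ x.2 * p₁ x.1 * extendLeft Γ Φ p₂ x.2) * M₂ := by
    rw [Finset.mul_sum, Finset.sum_mul]
    refine Finset.sum_congr rfl fun x _ => ?_
    rw [← mul_assoc, ((hGM.symm.pow_right x.2).mul_right (hpM x.1)).eq, mul_assoc, h₂, ← mul_assoc]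
  have e2 : M₁ * ∑ x ∈ antidiagonal n, (G₁ * Γ) ^ x.2 * extendRight G₁ Φ p₁ x.1 * p₂ x.2 =
      (∑ x ∈ antidiagonal n, (G₁ * Γ) ^ x.2 * extendLeft Γ Φ p₁ x.1 * p₂ x.2) * M₁ := by
    rw [Finset.mul_sum, Finset.sum_mul]
    refine Finset.sum_congr rfl fun x _ => ?_
    rw [← mul_assoc, ← mul_assoc, (hM.symm.pow_right x.2).eq, mul_assoc _ M₁, h₁, ← mul_assoc,
      mul_assoc _ M₁, (hp₂M x.2).eq, ← mul_assoc]
  -- M₂ carries the auxiliary factor from the right end to the middle position, and M₁ carries it on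
  -- to the left end.
  rw [mul_assoc, e1, middle_coproduct hpΓ hGΓ, ← mul_assoc, e2, mul_assoc]

end

/-! ### Chains of length `L + 1` as a site followed by a chain of length `L` -/

section

variable {M L : ℕ}

/-- The tensor product of an operator at the first site and an operator on the other sites. -/
def kron (a : LocOp M) (T : ChainOp M L) : ChainOp M (L + 1) :=
  Matrix.of fun σ τ => a (σ 0) (τ 0) * T (Fin.tail σ) (Fin.tail τ)

theorem kron_mul_kron (a b : LocOp M) (S T : ChainOp M L) :
    kron a S * kron b T = kron (a * b) (S * T) := by
  ext σ τ
  simp only [kron, Matrix.mul_apply, Matrix.of_apply]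
  -- The sum over intermediate configurations of L + 1 sites becomes a double sum over the first
  -- spin and the remaining ones.
  rw [← (Fin.consEquiv fun _ => Spin M).sum_comp, Fintype.sum_prod_type, Finset.sum_mul_sum]
  refine Finset.sum_congr rfl fun x _ => Finset.sum_congr rfl fun y _ => ?_
  have h0 : (Fin.consEquiv fun _ => Spin M) (x, y) 0 = x := rfl
  have h1 : Fin.tail ((Fin.consEquiv fun _ => Spin M) (x, y)) = y := rfl
  rw [h0, h1]
  ring

theorem kron_one_one : kron (1 : LocOp M) (1 : ChainOp M L) = 1 := by
  ext σ τ
  simp only [kron, Matrix.of_apply, Matrix.one_apply]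
  rw [ite_zero_mul_ite_zero, mul_one]
  congr 1
  rw [eq_iff_iff, ← Fin.cons_self_tail σ, ← Fin.cons_self_tail τ, Fin.cons_inj]
  simp

theorem kron_add_left (a b : LocOp M) (T : ChainOp M L) : kron (a + b) T = kron a T + kron b T := by
  ext; simp [kron, add_mul]

theorem kron_add_right (a : LocOp M) (S T : ChainOp M L) :
    kron a (S + T) = kron a S + kron a T := by
  ext; simp [kron, mul_add]

theorem kron_smul_left (c : ℂ) (a : LocOp M) (T : ChainOp M L) : kron (c • a) T = c • kron a T := by
  ext; simp [kron, mul_assoc]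

theorem kron_smul_right (c : ℂ) (a : LocOp M) (T : ChainOp M L) :
    kron a (c • T) = c • kron a T := by
  ext; simp [kron, mul_left_comm]

theorem kron_zero_left (T : ChainOp M L) : kron 0 T = 0 := by
  ext; simp [kron]

theorem kron_zero_right (a : LocOp M) : kron a (0 : ChainOp M L) = 0 := by
  ext; simp [kron]

/-- Operators at the first site. -/
def firstSite (M L : ℕ) : LocOp M →ₐ[ℂ] ChainOp M (L + 1) :=
  AlgHom.ofLinearMap
    { toFun := fun a => kron a 1
      map_add' := fun a b => kron_add_left a b 1
      map_smul' := fun c a => kron_smul_left c a 1 }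
    kron_one_one fun a b => by simp [kron_mul_kron]

/-- Operators on the sites different from the first one. -/
def otherSites (M L : ℕ) : ChainOp M L →ₐ[ℂ] ChainOp M (L + 1) :=
  AlgHom.ofLinearMap
    { toFun := fun T => kron 1 T
      map_add' := fun S T => kron_add_right 1 S T
      map_smul' := fun c T => kron_smul_right c 1 T }
    kron_one_one fun S T => by simp [kron_mul_kron]

theorem firstSite_apply (a : LocOp M) : firstSite M L a = kron a 1 := rfl

theorem otherSites_apply (T : ChainOp M L) : otherSites M L T = kron 1 T := rfl

theorem firstSite_mul_otherSites (a : LocOp M) (T : ChainOp M L) :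
    firstSite M L a * otherSites M L T = kron a T := by
  rw [firstSite_apply, otherSites_apply, kron_mul_kron, mul_one, one_mul]

theorem commute_firstSite_otherSites (a : LocOp M) (T : ChainOp M L) :
    Commute (firstSite M L a) (otherSites M L T) := by
  rw [commute_iff_eq, firstSite_mul_otherSites, firstSite_apply, otherSites_apply, kron_mul_kron,
    mul_one, one_mul]

theorem tensor_succ (O : Fin (L + 1) → LocOp M) :
    tensor O = kron (O 0) (tensor fun i => O i.succ) := by
  ext σ τ
  simp only [tensor, kron, Matrix.of_apply, Fin.prod_univ_succ]
  rfl

theorem tensor_zero (O : Fin 0 → LocOp M) : tensor O = 1 := by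
  ext σ τ
  rw [Subsingleton.elim σ τ, Matrix.one_apply_eq]
  simp [tensor]

theorem tensor_one : ∀ L, tensor (fun _ : Fin L => (1 : LocOp M)) = 1
  | 0 => tensor_zero _
  | L + 1 => by rw [tensor_succ, tensor_one L, kron_one_one]

theorem tensor_mul : ∀ {L} (O P : Fin L → LocOp M),
    tensor O * tensor P = tensor fun i => O i * P i
  | 0, _, _ => by simp [tensor_zero]
  | _ + 1, _, _ => by rw [tensor_succ, tensor_succ, kron_mul_kron, tensor_mul, tensor_succ]

theorem site_zero (O : LocOp M) : site (0 : Fin (L + 1)) O = firstSite M L O := by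
  rw [site, tensor_succ, firstSite_apply, ← tensor_one L]
  simp

theorem site_succ (i : Fin L) (O : LocOp M) :
    site i.succ O = otherSites M L (site i O) := by
  rw [site, tensor_succ, otherSites_apply, site]
  congr 1
  congr 1
  ext1 j
  simp [Function.update_apply]

theorem monodromy_zero (loc : Matrix (Fin 2) (Fin 2) (LocOp M)) : monodromy 0 loc = 1 := by
  simp [monodromy]

theorem monodromy_succ (loc : Matrix (Fin 2) (Fin 2) (LocOp M)) :
    monodromy (L + 1) loc =
      (firstSite M L).mapMatrix loc * (otherSites M L).mapMatrix (monodromy L loc) := by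
  rw [monodromy, List.ofFn_succ, List.prod_cons, monodromy, map_list_prod, List.map_ofFn]
  congr 1
  · ext i j : 2
    simp [site_zero]
  · congr 2
    funext l
    ext i j : 2
    simp [site_succ]

theorem monodromy_succ_apply (loc : Matrix (Fin 2) (Fin 2) (LocOp M)) (i j : Fin 2) :
    monodromy (L + 1) loc i j =
      kron (loc i 0) (monodromy L loc 0 j) + kron (loc i 1) (monodromy L loc 1 j) := by
  rw [monodromy_succ, Matrix.mul_apply, Fin.sum_univ_two]
  simp only [AlgHom.mapMatrix_apply, Matrix.map_apply, firstSite_mul_otherSites]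

end

/-! ### Intertwining relations for the chain -/

section

variable {R S : Type*} [Ring R] [Ring S] [Algebra ℂ R] [Algebra ℂ S]

/-- The group-like element in the auxiliary space. -/
noncomputable def auxDiag (R : Type*) [Ring R] [Algebra ℂ R] (Q : ℂ) : Matrix (Fin 2) (Fin 2) R :=
  !![Q⁻¹ • 1, 0; 0, Q • 1]

/-- The lowering element in the auxiliary space. -/
def auxLower (R : Type*) [Ring R] [Algebra ℂ R] (c : ℂ) : Matrix (Fin 2) (Fin 2) R :=
  !![0, 0; c • 1, 0]

theorem mapMatrix_auxDiag (φ : R →ₐ[ℂ] S) (Q : ℂ) :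
    φ.mapMatrix (auxDiag R Q) = auxDiag S Q := by
  ext i j; fin_cases i <;> fin_cases j <;> simp [auxDiag]

theorem mapMatrix_auxLower (φ : R →ₐ[ℂ] S) (c : ℂ) :
    φ.mapMatrix (auxLower R c) = auxLower S c := by
  ext i j; fin_cases i <;> fin_cases j <;> simp [auxLower]

theorem mapMatrix_scalar (φ : R →ₐ[ℂ] S) (x : R) :
    φ.mapMatrix (Matrix.scalar (Fin 2) x) = Matrix.scalar (Fin 2) (φ x) := by
  ext i j; fin_cases i <;> fin_cases j <;> simp

theorem commute_scalar_auxDiag (Q : ℂ) (x : R) :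
    Commute (Matrix.scalar (Fin 2) x) (auxDiag R Q) := by
  rw [commute_iff_eq]
  ext i j; fin_cases i <;> fin_cases j <;> simp [auxDiag, Matrix.mul_apply]

theorem commute_scalar_auxLower (c : ℂ) (x : R) :
    Commute (Matrix.scalar (Fin 2) x) (auxLower R c) := by
  rw [commute_iff_eq]
  ext i j; fin_cases i <;> fin_cases j <;> simp [auxLower, Matrix.mul_apply]

theorem commute_scalar_of_forall {R : Type*} [Ring R] {x : R} {N : Matrix (Fin 2) (Fin 2) R}
    (h : ∀ i j, Commute x (N i j)) : Commute (Matrix.scalar (Fin 2) x) N := by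
  rw [commute_iff_eq]
  ext i j
  simp [(h i j).eq]

theorem map_extendRight {R S : Type*} [Ring R] [Ring S] (φ : R →+* S) (G Φ : R) (p : ℕ → R)
    (n : ℕ) : φ (extendRight G Φ p n) = extendRight (φ G) (φ Φ) (fun n => φ (p n)) n := by
  cases n <;> simp [extendRight]

theorem map_extendLeft {R S : Type*} [Ring R] [Ring S] (φ : R →+* S) (Γ Φ : R) (p : ℕ → R)
    (n : ℕ) : φ (extendLeft Γ Φ p n) = extendLeft (φ Γ) (φ Φ) (fun n => φ (p n)) n := by
  cases n <;> simp [extendLeft]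

/-- The monodromy matrix `N` intertwines the two coproducts of the sequence `p` with the divided
powers in the auxiliary space. -/
def Intertwines (Q c : ℂ) (N : Matrix (Fin 2) (Fin 2) R) (g : R) (p : ℕ → R) : Prop :=
  ∀ n, N * extendRight (Matrix.scalar (Fin 2) g) (auxLower R c)
        (fun n => Matrix.scalar (Fin 2) (p n)) n =
      extendLeft (auxDiag R Q) (auxLower R c) (fun n => Matrix.scalar (Fin 2) (p n)) n * N

theorem Intertwines.map {Q c : ℂ} {N : Matrix (Fin 2) (Fin 2) R} {g : R} {p : ℕ → R}
    (h : Intertwines Q c N g p) (φ : R →ₐ[ℂ] S) :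
    Intertwines Q c (φ.mapMatrix N) (φ g) fun n => φ (p n) := fun n => by
  have h1 := congrArg (RingHomClass.toRingHom (φ.mapMatrix (m := Fin 2))) (h n)
  rw [map_mul, map_mul, map_extendRight, map_extendLeft] at h1
  simpa only [RingHom.coe_coe, mapMatrix_scalar, mapMatrix_auxDiag, mapMatrix_auxLower] using h1

theorem auxDiag_pow (Q : ℂ) (n : ℕ) : auxDiag R Q ^ n = !![Q⁻¹ ^ n • 1, 0; 0, Q ^ n • 1] := by
  induction n with
  | zero => ext i j; fin_cases i <;> fin_cases j <;> simp
  | succ n ih =>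
    rw [pow_succ, ih, auxDiag]
    ext i j; fin_cases i <;> fin_cases j <;> simp [Matrix.mul_apply, smul_smul, pow_succ']

/-- The auxiliary lowering element has a single nonzero entry, so in 2 × 2 blocks each equation of
positive degree becomes four short relations for A, B, C, D; in degree 0 the extensions are just p
0. -/
theorem intertwines_iff {Q c : ℂ} {N : Matrix (Fin 2) (Fin 2) R} {g : R} {p : ℕ → R} :
    Intertwines Q c N g p ↔ (∀ i j, Commute (N i j) (p 0)) ∧ ∀ n,
      N 0 0 * p (n + 1) + c • (N 0 1 * (g * p n)) = Q⁻¹ ^ (n + 1) • (p (n + 1) * N 0 0) ∧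
      N 0 1 * p (n + 1) = Q⁻¹ ^ (n + 1) • (p (n + 1) * N 0 1) ∧
      N 1 0 * p (n + 1) + c • (N 1 1 * (g * p n)) =
        (c * Q ^ n) • (p n * N 0 0) + Q ^ (n + 1) • (p (n + 1) * N 1 0) ∧
      N 1 1 * p (n + 1) = (c * Q ^ n) • (p n * N 0 1) + Q ^ (n + 1) • (p (n + 1) * N 1 1) := by
  have key : ∀ n, (N * extendRight (Matrix.scalar (Fin 2) g) (auxLower R c)
        (fun n => Matrix.scalar (Fin 2) (p n)) (n + 1) =
      extendLeft (auxDiag R Q) (auxLower R c) (fun n => Matrix.scalar (Fin 2) (p n)) (n + 1) * N) ↔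
      N 0 0 * p (n + 1) + c • (N 0 1 * (g * p n)) = Q⁻¹ ^ (n + 1) • (p (n + 1) * N 0 0) ∧
      N 0 1 * p (n + 1) = Q⁻¹ ^ (n + 1) • (p (n + 1) * N 0 1) ∧
      N 1 0 * p (n + 1) + c • (N 1 1 * (g * p n)) =
        (c * Q ^ n) • (p n * N 0 0) + Q ^ (n + 1) • (p (n + 1) * N 1 0) ∧
      N 1 1 * p (n + 1) = (c * Q ^ n) • (p n * N 0 1) + Q ^ (n + 1) • (p (n + 1) * N 1 1) := by
    intro n
    rw [extendRight, extendLeft, auxDiag_pow, auxDiag_pow, ← Matrix.ext_iff]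
    simp [Fin.forall_fin_two, auxLower, Matrix.mul_apply, Matrix.add_apply, mul_add,
      Matrix.diagonal_apply, smul_smul, and_assoc, mul_comm c]
  constructor
  · refine fun h => ⟨fun i j => ?_, fun n => (key n).1 (h (n + 1))⟩
    have := congrFun (congrFun (h 0) i) j
    rw [commute_iff_eq]
    simpa [extendRight, extendLeft] using this
  · rintro ⟨h0, h1⟩ (_ | n)
    · exact (commute_scalar_of_forall fun i j => (h0 i j).symm).symm
    · exact (key n).2 (h1 n)

end

/-- Divided powers on the chain, from a group-like element `g` and divided powers `p` on a site. -/
def chainPow {M : ℕ} (g : LocOp M) (p : ℕ → LocOp M) : (L : ℕ) → ℕ → ChainOp M L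
  | 0, n => if n = 0 then 1 else 0
  | L + 1, n => ∑ x ∈ antidiagonal n, kron (g ^ x.2 * p x.1) (chainPow g p L x.2)

/-- One site is added at a time by `intertwine_mul`. The hypothesis `hg` expresses that the local
L-operator conserves the combined weight of the site and the auxiliary space. -/
theorem monodromy_intertwines {M : ℕ} {Q c : ℂ} {loc : Matrix (Fin 2) (Fin 2) (LocOp M)}
    {g : LocOp M} {p : ℕ → LocOp M} (h : Intertwines Q c loc g p)
    (hg : Commute (Matrix.scalar (Fin 2) g * auxDiag (LocOp M) Q) loc) (L : ℕ) :
    Intertwines Q c (monodromy L loc) (tensor fun _ => g) (chainPow g p L) := by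
  induction L with
  | zero =>
    rw [monodromy_zero, intertwines_iff]
    refine ⟨fun i j => by simp [chainPow], fun n => ?_⟩
    rcases n with _ | n <;> simp [chainPow, tensor_zero]
  | succ L ih =>
    intro n
    -- The recursion defining `chainPow` is the coproduct of the first site with the other sites,
    -- once both are embedded in the operators on the longer chain.
    have hp : (fun n => Matrix.scalar (Fin 2) (chainPow g p (L + 1) n)) =
        coproduct (Matrix.scalar (Fin 2) (firstSite M L g))
          (fun n => Matrix.scalar (Fin 2) (firstSite M L (p n)))
          fun n => Matrix.scalar (Fin 2) (otherSites M L (chainPow g p L n)) := by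
      funext n
      rw [coproduct, chainPow, map_sum]
      refine Finset.sum_congr rfl fun x _ => ?_
      rw [← firstSite_mul_otherSites, map_mul (firstSite M L), map_pow, map_mul, map_mul, map_pow]
    have hG : Matrix.scalar (Fin 2) (tensor fun _ : Fin (L + 1) => g) =
        Matrix.scalar (Fin 2) (firstSite M L g) *
          Matrix.scalar (Fin 2) (otherSites M L (tensor fun _ => g)) := by
      rw [← map_mul, firstSite_mul_otherSites, tensor_succ]
    have hc : ∀ a T, Commute (Matrix.scalar (Fin 2) (firstSite M L a))
        (Matrix.scalar (Fin 2) (otherSites M L T)) := fun a T =>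
      (commute_firstSite_otherSites a T).map (Matrix.scalar (Fin 2))
    rw [monodromy_succ, hG, hp]
    refine intertwine_mul (h.map (firstSite M L)) (ih.map (otherSites M L)) (hc _ _)
      (commute_scalar_auxDiag _ _) (commute_scalar_auxLower _ _)
      (commute_scalar_of_forall fun i j => commute_firstSite_otherSites _ _)
      (fun n => (hc _ _).symm) (fun n => (commute_scalar_auxDiag _ _).symm)
      (fun n => (commute_scalar_of_forall fun i j => commute_firstSite_otherSites _ _).symm)
      (fun n => (commute_scalar_of_forall fun i j =>
        (commute_firstSite_otherSites _ _).symm).symm) ?_ n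
    have := hg.map (firstSite M L).mapMatrix
    rwa [map_mul, mapMatrix_scalar, mapMatrix_auxDiag] at this

/-- In degree n + 1 the relation for A leaves over -c Q^n p_n B g, and z times the relation for D
leaves over z c Q^n p_n B. Together these are a left multiple of g - z, so the transfer matrix
passes through exactly where g acts as z. -/
theorem Intertwines.exists_transfer_mul {R : Type*} [Ring R] [Algebra ℂ R] {Q c : ℂ}
    {N : Matrix (Fin 2) (Fin 2) R} {g : R} {p : ℕ → R} (h : Intertwines Q c N g p) (hQ : Q ≠ 0)
    (hg : ∀ n, g * p n = (Q ^ 2) ^ n • (p n * g)) (z : ℂ) (n : ℕ) :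
    ∃ X, (N 0 0 + z • N 1 1) * p n =
      Q⁻¹ ^ n • (p n * (N 0 0 + (z * (Q ^ 2) ^ n) • N 1 1)) + X * (g - z • 1) := by
  obtain ⟨h0, h1⟩ := intertwines_iff.1 h
  have hB : ∀ n, N 0 1 * p n = Q⁻¹ ^ n • (p n * N 0 1) := by
    rintro (_ | n)
    · simpa using (h0 0 1).eq
    · exact (h1 n).2.1
  rcases n with _ | n
  · exact ⟨0, by simp [add_mul, mul_add, (h0 0 0).eq, (h0 1 1).eq]⟩
  · obtain ⟨hA, -, -, hD⟩ := h1 n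
    refine ⟨-(c * Q ^ n) • (p n * N 0 1), ?_⟩
    have hA' : N 0 0 * p (n + 1) =
        Q⁻¹ ^ (n + 1) • (p (n + 1) * N 0 0) - (c * Q ^ n) • (p n * N 0 1 * g) := by
      rw [← hA, hg, mul_smul_comm, ← mul_assoc, hB, smul_mul_assoc, smul_smul, smul_smul,
        eq_sub_iff_add_eq, add_right_inj]
      congr 1
      rw [inv_pow, ← pow_mul, mul_comm 2 n, pow_mul, sq]
      field_simp [pow_ne_zero n hQ]
    rw [add_mul, hA', smul_mul_assoc, hD]
    simp only [mul_add, mul_sub, mul_smul_comm, smul_mul_assoc, mul_one]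
    have hQ1 : Q ^ n ≠ 0 := pow_ne_zero n hQ
    match_scalars <;> (try simp only [inv_pow]) <;> field_simp <;> ring

/-! ### The normalized powers as iterated coproducts -/

section

variable {M : ℕ}

theorem tensor_smul {L : ℕ} (c : Fin L → ℂ) (O : Fin L → LocOp M) :
    (tensor fun i => c i • O i) = (∏ i, c i) • tensor O := by
  ext σ τ
  simp [tensor, Finset.prod_mul_distrib]

theorem tensor_const_smul {L : ℕ} (c : ℂ) (O : Fin L → LocOp M) :
    (tensor fun i => c • O i) = c ^ L • tensor O := by
  rw [tensor_smul, Finset.prod_const, Finset.card_univ, Fintype.card_fin]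

theorem tensor_pow {L : ℕ} (O : Fin L → LocOp M) (n : ℕ) :
    (tensor fun i => O i ^ n) = tensor O ^ n := by
  induction n with
  | zero => simp [tensor_one]
  | succ n ih => simp only [pow_succ, ← tensor_mul, ih]

/-- The common form of the operators `𝓑₊⁽ⁿ⁾`, `𝓑₋⁽ⁿ⁾`, `𝓒₊⁽ⁿ⁾`, `𝓒₋⁽ⁿ⁾`. -/
noncomputable def weightedPower (L : ℕ) (a d : ℂ) (k e : LocOp M) (n : ℕ) : ChainOp M L :=
  powerSum n fun κ i =>
    (a ^ above κ i * d ^ below κ i) • (k ^ (below κ i - above κ i) * e ^ (κ i : ℕ))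

theorem above_cons_zero {L : ℕ} (x : Fin (2 * M + 1)) (κ : Fin L → Fin (2 * M + 1)) :
    above (Fin.cons x κ : Fin (L + 1) → Fin (2 * M + 1)) 0 = ((∑ i, (κ i : ℕ) : ℕ) : ℤ) := by
  rw [above, Finset.sum_filter, Fin.sum_univ_succ]
  simp

theorem below_cons_zero {L : ℕ} (x : Fin (2 * M + 1)) (κ : Fin L → Fin (2 * M + 1)) :
    below (Fin.cons x κ : Fin (L + 1) → Fin (2 * M + 1)) 0 = 0 := by
  simp [below]

theorem above_cons_succ {L : ℕ} (x : Fin (2 * M + 1)) (κ : Fin L → Fin (2 * M + 1)) (i : Fin L) :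
    above (Fin.cons x κ : Fin (L + 1) → Fin (2 * M + 1)) i.succ = above κ i := by
  rw [above, above, Finset.sum_filter, Finset.sum_filter, Fin.sum_univ_succ]
  simp

theorem below_cons_succ {L : ℕ} (x : Fin (2 * M + 1)) (κ : Fin L → Fin (2 * M + 1)) (i : Fin L) :
    below (Fin.cons x κ : Fin (L + 1) → Fin (2 * M + 1)) i.succ = (x : ℕ) + below κ i := by
  rw [below, below, Finset.sum_filter, Finset.sum_filter, Fin.sum_univ_succ]
  simp

/-- Removes the cutoff k_1 < N: the terms of the antidiagonal beyond it vanish by `hf`. -/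
theorem sum_fin_ite_add_eq {A : Type*} [AddCommMonoid A] {N : ℕ} (f : ℕ → A)
    (hf : ∀ j, N ≤ j → f j = 0) (S n : ℕ) :
    (∑ x : Fin N, if (x : ℕ) + S = n then f x else 0) =
      ∑ y ∈ antidiagonal n, if S = y.2 then f y.1 else 0 := by
  rw [Fin.sum_univ_eq_sum_range (fun x => if x + S = n then f x else 0) N]
  rcases le_or_gt S n with h | h
  · have h1 : ∀ y ∈ antidiagonal n, (if S = y.2 then f y.1 else 0) =
        if y = (n - S, S) then f (n - S) else 0 := by
      rintro ⟨i, j⟩ hy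
      rw [Finset.HasAntidiagonal.mem_antidiagonal] at hy
      simp only [Prod.mk.injEq] at hy ⊢
      by_cases hj : S = j
      · rw [if_pos hj, if_pos ⟨by omega, hj.symm⟩]; congr 1; omega
      · rw [if_neg hj, if_neg (fun hh => hj hh.2.symm)]
    have h2 : ∀ x ∈ Finset.range N, (if x + S = n then f x else 0) =
        if x = n - S then f (n - S) else 0 := by
      intro x _
      by_cases hx : x + S = n
      · rw [if_pos hx, if_pos (by omega)]; congr 1; omega
      · rw [if_neg hx, if_neg (by omega)]
    rw [Finset.sum_congr rfl h1, Finset.sum_congr rfl h2, Finset.sum_ite_eq', Finset.sum_ite_eq']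
    have hm : (n - S, S) ∈ antidiagonal n := by
      rw [Finset.HasAntidiagonal.mem_antidiagonal]; exact Nat.sub_add_cancel h
    rw [if_pos hm]
    split_ifs with hh
    · rfl
    · rw [Finset.mem_range, not_lt] at hh
      exact (hf _ hh).symm
  · rw [Finset.sum_eq_zero, Finset.sum_eq_zero]
    · rintro ⟨i, j⟩ hy
      rw [Finset.HasAntidiagonal.mem_antidiagonal] at hy
      rw [if_neg]
      simp only at hy ⊢
      omega
    · intro x _
      rw [if_neg (by omega)]

/-- With x = k_1 split off, the first site has nothing below it and n - x above it. At each of the L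
other sites `below` grows by x, which contributes d^x k^x; over the chain this is d^(Lx) times the
x-th power of the tensor product of the k. -/
theorem weightedPower_succ (hM : 1 ≤ M) (L : ℕ) {a d : ℂ} (hd : d ≠ 0) {k : LocOp M}
    (hk : IsUnit k.det) (e : LocOp M) (n : ℕ) :
    weightedPower (L + 1) a d k e n = ∑ x ∈ antidiagonal n,
      kron (a ^ x.2 • (k⁻¹ ^ x.2 * ((qFact M x.1)⁻¹ • e ^ x.1)))
        (d ^ (L * x.1) • ((tensor fun _ => k) ^ x.1 * weightedPower L a d k e x.2)) := by
  set O : ∀ L, (Fin L → Fin (2 * M + 1)) → Fin L → LocOp M := fun L κ i =>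
    (a ^ above κ i * d ^ below κ i) • (k ^ (below κ i - above κ i) * e ^ (κ i : ℕ)) with hO
  have hterm : ∀ (x : Fin (2 * M + 1)) (κ : Fin L → Fin (2 * M + 1)),
      (∏ i, qFact M ((Fin.cons x κ : Fin (L + 1) → Fin (2 * M + 1)) i))⁻¹ •
        tensor (O (L + 1) (Fin.cons x κ)) =
      kron (a ^ (∑ i, (κ i : ℕ)) • (k⁻¹ ^ (∑ i, (κ i : ℕ)) * ((qFact M x)⁻¹ • e ^ (x : ℕ))))
        (d ^ (L * x) • ((tensor fun _ => k) ^ (x : ℕ) *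
          ((∏ i, qFact M (κ i))⁻¹ • tensor (O L κ)))) := by
    intro x κ
    have h0 : O (L + 1) (Fin.cons x κ) 0 =
        a ^ (∑ i, (κ i : ℕ)) • (k⁻¹ ^ (∑ i, (κ i : ℕ)) * e ^ (x : ℕ)) := by
      simp only [hO]
      rw [above_cons_zero, below_cons_zero, zpow_zero, mul_one, zpow_natCast, zero_sub, Fin.cons_zero,
        Matrix.zpow_neg_natCast, Matrix.inv_pow']
    have h1 : (fun i : Fin L => O (L + 1) (Fin.cons x κ) i.succ) =
        fun i => d ^ (x : ℕ) • (k ^ (x : ℕ) * O L κ i) := by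
      funext i
      simp only [hO]
      rw [above_cons_succ, below_cons_succ, Fin.cons_succ, add_sub_assoc,
        Matrix.zpow_add (A := k) hk, zpow_add₀ hd, zpow_natCast, zpow_natCast, mul_smul_comm,
        smul_smul, mul_assoc]
      congr 1
      ring
    rw [tensor_succ, h0, h1, tensor_const_smul (d ^ (x : ℕ)), ← tensor_mul, tensor_pow,
      Fin.prod_univ_succ]
    simp only [Fin.cons_zero, Fin.cons_succ, mul_smul_comm, kron_smul_left, kron_smul_right,
      smul_smul]
    congr 1
    rw [← pow_mul, mul_comm L, mul_inv]
    ring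
  rw [weightedPower, powerSum, Finset.sum_filter, ← (Fin.consEquiv fun _ => Fin (2 * M + 1)).sum_comp,
    Fintype.sum_prod_type, Finset.sum_comm]
  have hR : ∀ y ∈ antidiagonal n,
      kron (a ^ y.2 • (k⁻¹ ^ y.2 * ((qFact M y.1)⁻¹ • e ^ y.1)))
        (d ^ (L * y.1) • ((tensor fun _ => k) ^ y.1 * weightedPower L a d k e y.2)) =
      ∑ κ : Fin L → Fin (2 * M + 1), if ∑ i, (κ i : ℕ) = y.2 then
        kron (a ^ (∑ i, (κ i : ℕ)) • (k⁻¹ ^ (∑ i, (κ i : ℕ)) * ((qFact M y.1)⁻¹ • e ^ y.1)))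
        (d ^ (L * y.1) • ((tensor fun _ => k) ^ y.1 *
          ((∏ i, qFact M (κ i))⁻¹ • tensor (O L κ)))) else 0 := by
    intro y _
    rw [weightedPower, powerSum, Finset.mul_sum, Finset.smul_sum, ← firstSite_mul_otherSites,
      map_sum, Finset.mul_sum, Finset.sum_filter]
    refine Finset.sum_congr rfl fun κ _ => ?_
    split_ifs with h
    · rw [firstSite_mul_otherSites, h]
    · rfl
  rw [Finset.sum_congr rfl hR, Finset.sum_comm (s := antidiagonal n)]
  refine Finset.sum_congr rfl fun κ _ => ?_
  -- For x ≥ N the inverse of [x]! = 0 is 0, so the unrestricted antidiagonal adds nothing.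
  rw [← sum_fin_ite_add_eq (fun x => kron
    (a ^ (∑ i, (κ i : ℕ)) • (k⁻¹ ^ (∑ i, (κ i : ℕ)) * ((qFact M x)⁻¹ • e ^ x)))
        (d ^ (L * x) • ((tensor fun _ => k) ^ x *
          ((∏ i, qFact M (κ i))⁻¹ • tensor (O L κ))))) (N := 2 * M + 1) (fun j hj => by
      simp [qFact_eq_zero hM hj, kron_zero_left])]
  refine Finset.sum_congr rfl fun x _ => ?_
  have hx : (Fin.consEquiv fun _ => Fin (2 * M + 1)) (x, κ) =
      (Fin.cons x κ : Fin (L + 1) → Fin (2 * M + 1)) := rfl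
  rw [hx, Fin.sum_univ_succ, hterm]
  simp only [Fin.cons_zero, Fin.cons_succ]

theorem tensor_mul_tensor_inv {k : LocOp M} (hk : IsUnit k.det) (L : ℕ) :
    (tensor fun _ : Fin L => k) * (tensor fun _ : Fin L => k⁻¹) = 1 := by
  rw [tensor_mul, Matrix.mul_nonsing_inv _ hk, tensor_one]

theorem weightedPower_zero (a d : ℂ) (k e : LocOp M) (n : ℕ) :
    weightedPower 0 a d k e n = if n = 0 then 1 else 0 := by
  rw [weightedPower, powerSum, Finset.sum_filter, Fintype.sum_unique]
  simp [tensor_zero, eq_comm]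

/-- The weights of the explicit operators are symmetric, those of `chainPow` sit to the left only. A
global factor k^n converts one into the other: at the first site, with n = x₁ + x₂, it turns
k^(-2x₂-x₁) into k^(-x₂), and on the other sites it splits as k^(x₁) k^(x₂), the second factor being
used up by induction. -/
theorem weightedPower_eq_chainPow (hM : 1 ≤ M) {a d : ℂ} (hd : d ≠ 0) {k : LocOp M}
    (hk : IsUnit k.det) (e : LocOp M) (L n : ℕ) :
    weightedPower L a d k e n = d ^ (L * n) • ((tensor fun _ => k) ^ n *
      chainPow ((a / d) • (k⁻¹ * k⁻¹)) (fun n => d⁻¹ ^ n • (k⁻¹ ^ n * ((qFact M n)⁻¹ • e ^ n))) L n) := by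
  induction L generalizing n with
  | zero =>
    rw [weightedPower_zero, chainPow]
    rcases n with _ | n <;> simp
  | succ L ih =>
    rw [weightedPower_succ hM L hd hk, chainPow, Finset.mul_sum, Finset.smul_sum]
    refine Finset.sum_congr rfl fun x hx => ?_
    rw [Finset.HasAntidiagonal.mem_antidiagonal] at hx
    have hkn : (tensor fun _ : Fin (L + 1) => k) ^ n =
        kron (k ^ n) ((tensor fun _ : Fin L => k) ^ n) := by
      rw [← tensor_pow, tensor_succ, tensor_pow]
    rw [hkn, kron_mul_kron, ih, mul_smul_comm (d ^ (L * x.2)),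
      ← mul_assoc _ ((tensor fun _ => k) ^ x.2), ← pow_add, hx, smul_pow,
      smul_mul_smul_comm, mul_smul_comm (_ * _)]
    simp only [kron_smul_left, kron_smul_right, smul_smul]
    have hk1 : k ^ n * ((k⁻¹ * k⁻¹) ^ x.2 * (k⁻¹ ^ x.1 * (qFact M x.1)⁻¹ • e ^ x.1)) =
        k⁻¹ ^ x.2 * (qFact M x.1)⁻¹ • e ^ x.1 := by
      have h1 : Commute k k⁻¹ :=
        (Matrix.mul_nonsing_inv _ hk).trans (Matrix.nonsing_inv_mul _ hk).symm
      rw [← mul_assoc, ← mul_assoc, (Commute.refl k⁻¹).mul_pow, ← pow_add, mul_assoc (k ^ n), ← pow_add,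
        show x.2 + x.2 + x.1 = n + x.2 by omega, pow_add, ← mul_assoc, ← h1.mul_pow,
        Matrix.mul_nonsing_inv _ hk, one_pow, one_mul]
    rw [hk1]
    congr 1
    have hdn : ∀ j, d ^ j ≠ 0 := fun j => pow_ne_zero j hd
    rw [← hx, div_pow, inv_pow]
    field_simp
    ring

theorem mul_chainPow {g h : LocOp M} {p : ℕ → LocOp M} {c : ℂ} (hg : Commute h g)
    (hp : ∀ n, h * p n = c ^ n • (p n * h)) (L n : ℕ) :
    (tensor fun _ => h) * chainPow g p L n = c ^ n • (chainPow g p L n * tensor fun _ => h) := by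
  induction L generalizing n with
  | zero => rcases n with _ | n <;> simp [chainPow, tensor_zero]
  | succ L ih =>
    rw [chainPow, Finset.mul_sum, Finset.sum_mul, Finset.smul_sum]
    refine Finset.sum_congr rfl fun x hx => ?_
    rw [Finset.HasAntidiagonal.mem_antidiagonal] at hx
    rw [tensor_succ, kron_mul_kron, kron_mul_kron, ih, ← mul_assoc, (hg.pow_right x.2).eq,
      mul_assoc, hp, mul_smul_comm, kron_smul_left, kron_smul_right, smul_smul, ← pow_add, hx,
      mul_assoc]

/-- The transfer matrix `N 0 0 + z • N 1 1` moves through the divided powers, with a remainder that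
vanishes where `K` has the right value. -/
theorem exists_transfer_mul_weightedPower (hM : 1 ≤ M) {Q : ℂ} {k e f : LocOp M}
    (h : DividedPowers Q k k⁻¹ e f fun n => (qFact M n)⁻¹ • e ^ n) (hQ : Q ≠ 0)
    (hκ : Q - Q⁻¹ ≠ 0) {a₁ a₂ β a d : ℂ} (h1 : a₁ ≠ 0) (h2 : a₂ ≠ 0) (hβ : β ≠ 0) (hd : d ≠ 0)
    (had : a / d = -(a₁ * a₂)) {loc : Matrix (Fin 2) (Fin 2) (LocOp M)}
    (hA : loc 0 0 = a₁ • k⁻¹ + a₂ • k) (hB : loc 0 1 = β • e)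
    (hC : loc 1 0 = ((Q - Q⁻¹) ^ 2 / β) • f) (hD : loc 1 1 = (-a₂⁻¹) • k + (-a₁⁻¹) • k⁻¹)
    (L n : ℕ) (z : ℂ) (hc0 : Commute (tensor fun _ => k) (monodromy L loc 0 0))
    (hc1 : Commute (tensor fun _ => k) (monodromy L loc 1 1)) :
    ((tensor fun _ => k) * weightedPower L a d k e n =
      Q⁻¹ ^ n • (weightedPower L a d k e n * tensor fun _ => k)) ∧
    ∃ X, (monodromy L loc 0 0 + z • monodromy L loc 1 1) * weightedPower L a d k e n =
      Q⁻¹ ^ n • (weightedPower L a d k e n *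
        (monodromy L loc 0 0 + (z * (Q ^ 2) ^ n) • monodromy L loc 1 1)) +
      X * ((a / d) ^ L • (tensor fun _ => k⁻¹) ^ 2 - z • 1) := by
  have hk : IsUnit k.det := (Matrix.isUnit_iff_isUnit_det _).1 (IsUnit.of_mul_eq_one _ h.mul_inv)
  have hs := h.symm hQ
  have hW := weightedPower_eq_chainPow hM (a := a) hd hk e L n
  obtain ⟨p, hp⟩ : ∃ p : ℕ → LocOp M, p = fun n => d⁻¹ ^ n • (k⁻¹ ^ n * ((qFact M n)⁻¹ • e ^ n)) :=
    ⟨_, rfl⟩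
  obtain ⟨g, hg⟩ : ∃ g : LocOp M, g = (a / d) • (k⁻¹ * k⁻¹) := ⟨_, rfl⟩
  rw [← hp, ← hg] at hW
  obtain ⟨E, hE⟩ : ∃ E : ℕ → LocOp M, E = fun n => (qFact M n)⁻¹ • e ^ n := ⟨_, rfl⟩
  have hp : p = fun n => d⁻¹ ^ n • (k⁻¹ ^ n * E n) := by rw [hp, hE]
  rw [← hE] at h hs
  have hkk : Commute k k⁻¹ := h.mul_inv.trans h.inv_mul.symm
  have hkp : ∀ n, k * p n = Q⁻¹ ^ n • (p n * k) := fun n => by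
    rw [hp]
    simp only
    rw [mul_smul_comm, ← mul_assoc, (hkk.pow_right n).eq, mul_assoc, h.k_E, mul_smul_comm,
      smul_comm, smul_mul_assoc, mul_assoc]
  have hk'p : ∀ n, k⁻¹ * p n = Q ^ n • (p n * k⁻¹) := fun n =>
    inv_mul_eq_of_mul_eq (pow_ne_zero n hQ) h.mul_inv h.inv_mul (by rw [hkp, inv_pow])
  have hgp : ∀ n, g * p n = (Q ^ 2) ^ n • (p n * g) := fun n => by
    rw [hg, smul_mul_assoc, mul_assoc, hk'p, mul_smul_comm, ← mul_assoc, hk'p, smul_mul_assoc,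
      mul_smul_comm, mul_assoc, smul_smul, smul_smul, smul_smul]
    congr 1
    rw [← pow_mul, mul_comm 2 n, pow_mul]
    ring
  have hk'e : e * k⁻¹ = Q⁻¹ • (k⁻¹ * e) := by
    rw [hs.k_e, inv_inv, smul_smul, inv_mul_cancel₀ hQ, one_smul]
  have hk'f : f * k⁻¹ = Q • (k⁻¹ * f) := by
    rw [hs.k_f, smul_smul, mul_inv_cancel₀ hQ, one_smul]
  have hloc : Intertwines Q ((Q - Q⁻¹) * Q / (a₂ * β * d)) loc g p := by
    rw [intertwines_iff]
    refine ⟨fun i j => ?_, fun n => ?_⟩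
    · rw [hp]; simp [hE, qFact_zero]
    · exact h.local_relations hQ hκ h1 h2 hβ hd hA hB hC hD (g := g) (by rw [hg, had])
        (fun n => by rw [hp]) rfl n
  -- Weight conservation: passing g through the off-diagonal entries costs Q^(±2), which the two
  -- different entries of the auxiliary group-like element compensate.
  have hgloc : Commute (Matrix.scalar (Fin 2) g * auxDiag (LocOp M) Q) loc := by
    have g00 : Commute g (loc 0 0) := by
      rw [hA, hg]
      exact ((((Commute.refl _).mul_left (Commute.refl _)).smul_right _).add_right
        ((hkk.symm.mul_left hkk.symm).smul_right _)).smul_left _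
    have g11 : Commute g (loc 1 1) := by
      rw [hD, hg]
      exact (((hkk.symm.mul_left hkk.symm).smul_right _).add_right
        (((Commute.refl _).mul_left (Commute.refl _)).smul_right _)).smul_left _
    have g01 : Q⁻¹ • (g * loc 0 1) = Q • (loc 0 1 * g) := by
      rw [hB, hg]
      simp only [smul_mul_assoc, mul_smul_comm, smul_smul]
      rw [← mul_assoc e, hk'e, smul_mul_assoc, mul_assoc _ e, hk'e, mul_smul_comm, smul_smul, smul_smul,
        mul_assoc]
      congr 1
      field_simp
    have g10 : Q • (g * loc 1 0) = Q⁻¹ • (loc 1 0 * g) := by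
      rw [hC, hg]
      simp only [smul_mul_assoc, mul_smul_comm, smul_smul]
      rw [← mul_assoc f, hk'f, smul_mul_assoc, mul_assoc _ f, hk'f, mul_smul_comm, smul_smul, smul_smul,
        mul_assoc]
      congr 1
      field_simp
    rw [commute_iff_eq]
    ext i j : 1
    fin_cases i <;> fin_cases j <;>
      simp [auxDiag, Matrix.mul_apply, Fin.sum_univ_two, g00.eq, g11.eq, g01, g10]
  have hI := monodromy_intertwines hloc hgloc L
  have hgP : ∀ n, (tensor fun _ => g) * chainPow g p L n =
      (Q ^ 2) ^ n • (chainPow g p L n * tensor fun _ => g) :=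
    mul_chainPow (Commute.refl g) hgp L
  have hkg : Commute k g := hg ▸ (hkk.mul_right hkk).smul_right _
  have hkP := mul_chainPow hkg hkp L n
  have htg : (tensor fun _ : Fin L => g) = (a / d) ^ L • (tensor fun _ => k⁻¹) ^ 2 := by
    rw [hg, tensor_const_smul, sq, tensor_mul]
  refine ⟨?_, ?_⟩
  · rw [hW, mul_smul_comm, ← mul_assoc, (Commute.self_pow _ n).eq, mul_assoc, hkP, mul_smul_comm,
      smul_comm, smul_mul_assoc, mul_assoc]
  · obtain ⟨X, hX⟩ := hI.exists_transfer_mul hQ hgP z n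
    refine ⟨d ^ (L * n) • ((tensor fun _ => k) ^ n * X), ?_⟩
    -- The prefactor that relates `weightedPower` to `chainPow` commutes with the transfer matrix,
    -- so the relation transfers, with the prefactor included in X.
    have hcT : Commute ((tensor fun _ => k) ^ n) (monodromy L loc 0 0 + z • monodromy L loc 1 1) :=
      (hc0.add_right (hc1.smul_right z)).pow_left n
    rw [← htg, hW, mul_smul_comm, ← mul_assoc, ← hcT.eq, mul_assoc, hX]
    rw [mul_add, smul_add, mul_smul_comm, smul_comm (d ^ (L * n)), smul_mul_assoc, smul_mul_assoc,
      mul_assoc, mul_assoc]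

end

section

variable {M L m : ℕ}

/-! ### The total `K ^ (1/2)` and the charge -/

theorem kHalfTot_mul_tensor_inv (M L m : ℕ) :
    kHalfTot M L m * (tensor fun _ => (kHalf M m)⁻¹) = 1 :=
  tensor_mul_tensor_inv (isUnit_kHalf_det M m) L

theorem tensor_inv_mul_kHalfTot (M L m : ℕ) :
    (tensor fun _ => (kHalf M m)⁻¹) * kHalfTot M L m = 1 :=
  mul_eq_one_comm.1 (kHalfTot_mul_tensor_inv M L m)

theorem kHalfTot_inv (M L m : ℕ) : (kHalfTot M L m)⁻¹ = tensor fun _ => (kHalf M m)⁻¹ :=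
  Matrix.inv_eq_right_inv (kHalfTot_mul_tensor_inv M L m)

theorem kHalfTot_mul_inv (M L m : ℕ) : kHalfTot M L m * (kHalfTot M L m)⁻¹ = 1 := by
  rw [kHalfTot_inv, kHalfTot_mul_tensor_inv]

theorem kHalfTot_inv_mul (M L m : ℕ) : (kHalfTot M L m)⁻¹ * kHalfTot M L m = 1 := by
  rw [kHalfTot_inv, tensor_inv_mul_kHalfTot]

theorem kHalfTot_succ : kHalfTot M (L + 1) m = kron (kHalf M m) (kHalfTot M L m) := by
  rw [kHalfTot, tensor_succ, kHalfTot]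

theorem kHalfTot_inv_succ :
    (kHalfTot M (L + 1) m)⁻¹ = kron (kHalf M m)⁻¹ (kHalfTot M L m)⁻¹ := by
  rw [kHalfTot_inv, tensor_succ, kHalfTot_inv]

theorem weylX_eq (M m : ℕ) :
    weylX M = q M ^ (2 * m + 1) • ((kHalf M m)⁻¹ * (kHalf M m)⁻¹) := by
  rw [kHalf_inv, smul_mul_smul_comm, weylZhatHalf_sq, smul_smul, ← kScalar_sq, ← sq, ← mul_pow,
    mul_inv_cancel₀ (kScalar_ne_zero M m), one_pow, one_smul]

theorem tensor_weylX_eq (M L m : ℕ) : (tensor fun _ : Fin L => weylX M) =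
    q M ^ ((2 * m + 1) * L : ℤ) • ((kHalfTot M L m)⁻¹ * (kHalfTot M L m)⁻¹) := by
  rw [weylX_eq M m, tensor_const_smul, ← tensor_mul, kHalfTot_inv, ← pow_mul]
  norm_cast

theorem mem_chargeSpace {Q : ℤ} {v : Conf M L → ℂ} :
    v ∈ chargeSpace M L Q ↔ (tensor fun _ : Fin L => weylX M).mulVec v = omega M ^ Q • v := by
  rw [chargeSpace, LinearMap.mem_ker, LinearMap.sub_apply, sub_eq_zero]
  rfl

/-- On a site X = q^(2m+1) K⁻¹, so X_1⋯X_L is a scalar multiple of K⁻¹, and ω^Q = q^(-2Q). Charge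
spaces are thus eigenspaces of K, which makes the remainder in the transfer relation computable. -/
theorem mem_chargeSpace_iff_inv (m : ℕ) {Q : ℤ} {v : Conf M L → ℂ} :
    v ∈ chargeSpace M L Q ↔ ((kHalfTot M L m)⁻¹ ^ 2).mulVec v =
      q M ^ (-((2 * m + 1) * L + 2 * Q) : ℤ) • v := by
  have hq := q_ne_zero M
  rw [mem_chargeSpace, tensor_weylX_eq M L m, Matrix.smul_mulVec, ← sq, omega_zpow,
    neg_add, zpow_add₀ hq, ← smul_smul, zpow_neg (q M) ((2 * m + 1) * L : ℤ),
    ← eq_inv_smul_iff₀ (zpow_ne_zero _ hq), neg_mul]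

theorem mem_chargeSpace_iff (m : ℕ) {Q : ℤ} {v : Conf M L → ℂ} :
    v ∈ chargeSpace M L Q ↔ (kHalfTot M L m ^ 2).mulVec v =
      q M ^ ((2 * m + 1) * L + 2 * Q : ℤ) • v := by
  have hq := q_ne_zero M
  have hc : Commute (kHalfTot M L m) (kHalfTot M L m)⁻¹ :=
    (kHalfTot_mul_inv M L m).trans (kHalfTot_inv_mul M L m).symm
  have h1 : kHalfTot M L m ^ 2 * (kHalfTot M L m)⁻¹ ^ 2 = 1 := by
    rw [← hc.mul_pow, kHalfTot_mul_inv, one_pow]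
  have h2 : (kHalfTot M L m)⁻¹ ^ 2 * kHalfTot M L m ^ 2 = 1 := by
    rw [← hc.symm.mul_pow, kHalfTot_inv_mul, one_pow]
  rw [mem_chargeSpace_iff_inv m, zpow_neg]
  constructor
  · intro h
    have := congrArg (kHalfTot M L m ^ 2).mulVec h
    rw [Matrix.mulVec_mulVec, h1, Matrix.one_mulVec, Matrix.mulVec_smul] at this
    rw [eq_comm, ← eq_inv_smul_iff₀ (inv_ne_zero (zpow_ne_zero _ hq)), inv_inv] at this
    exact this
  · intro h
    have := congrArg ((kHalfTot M L m)⁻¹ ^ 2).mulVec h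
    rw [Matrix.mulVec_mulVec, h2, Matrix.one_mulVec, Matrix.mulVec_smul] at this
    rw [eq_comm, ← eq_inv_smul_iff₀ (zpow_ne_zero _ hq)] at this
    exact this

theorem chargeSpace_congr {Q Q' : ℤ} (h : Q ≡ Q' [ZMOD (2 * M + 1 : ℕ)]) :
    chargeSpace M L Q = chargeSpace M L Q' := by
  rw [chargeSpace, chargeSpace, omega_zpow_congr h]

theorem xxzT_congr {r r' : ℤ} (h : r ≡ r' [ZMOD (2 * M + 1 : ℕ)]) (s : ℂ) :
    xxzT M L m r s = xxzT M L m r' s := by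
  rw [xxzT, xxzT, q_zpow_congr (h.mul_left (-2))]

/-- An operator of definite weight shifts the charge. -/
theorem mulVec_mem_chargeSpace (m : ℕ) {Q n : ℤ} {T : ChainOp M L}
    (h : kHalfTot M L m * T = q M ^ n • (T * kHalfTot M L m)) {v : Conf M L → ℂ}
    (hv : v ∈ chargeSpace M L Q) : T.mulVec v ∈ chargeSpace M L (Q + n) := by
  rw [mem_chargeSpace_iff m] at hv ⊢
  have h2 : kHalfTot M L m ^ 2 * T = q M ^ (2 * n) • (T * kHalfTot M L m ^ 2) := by
    rw [sq, mul_assoc, h, mul_smul_comm, ← mul_assoc, h, smul_mul_assoc, smul_smul,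
      ← zpow_add₀ (q_ne_zero M), mul_assoc, two_mul n]
  rw [Matrix.mulVec_mulVec, h2, Matrix.smul_mulVec, ← Matrix.mulVec_mulVec, hv,
    Matrix.mulVec_smul, smul_smul, ← zpow_add₀ (q_ne_zero M)]
  congr 2
  ring

/-! ### Weights of the monodromy entries -/

theorem xxzMon_succ_apply (s : ℂ) (i j : Fin 2) : xxzMon M (L + 1) m s i j =
    kron (xxzL M m s i 0) (xxzMon M L m s 0 j) + kron (xxzL M m s i 1) (xxzMon M L m s 1 j) :=
  monodromy_succ_apply _ i j

theorem commute_kHalf_inv (M m : ℕ) : Commute (kHalf M m) (kHalf M m)⁻¹ :=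
  (kHalf_mul_inv M m).trans (kHalf_inv_mul M m).symm

theorem commute_kHalf_xxzL_zero (s : ℂ) : Commute (kHalf M m) (xxzL M m s 0 0) :=
  ((commute_kHalf_inv M m).smul_right _).sub_right ((Commute.refl _).smul_right _)

theorem commute_kHalf_xxzL_one (s : ℂ) : Commute (kHalf M m) (xxzL M m s 1 1) :=
  ((Commute.refl _).smul_right _).sub_right ((commute_kHalf_inv M m).smul_right _)

theorem kHalf_mul_xxzL_zero_one (s : ℂ) :
    kHalf M m * xxzL M m s 0 1 = (q M)⁻¹ • (xxzL M m s 0 1 * kHalf M m) := by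
  have : xxzL M m s 0 1 = (q M - (q M)⁻¹) • eMinus M m := rfl
  rw [this, mul_smul_comm, kHalf_mul_eMinus, smul_comm, smul_mul_assoc]

theorem kHalf_mul_xxzL_one_zero (s : ℂ) :
    kHalf M m * xxzL M m s 1 0 = q M • (xxzL M m s 1 0 * kHalf M m) := by
  have : xxzL M m s 1 0 = (q M - (q M)⁻¹) • ePlus M m := rfl
  rw [this, mul_smul_comm, kHalf_mul_ePlus, smul_comm, smul_mul_assoc]

theorem kHalfTot_mul_xxzMon (L : ℕ) (s : ℂ) :
    (Commute (kHalfTot M L m) (xxzMon M L m s 0 0) ∧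
      Commute (kHalfTot M L m) (xxzMon M L m s 1 1)) ∧
    (kHalfTot M L m * xxzMon M L m s 0 1 = (q M)⁻¹ • (xxzMon M L m s 0 1 * kHalfTot M L m) ∧
      kHalfTot M L m * xxzMon M L m s 1 0 = q M • (xxzMon M L m s 1 0 * kHalfTot M L m)) := by
  have hq := q_ne_zero M
  induction L with
  | zero => simp [xxzMon, monodromy_zero]
  | succ L ih =>
    obtain ⟨⟨h0, h1⟩, h2, h3⟩ := ih
    have g0 := (commute_kHalf_xxzL_zero (M := M) (m := m) s).eq
    have g1 := (commute_kHalf_xxzL_one (M := M) (m := m) s).eq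
    have g2 := kHalf_mul_xxzL_zero_one (M := M) (m := m) s
    have g3 := kHalf_mul_xxzL_one_zero (M := M) (m := m) s
    simp only [commute_iff_eq, kHalfTot_succ, xxzMon_succ_apply, mul_add, add_mul, kron_mul_kron,
      h0.eq, h1.eq, h2, h3, g0, g1, g2, g3, kron_smul_left, kron_smul_right, smul_add, smul_smul,
      mul_inv_cancel₀ hq, inv_mul_cancel₀ hq, one_smul, and_self]

theorem commute_kHalfTot_xxzT (r : ℤ) (s : ℂ) : Commute (kHalfTot M L m) (xxzT M L m r s) :=
  (kHalfTot_mul_xxzMon L s).1.1.add_right ((kHalfTot_mul_xxzMon L s).1.2.smul_right _)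

theorem xxzT_mulVec_mem (r : ℤ) (s : ℂ) {Q : ℤ} {v : Conf M L → ℂ} (hv : v ∈ chargeSpace M L Q) :
    (xxzT M L m r s).mulVec v ∈ chargeSpace M L Q := by
  have := mulVec_mem_chargeSpace m (n := 0) (T := xxzT M L m r s)
    (by rw [zpow_zero, one_smul, (commute_kHalfTot_xxzT r s).eq]) hv
  rwa [add_zero] at this

/-- Reversing the auxiliary basis is compatible with matrix products. It puts e⁺ in the upper right
corner, so the general relation, stated for that corner, also covers the powers of 𝓒. -/
theorem monodromy_submatrix (loc : Matrix (Fin 2) (Fin 2) (LocOp M)) (i j : Fin 2) :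
    monodromy L (loc.submatrix Fin.rev Fin.rev) i j = monodromy L loc i.rev j.rev := by
  induction L generalizing i with
  | zero => fin_cases i <;> fin_cases j <;> simp [monodromy_zero]
  | succ L ih =>
    rw [monodromy_succ_apply, monodromy_succ_apply, ih, ih]
    exact add_comm _ _

/-! ### The transfer matrix and the normalized powers -/

theorem bPlus_eq (M L m n : ℕ) :
    bPlus M L m n = weightedPower L (rho M m)⁻¹ 1 (kHalf M m) (eMinus M m) n := by
  simp only [bPlus, weightedPower, one_zpow, mul_one, inv_zpow, zpow_neg]

theorem bMinus_eq (M L m n : ℕ) :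
    bMinus M L m n = weightedPower L 1 (rho M m) (kHalf M m)⁻¹ (eMinus M m) n := by
  simp only [bMinus, weightedPower, one_zpow, one_mul, Matrix.inv_zpow' (isUnit_kHalf_det M m), neg_sub]

theorem cPlus_eq (M L m n : ℕ) :
    cPlus M L m n = weightedPower L 1 (rho M m)⁻¹ (kHalf M m)⁻¹ (ePlus M m) n := by
  simp only [cPlus, weightedPower, one_zpow, one_mul, Matrix.inv_zpow' (isUnit_kHalf_det M m), neg_sub, inv_zpow, zpow_neg]

theorem cMinus_eq (M L m n : ℕ) :
    cMinus M L m n = weightedPower L (rho M m) 1 (kHalf M m) (ePlus M m) n := by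
  simp only [cMinus, weightedPower, one_zpow, mul_one]

theorem rho_ne_zero (M m : ℕ) : rho M m ≠ 0 := pow_ne_zero _ (inv_ne_zero (q_ne_zero M))

theorem rho_eq (M m : ℕ) : rho M m = q M ^ (-(2 * m + 1) : ℤ) := by
  rw [rho, zpow_neg, inv_pow]
  norm_cast

theorem mulVec_of_remainder {T T' B X G : ChainOp M L} {c z : ℂ}
    (h : T * B = c • (B * T') + X * (G - z • 1)) {v : Conf M L → ℂ} (hv : G.mulVec v = z • v) :
    T.mulVec (B.mulVec v) = c • B.mulVec (T'.mulVec v) := by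
  have : (G - z • 1).mulVec v = 0 := by
    rw [Matrix.sub_mulVec, hv, Matrix.smul_mulVec, Matrix.one_mulVec, sub_self]
  rw [Matrix.mulVec_mulVec, h, Matrix.add_mulVec, ← Matrix.mulVec_mulVec _ X, this,
    Matrix.mulVec_zero, add_zero, Matrix.smul_mulVec, Matrix.mulVec_mulVec]

theorem mul_eq_of_inv_mul_eq {R : Type*} [Ring R] [Algebra ℂ R] {c : ℂ} (hc : c ≠ 0)
    {k k' x : R} (h1 : k * k' = 1) (h2 : k' * k = 1) (h : k' * x = c • (x * k')) :
    k * x = c⁻¹ • (x * k) :=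
  inv_mul_eq_of_mul_eq (inv_ne_zero hc) h2 h1 (by rwa [inv_inv])

/-- `xxzL` with the order of the two auxiliary basis vectors reversed. -/
noncomputable abbrev xxzLrev (M m : ℕ) (s : ℂ) : Matrix (Fin 2) (Fin 2) (LocOp M) :=
  (xxzL M m s).submatrix Fin.rev Fin.rev

theorem xxzL_rev_monodromy (s : ℂ) : monodromy L (xxzLrev M m s) 0 0 = xxzMon M L m s 1 1 ∧
    monodromy L (xxzLrev M m s) 1 1 = xxzMon M L m s 0 0 :=
  ⟨monodromy_submatrix _ 0 0, monodromy_submatrix _ 1 1⟩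

theorem commute_tensor_inv_of_commute {T : ChainOp M L} (h : Commute (kHalfTot M L m) T) :
    Commute (tensor fun _ => (kHalf M m)⁻¹) T := by
  rw [← kHalfTot_inv]
  have := h.eq
  rw [commute_iff_eq]
  calc (kHalfTot M L m)⁻¹ * T = (kHalfTot M L m)⁻¹ * (T * kHalfTot M L m) * (kHalfTot M L m)⁻¹ := by
        rw [mul_assoc, mul_assoc, kHalfTot_mul_inv, mul_one]
    _ = T * (kHalfTot M L m)⁻¹ := by
        rw [← this, ← mul_assoc, kHalfTot_inv_mul, one_mul]

/-- Here -(a₁ a₂) = q^(2m+1) = ρ⁻¹, independent of s, which is why the weights ρ occur in the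
normalized powers. On charge Q the element g is q^((2m+1)L) K⁻¹ = q^(-2Q), so it equals z = q^(-2r)
if Q ≡ r. -/
theorem bPlus_transfer (hM : 1 ≤ M) (m L n : ℕ) :
    (kHalfTot M L m * bPlus M L m n = q M ^ (-n : ℤ) • (bPlus M L m n * kHalfTot M L m)) ∧
    ∀ (r Q : ℤ) (s : ℂ), s ≠ 0 → Q ≡ r [ZMOD (2 * M + 1 : ℕ)] → ∀ v ∈ chargeSpace M L Q,
      (xxzT M L m r s).mulVec ((bPlus M L m n).mulVec v) =
        q M ^ (-n : ℤ) • (bPlus M L m n).mulVec ((xxzT M L m (r - n) s).mulVec v) := by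
  have hq := q_ne_zero M
  have hκ := q_sub_inv_ne_zero hM
  have hρ := rho_ne_zero M m
  have key := fun (s : ℂ) (hs : s ≠ 0) (z : ℂ) => exists_transfer_mul_weightedPower hM
    (dividedPowers_eMinus hM m) hq hκ (a₁ := q M ^ (1 + 2 * m) * s) (a₂ := -s⁻¹)
    (β := q M - (q M)⁻¹) (a := (rho M m)⁻¹) (d := 1) (mul_ne_zero (pow_ne_zero _ hq) hs)
    (neg_ne_zero.2 (inv_ne_zero hs)) hκ one_ne_zero
    (by rw [rho, inv_pow, inv_inv, add_comm]; field_simp)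
    (loc := xxzL M m s) (by simp [xxzL, sub_eq_add_neg]) rfl
    (by rw [sq, mul_div_cancel_right₀ _ hκ]; rfl)
    (by simp [xxzL, sub_eq_add_neg, mul_comm]) L n z (kHalfTot_mul_xxzMon L s).1.1
    (kHalfTot_mul_xxzMon L s).1.2
  simp only [← bPlus_eq] at key
  have hqn : (q M)⁻¹ ^ n = q M ^ (-n : ℤ) := by rw [zpow_neg, inv_pow, zpow_natCast]
  rw [hqn] at key
  refine ⟨(key 1 one_ne_zero 0).1, fun r Q s hs hr v hv => ?_⟩
  obtain ⟨X, hX⟩ := (key s hs (q M ^ (-2 * r))).2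
  have hz : q M ^ (-2 * r) * (q M ^ 2) ^ n = q M ^ (-2 * (r - n)) := by
    rw [← pow_mul, ← zpow_natCast, ← zpow_add₀ hq]; congr 1; push_cast; ring
  rw [hz] at hX
  refine mulVec_of_remainder hX ?_
  rw [← kHalfTot_inv, div_one, Matrix.smul_mulVec, (mem_chargeSpace_iff_inv m).1 hv, smul_smul]
  congr 1
  rw [rho_eq, ← zpow_neg, ← zpow_natCast, ← zpow_mul, ← zpow_add₀ hq,
    ← q_zpow_congr (hr.mul_left (-2))]
  congr 1; ring

/-- The same relation with q⁻¹ and K^(-1/2): now g = q^((2m+1)L) K, which is q^(2(2m+1)L+2Q) on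
charge Q, and comparison with q^(-2r) gives the other congruence. -/
theorem bMinus_transfer (hM : 1 ≤ M) (m L n : ℕ) :
    (kHalfTot M L m * bMinus M L m n = q M ^ (-n : ℤ) • (bMinus M L m n * kHalfTot M L m)) ∧
    ∀ (r Q : ℤ) (s : ℂ), s ≠ 0 → (1 + 2 * m) * L + Q + r ≡ 0 [ZMOD (2 * M + 1 : ℕ)] →
      ∀ v ∈ chargeSpace M L Q,
      (xxzT M L m r s).mulVec ((bMinus M L m n).mulVec v) =
        q M ^ (n : ℤ) • (bMinus M L m n).mulVec ((xxzT M L m (r + n) s).mulVec v) := by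
  have hq := q_ne_zero M
  have hκ := q_sub_inv_ne_zero hM
  have hρ := rho_ne_zero M m
  have hkk : (kHalf M m)⁻¹⁻¹ = kHalf M m := Matrix.nonsing_inv_nonsing_inv _ (isUnit_kHalf_det M m)
  have hκ' : (q M)⁻¹ - (q M)⁻¹⁻¹ ≠ 0 := by rw [inv_inv, ← neg_sub]; exact neg_ne_zero.2 hκ
  have key := fun (s : ℂ) (hs : s ≠ 0) (z : ℂ) => exists_transfer_mul_weightedPower hM
    (k := (kHalf M m)⁻¹) (by rw [hkk]; exact (dividedPowers_eMinus hM m).symm hq) (inv_ne_zero hq)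
    hκ' (a₁ := -s⁻¹) (a₂ := q M ^ (1 + 2 * m) * s)
    (β := q M - (q M)⁻¹) (a := 1) (d := rho M m)
    (neg_ne_zero.2 (inv_ne_zero hs)) (mul_ne_zero (pow_ne_zero _ hq) hs) hκ hρ
    (by rw [rho, one_div, inv_pow, inv_inv, add_comm]; field_simp)
    (loc := xxzL M m s) (by simp [xxzL, sub_eq_add_neg, hkk, add_comm]) rfl
    (by rw [inv_inv, ← neg_sub, neg_sq, sq, mul_div_cancel_right₀ _ hκ]; rfl)
    (by simp [xxzL, sub_eq_add_neg, mul_comm, hkk, add_comm]) L n z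
    (commute_tensor_inv_of_commute (kHalfTot_mul_xxzMon L s).1.1)
    (commute_tensor_inv_of_commute (kHalfTot_mul_xxzMon L s).1.2)
  simp only [← bMinus_eq, inv_inv, hkk] at key
  refine ⟨?_, fun r Q s hs hr v hv => ?_⟩
  · rw [zpow_neg]
    exact mul_eq_of_inv_mul_eq (zpow_ne_zero _ hq) (kHalfTot_mul_tensor_inv M L m)
      (tensor_inv_mul_kHalfTot M L m) (by rw [zpow_natCast]; exact (key 1 one_ne_zero 0).1)
  obtain ⟨X, hX⟩ := (key s hs (q M ^ (-2 * r))).2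
  have hz : q M ^ (-2 * r) * ((q M)⁻¹ ^ 2) ^ n = q M ^ (-2 * (r + n)) := by
    rw [← pow_mul, inv_pow, ← zpow_natCast, ← zpow_neg, ← zpow_add₀ hq]; congr 1; push_cast; ring
  rw [hz, ← zpow_natCast] at hX
  refine mulVec_of_remainder hX ?_
  rw [← kHalfTot, Matrix.smul_mulVec, (mem_chargeSpace_iff m).1 hv, smul_smul]
  congr 1
  rw [rho_eq, one_div, ← zpow_neg, ← zpow_natCast, ← zpow_mul, ← zpow_add₀ hq]
  apply q_zpow_congr
  have := (hr.mul_left 2).add_right (-2 * r)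
  convert this using 1 <;> ring

theorem cPlus_transfer (hM : 1 ≤ M) (m L n : ℕ) :
    (kHalfTot M L m * cPlus M L m n = q M ^ (n : ℤ) • (cPlus M L m n * kHalfTot M L m)) ∧
    ∀ (r Q : ℤ) (s : ℂ), s ≠ 0 → Q ≡ r [ZMOD (2 * M + 1 : ℕ)] → ∀ v ∈ chargeSpace M L Q,
      (xxzT M L m r s).mulVec ((cPlus M L m n).mulVec v) =
        q M ^ (n : ℤ) • (cPlus M L m n).mulVec ((xxzT M L m (r + n) s).mulVec v) := by
  have hq := q_ne_zero M
  have hκ := q_sub_inv_ne_zero hM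
  have hρ := rho_ne_zero M m
  have hkk : (kHalf M m)⁻¹⁻¹ = kHalf M m := Matrix.nonsing_inv_nonsing_inv _ (isUnit_kHalf_det M m)
  have key := fun (s : ℂ) (hs : s ≠ 0) (z : ℂ) => exists_transfer_mul_weightedPower hM
    (k := (kHalf M m)⁻¹) (by rw [hkk]; exact dividedPowers_ePlus hM m) hq
    hκ (a₁ := s) (a₂ := -((q M)⁻¹ ^ (1 + 2 * m) * s⁻¹))
    (β := q M - (q M)⁻¹) (a := 1) (d := (rho M m)⁻¹) hs
    (neg_ne_zero.2 (mul_ne_zero (pow_ne_zero _ (inv_ne_zero hq)) (inv_ne_zero hs)))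
    hκ (inv_ne_zero hρ)
    (by rw [rho, one_div, inv_inv, add_comm]; field_simp)
    (loc := xxzLrev M m s) (by simp [xxzL, sub_eq_add_neg, hkk]) rfl
    (by rw [sq, mul_div_cancel_right₀ _ hκ]; rfl)
    (by simp [xxzL, sub_eq_add_neg, mul_comm, hkk]) L n z
    (by
      rw [xxzL_rev_monodromy s |>.1]
      exact commute_tensor_inv_of_commute (kHalfTot_mul_xxzMon L s).1.2)
    (by
      rw [xxzL_rev_monodromy s |>.2]
      exact commute_tensor_inv_of_commute (kHalfTot_mul_xxzMon L s).1.1)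
  simp only [← cPlus_eq, hkk, xxzL_rev_monodromy] at key
  refine ⟨?_, fun r Q s hs hr v hv => ?_⟩
  · have := mul_eq_of_inv_mul_eq (c := (q M)⁻¹ ^ n) (pow_ne_zero _ (inv_ne_zero hq))
      (kHalfTot_mul_tensor_inv M L m) (tensor_inv_mul_kHalfTot M L m) (key 1 one_ne_zero 0).1
    rwa [inv_pow, inv_inv, ← zpow_natCast] at this
  -- In the reversed basis the relation concerns 𝓓 + z 𝓐; with z = q^(2r) this is q^(2r) 𝓣(s).
  obtain ⟨X, hX⟩ := (key s hs (q M ^ (2 * r))).2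
  have h := mulVec_of_remainder (v := v) hX (by
    rw [← kHalfTot, Matrix.smul_mulVec, (mem_chargeSpace_iff m).1 hv, smul_smul]
    congr 1
    rw [rho_eq, one_div, inv_inv, ← zpow_natCast, ← zpow_mul, ← zpow_add₀ hq,
      ← q_zpow_congr (hr.mul_left 2)]
    congr 1; ring)
  have e1 : xxzMon M L m s 1 1 + q M ^ (2 * r) • xxzMon M L m s 0 0 =
      q M ^ (2 * r) • xxzT M L m r s := by
    rw [xxzT, smul_add, smul_smul, ← zpow_add₀ hq, neg_mul, add_neg_cancel, zpow_zero, one_smul,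
      add_comm]
  have e2 : xxzMon M L m s 1 1 + (q M ^ (2 * r) * (q M ^ 2) ^ n) • xxzMon M L m s 0 0 =
      q M ^ (2 * (r + n)) • xxzT M L m (r + n) s := by
    have hz : q M ^ (2 * r) * (q M ^ 2) ^ n = q M ^ (2 * (r + n)) := by
      rw [← pow_mul, ← zpow_natCast, ← zpow_add₀ hq]; congr 1; push_cast; ring
    rw [hz, xxzT, smul_add, smul_smul, ← zpow_add₀ hq, neg_mul, add_neg_cancel, zpow_zero, one_smul,
      add_comm]
  rw [e1, e2, Matrix.smul_mulVec, Matrix.smul_mulVec, Matrix.mulVec_smul, smul_smul,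
    ← eq_inv_smul_iff₀ (zpow_ne_zero _ hq), smul_smul] at h
  rw [h]
  congr 1
  rw [← zpow_neg, inv_pow, ← zpow_natCast, ← zpow_neg, ← zpow_add₀ hq, ← zpow_add₀ hq]
  congr 1; ring

theorem cMinus_transfer (hM : 1 ≤ M) (m L n : ℕ) :
    (kHalfTot M L m * cMinus M L m n = q M ^ (n : ℤ) • (cMinus M L m n * kHalfTot M L m)) ∧
    ∀ (r Q : ℤ) (s : ℂ), s ≠ 0 → (1 + 2 * m) * L + Q + r ≡ 0 [ZMOD (2 * M + 1 : ℕ)] →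
      ∀ v ∈ chargeSpace M L Q,
      (xxzT M L m r s).mulVec ((cMinus M L m n).mulVec v) =
        q M ^ (-n : ℤ) • (cMinus M L m n).mulVec ((xxzT M L m (r - n) s).mulVec v) := by
  have hq := q_ne_zero M
  have hκ := q_sub_inv_ne_zero hM
  have hρ := rho_ne_zero M m
  have hkk : (kHalf M m)⁻¹⁻¹ = kHalf M m := Matrix.nonsing_inv_nonsing_inv _ (isUnit_kHalf_det M m)
  have hκ' : (q M)⁻¹ - (q M)⁻¹⁻¹ ≠ 0 := by rw [inv_inv, ← neg_sub]; exact neg_ne_zero.2 hκ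
  have key := fun (s : ℂ) (hs : s ≠ 0) (z : ℂ) => exists_transfer_mul_weightedPower hM
    ((dividedPowers_ePlus hM m).symm hq) (inv_ne_zero hq)
    hκ' (a₁ := -((q M)⁻¹ ^ (1 + 2 * m) * s⁻¹)) (a₂ := s)
    (β := q M - (q M)⁻¹) (a := rho M m) (d := 1)
    (neg_ne_zero.2 (mul_ne_zero (pow_ne_zero _ (inv_ne_zero hq)) (inv_ne_zero hs))) hs
    hκ one_ne_zero
    (by rw [rho, add_comm]; field_simp)
    (loc := xxzLrev M m s) (by simp [xxzL, sub_eq_add_neg, add_comm]) rfl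
    (by rw [inv_inv, ← neg_sub, neg_sq, sq, mul_div_cancel_right₀ _ hκ]; rfl)
    (by simp [xxzL, sub_eq_add_neg, mul_comm, add_comm]) L n z
    (by
      rw [xxzL_rev_monodromy s |>.1]
      exact (kHalfTot_mul_xxzMon L s).1.2)
    (by
      rw [xxzL_rev_monodromy s |>.2]
      exact (kHalfTot_mul_xxzMon L s).1.1)
  simp only [← cMinus_eq, xxzL_rev_monodromy, inv_inv] at key
  refine ⟨by rw [zpow_natCast]; exact (key 1 one_ne_zero 0).1, fun r Q s hs hr v hv => ?_⟩
  obtain ⟨X, hX⟩ := (key s hs (q M ^ (2 * r))).2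
  have h := mulVec_of_remainder (v := v) hX (by
    rw [← kHalfTot_inv, div_one, Matrix.smul_mulVec, (mem_chargeSpace_iff_inv m).1 hv, smul_smul]
    congr 1
    rw [rho_eq, ← zpow_natCast, ← zpow_mul, ← zpow_add₀ hq]
    apply q_zpow_congr
    have := (hr.mul_left (-2)).add_right (2 * r)
    convert this using 1 <;> ring)
  have e1 : xxzMon M L m s 1 1 + q M ^ (2 * r) • xxzMon M L m s 0 0 =
      q M ^ (2 * r) • xxzT M L m r s := by
    rw [xxzT, smul_add, smul_smul, ← zpow_add₀ hq, neg_mul, add_neg_cancel, zpow_zero, one_smul,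
      add_comm]
  have e2 : xxzMon M L m s 1 1 + (q M ^ (2 * r) * ((q M)⁻¹ ^ 2) ^ n) • xxzMon M L m s 0 0 =
      q M ^ (2 * (r - n)) • xxzT M L m (r - n) s := by
    have hz : q M ^ (2 * r) * ((q M)⁻¹ ^ 2) ^ n = q M ^ (2 * (r - n)) := by
      rw [← pow_mul, inv_pow, ← zpow_natCast, ← zpow_neg, ← zpow_add₀ hq]; congr 1; push_cast; ring
    rw [hz, xxzT, smul_add, smul_smul, ← zpow_add₀ hq, neg_mul, add_neg_cancel, zpow_zero, one_smul,
      add_comm]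
  rw [e1, e2, Matrix.smul_mulVec, Matrix.smul_mulVec, Matrix.mulVec_smul, smul_smul,
    ← eq_inv_smul_iff₀ (zpow_ne_zero _ hq), smul_smul] at h
  rw [h]
  congr 1
  rw [← zpow_neg, ← zpow_natCast, ← zpow_add₀ hq, ← zpow_add₀ hq]
  congr 1; ring

/-! ### The Fourier basis -/

theorem omega_pow_val_intCast (M : ℕ) (k : ℤ) : omega M ^ (k : Spin M).val = omega M ^ k := by
  rw [← zpow_natCast, ZMod.val_intCast]
  exact omega_zpow_congr (Int.mod_modEq _ _)

theorem fourierKet_apply (M : ℕ) (k σ : Spin M) : fourierKet M k σ =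
    ((Real.sqrt (2 * M + 1 : ℕ) : ℝ) : ℂ)⁻¹ * (omega M ^ (k * σ).val)⁻¹ := by
  rw [fourierKet, zpow_neg, zpow_natCast]

theorem weylX_mulVec_fourierKet (M : ℕ) (k : Spin M) :
    (weylX M).mulVec (fourierKet M k) = omega M ^ k.val • fourierKet M k := by
  ext σ
  have h : ∀ τ : Spin M, (σ = τ + 1) ↔ (τ = σ - 1) := fun τ => by
    constructor <;> intro h <;> rw [h] <;> ring
  simp only [Matrix.mulVec, dotProduct, weylX, Matrix.of_apply, h, ite_mul, one_mul, zero_mul,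
    Finset.sum_ite_eq', Finset.mem_univ, if_true, Pi.smul_apply, smul_eq_mul]
  have h2 : omega M ^ (k * σ).val = omega M ^ (k * (σ - 1)).val * omega M ^ k.val := by
    rw [← omega_pow_val_add]; congr 2; ring
  have h0 := pow_ne_zero k.val (omega_ne_zero M)
  rw [fourierKet_apply, fourierKet_apply, h2, mul_inv]
  field_simp

theorem weylZ_mulVec_fourierKet (M : ℕ) (k : Spin M) :
    (weylZ M).mulVec (fourierKet M k) = fourierKet M (k - 1) := by
  ext σ
  have h2 : omega M ^ (k * σ).val = omega M ^ ((k - 1) * σ).val * omega M ^ σ.val := by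
    rw [← omega_pow_val_add]; congr 2; ring
  have h0 := pow_ne_zero σ.val (omega_ne_zero M)
  rw [weylZ, Matrix.mulVec_diagonal, fourierKet_apply, fourierKet_apply, h2, mul_inv]
  field_simp

theorem weylZ_inv_mulVec_fourierKet (M : ℕ) (k : Spin M) :
    (weylZ M)⁻¹.mulVec (fourierKet M k) = fourierKet M (k + 1) := by
  have := weylZ_mulVec_fourierKet M (k + 1)
  rw [add_sub_cancel_right] at this
  rw [← this, Matrix.mulVec_mulVec, weylZ_inv_mul, Matrix.one_mulVec]

theorem kHalf_mulVec_fourierKet (M m : ℕ) (k : ℤ) :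
    (kHalf M m).mulVec (fourierKet M ((k : Spin M) - (m : Spin M))) =
      q M ^ (k - M) • fourierKet M ((k : Spin M) - (m : Spin M)) := by
  have hX : ∀ n, (weylX M ^ n).mulVec (fourierKet M ((k : Spin M) - (m : Spin M))) =
      (omega M ^ (k - m)) ^ n • fourierKet M ((k : Spin M) - (m : Spin M)) := fun n => by
    induction n with
    | zero => simp
    | succ n ih =>
      rw [pow_succ, ← Matrix.mulVec_mulVec, weylX_mulVec_fourierKet, Matrix.mulVec_smul, ih,
        smul_smul, pow_succ']
      congr 2
      rw [← omega_pow_val_intCast]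
      push_cast
      rfl
  rw [kHalf_eq, weylZhatHalf_inv, Matrix.smul_mulVec, hX, smul_smul]
  congr 1
  have h1 : (omega M ^ (k - m)) ^ M = q M ^ (k - m) := by
    rw [q, ← zpow_natCast, ← zpow_natCast, ← zpow_mul, ← zpow_mul, mul_comm]
  have hq := q_ne_zero M
  -- The exponent is M + 1 + m + (k - m), which is k - M modulo N = 2M + 1.
  rw [h1, kScalar, qHalf, ← pow_add, ← zpow_natCast, ← zpow_add₀ hq]
  apply q_zpow_congr
  rw [Int.modEq_iff_dvd]
  exact ⟨-1, by push_cast; ring⟩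

theorem kHalf_inv_mulVec_fourierKet (M m : ℕ) (k : ℤ) :
    (kHalf M m)⁻¹.mulVec (fourierKet M ((k : Spin M) - (m : Spin M))) =
      q M ^ (-(k - M)) • fourierKet M ((k : Spin M) - (m : Spin M)) := by
  have h := congrArg (kHalf M m)⁻¹.mulVec (kHalf_mulVec_fourierKet M m k)
  rw [Matrix.mulVec_mulVec, kHalf_inv_mul, Matrix.one_mulVec, Matrix.mulVec_smul, eq_comm,
    ← eq_inv_smul_iff₀ (zpow_ne_zero _ (q_ne_zero M))] at h
  rw [h, zpow_neg]

theorem ePlus_mulVec_fourierKet {M : ℕ} (m : ℕ) (k : ℤ) :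
    (ePlus M m).mulVec (fourierKet M ((k : Spin M) - (m : Spin M))) =
      ((qHalf M)⁻¹ * qInt M (2 * M - k)) • fourierKet M ((k : Spin M) + 1 - (m : Spin M)) := by
  have hq := q_ne_zero M
  have hket : (k : Spin M) - (m : Spin M) + 1 = ((k + 1 : ℤ) : Spin M) - (m : Spin M) := by
    push_cast; ring
  have hket2 : (k : Spin M) + 1 - (m : Spin M) = ((k + 1 : ℤ) : Spin M) - (m : Spin M) := by
    push_cast; ring
  rw [ePlus_eq, Matrix.smul_mulVec, ← Matrix.mulVec_mulVec, weylZ_inv_mulVec_fourierKet, hket,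
    hket2, Matrix.sub_mulVec, Matrix.smul_mulVec, kHalf_mulVec_fourierKet,
    kHalf_inv_mulVec_fourierKet, smul_smul, ← sub_smul, smul_smul]
  congr 1
  rw [qInt, div_eq_inv_mul, mul_left_comm]
  congr 1
  have hh : (qHalf M)⁻¹ = q M ^ (M : ℤ) := by
    refine inv_eq_of_mul_eq_one_right ?_
    rw [qHalf, zpow_natCast, ← pow_add, show M + 1 + M = 2 * M + 1 by ring, q_pow_period]
  have h1 : q M ^ (M - k - 1 : ℤ) = q M ^ ((M : ℤ) + (2 * M - k)) := by
    apply q_zpow_congr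
    rw [Int.modEq_iff_dvd]
    exact ⟨1, by push_cast; ring⟩
  rw [hh, mul_sub, ← zpow_add₀ hq, ← zpow_add₀ hq, ← zpow_neg_one, ← zpow_add₀ hq, ← h1]
  congr 2 <;> ring

theorem eMinus_mulVec_fourierKet {M : ℕ} (m : ℕ) (k : ℤ) :
    (eMinus M m).mulVec (fourierKet M ((k : Spin M) - (m : Spin M))) =
      (qHalf M * qInt M k) • fourierKet M ((k : Spin M) - 1 - (m : Spin M)) := by
  have hq := q_ne_zero M
  have hket : (k : Spin M) - (m : Spin M) - 1 = ((k - 1 : ℤ) : Spin M) - (m : Spin M) := by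
    push_cast; ring
  have hket2 : (k : Spin M) - 1 - (m : Spin M) = ((k - 1 : ℤ) : Spin M) - (m : Spin M) := by
    push_cast; ring
  rw [eMinus_eq, Matrix.smul_mulVec, ← Matrix.mulVec_mulVec, weylZ_mulVec_fourierKet, hket,
    hket2, Matrix.sub_mulVec, Matrix.smul_mulVec, kHalf_mulVec_fourierKet,
    kHalf_inv_mulVec_fourierKet, smul_smul, ← sub_smul, smul_smul]
  congr 1
  rw [qInt, div_eq_inv_mul, mul_left_comm]
  congr 1
  have h1 : q M ^ (k - M : ℤ) = q M ^ (((M + 1 : ℕ) : ℤ) + k) := by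
    apply q_zpow_congr
    rw [Int.modEq_iff_dvd]
    exact ⟨1, by push_cast; ring⟩
  rw [qHalf, ← zpow_natCast, mul_sub, ← zpow_add₀ hq, ← zpow_add₀ hq, ← h1]
  nth_rw 1 [← zpow_one (q M)]
  rw [← zpow_add₀ hq]
  congr 2 <;> (push_cast; ring)

/-! ### The `τ⁽²⁾`-model and the XXZ chain -/

theorem omega_eq_inv_sq (M : ℕ) : omega M = (q M ^ 2)⁻¹ := by
  rw [omega_eq_q_zpow, zpow_neg]; norm_cast

/-- The quotient of vector entries is conjugation by diag(1, -sq). With X = q^(2m+1) K⁻¹ and ω =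
q⁻², each of the four entries is a direct comparison of the coefficients of K^(±1/2). -/
theorem tauL_eq {M m : ℕ} (hM : 1 ≤ M) {s : ℂ} (hs : s ≠ 0) (i j : Fin 2) :
    tauL M m (s ^ 2) i j = (-s * (![1, -(s * q M)] i / ![1, -(s * q M)] j)) •
      ((kHalf M m)⁻¹ * xxzL M m s i j) := by
  have hq := q_ne_zero M
  have hκ := q_sub_inv_ne_zero hM
  have e01 : xxzL M m s 0 1 = (q M • kHalf M m - (kHalf M m)⁻¹) * weylZ M := by
    have : xxzL M m s 0 1 = (q M - (q M)⁻¹) • eMinus M m := rfl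
    rw [this, eMinus_eq, smul_smul, mul_inv_cancel₀ hκ, one_smul]
  have e10 : xxzL M m s 1 0 = ((kHalf M m)⁻¹ - (q M)⁻¹ • kHalf M m) * (weylZ M)⁻¹ := by
    have : xxzL M m s 1 0 = (q M - (q M)⁻¹) • ePlus M m := rfl
    rw [this, ePlus_eq, smul_smul, mul_inv_cancel₀ hκ, one_smul]
  have hω : ∀ n, omega M ^ n = (q M ^ (2 * n))⁻¹ := fun n => by
    rw [omega_eq_inv_sq, inv_pow, ← pow_mul]
  fin_cases i <;> fin_cases j
  · simp only [tauL, xxzL, weylX_eq M m, Fin.zero_eta, Matrix.of_apply, Matrix.cons_val_zero,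
      mul_sub, mul_smul_comm, kHalf_inv_mul, Matrix.cons_val', Matrix.cons_val_fin_one]
    match_scalars <;> field_simp <;> ring
  · simp only [Fin.zero_eta, Fin.mk_one, e01]
    rw [← mul_assoc, mul_sub, mul_smul_comm, kHalf_inv_mul, ← smul_mul_assoc]
    simp only [tauL, weylX_eq M m, Matrix.of_apply, Matrix.cons_val_zero, Matrix.cons_val_one,
      Matrix.cons_val', Matrix.cons_val_fin_one, hω]
    congr 1
    match_scalars <;> field_simp <;> ring
  · simp only [Fin.zero_eta, Fin.mk_one, e10]
    have e : tauL M m (s ^ 2) 1 0 =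
        (-s ^ 2) • ((1 - omega M ^ m • weylX M) * (weylZ M)⁻¹) := rfl
    rw [e, ← mul_assoc, mul_sub, mul_smul_comm, kHalf_inv_mul, ← smul_mul_assoc, ← smul_mul_assoc,
      weylX_eq M m, hω]
    simp only [Matrix.cons_val_zero, Matrix.cons_val_one, Matrix.cons_val_fin_one]
    congr 1
    match_scalars <;> field_simp <;> ring
  · simp only [tauL, xxzL, weylX_eq M m, Fin.mk_one, Matrix.of_apply, Matrix.cons_val_one,
      mul_sub, mul_smul_comm, kHalf_inv_mul, Matrix.cons_val', Matrix.cons_val_fin_one, hω,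
      inv_pow]
    match_scalars <;> field_simp <;> ring

theorem tauMon_succ_apply (t : ℂ) (i j : Fin 2) : tauMon M (L + 1) m t i j =
    kron (tauL M m t i 0) (tauMon M L m t 0 j) + kron (tauL M m t i 1) (tauMon M L m t 1 j) :=
  monodromy_succ_apply _ i j

/-- The diagonal conjugations of neighbouring sites cancel, and the local K^(-1/2) multiply to the
global one because they act on different sites. -/
theorem tauMon_eq (hM : 1 ≤ M) (L m : ℕ) {s : ℂ} (hs : s ≠ 0) (i j : Fin 2) :
    tauMon M L m (s ^ 2) i j = ((-s) ^ L * (![1, -(s * q M)] i / ![1, -(s * q M)] j)) •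
      ((kHalfTot M L m)⁻¹ * xxzMon M L m s i j) := by
  have hq := q_ne_zero M
  have hγ : ∀ l : Fin 2, (![1, -(s * q M)] : Fin 2 → ℂ) l ≠ 0 := fun l => by
    fin_cases l <;> simp [hs, hq]
  induction L generalizing i with
  | zero =>
    have h1 : (kHalfTot M 0 m)⁻¹ = 1 := by rw [kHalfTot_inv, tensor_zero]
    rw [tauMon, xxzMon, monodromy_zero, monodromy_zero, h1]
    fin_cases i <;> fin_cases j <;> simp [hs, hq]
  | succ L ih =>
    rw [tauMon_succ_apply, xxzMon_succ_apply, kHalfTot_inv_succ, mul_add, kron_mul_kron,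
      kron_mul_kron, ih, ih, tauL_eq hM hs, tauL_eq hM hs, smul_add]
    simp only [kron_smul_left, kron_smul_right, smul_smul]
    congr 2 <;>
    · rw [pow_succ]
      have h0 := hγ 0
      have h1 := hγ 1
      have hi := hγ i
      have hj := hγ j
      generalize (![1, -(s * q M)] : Fin 2 → ℂ) = γ at *
      field_simp

theorem tau2_eq (hM : 1 ≤ M) (L m : ℕ) (r : ℤ) {s : ℂ} (hs : s ≠ 0) :
    tau2 M L m r (s ^ 2) =
      (-(q M)⁻¹ * s) ^ L • ((kHalfTot M L m)⁻¹ * xxzT M L m r ((q M)⁻¹ * s)) := by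
  have hq := q_ne_zero M
  have h1 : omega M * s ^ 2 = ((q M)⁻¹ * s) ^ 2 := by rw [omega_eq_inv_sq]; ring
  have hs' : (q M)⁻¹ * s ≠ 0 := mul_ne_zero (inv_ne_zero hq) hs
  have h2 : -((q M)⁻¹ * s * q M) ≠ 0 := neg_ne_zero.2 (mul_ne_zero hs' hq)
  rw [tau2, h1, tauMon_eq hM L m hs', tauMon_eq hM L m hs', xxzT, mul_add, smul_add, mul_smul_comm,
    omega_zpow]
  simp only [Matrix.cons_val_zero, Matrix.cons_val_one, Matrix.cons_val_fin_one, div_self h2,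
    div_one, mul_one, neg_mul]
  rw [smul_comm]

theorem tau2_eq' (hM : 1 ≤ M) (L m : ℕ) (r : ℤ) {s : ℂ} (hs : s ≠ 0) :
    tau2 M L m r ((omega M)⁻¹ * s ^ 2) =
      (-s) ^ L • ((kHalfTot M L m)⁻¹ * xxzT M L m r s) := by
  have hq := q_ne_zero M
  have := tau2_eq hM L m r (mul_ne_zero hq hs)
  rwa [neg_mul, inv_mul_cancel_left₀ hq, mul_pow, ← inv_inv (q M ^ 2), ← omega_eq_inv_sq] at this

/-! ### Continuity in t and the value t = 0 -/

theorem exists_omega_inv_mul_sq {t : ℂ} (ht : t ≠ 0) :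
    ∃ s : ℂ, s ≠ 0 ∧ (omega M)⁻¹ * s ^ 2 = t := by
  obtain ⟨s, hs⟩ := IsAlgClosed.exists_pow_nat_eq (omega M * t) (n := 2) (by norm_num)
  refine ⟨s, ?_, by rw [hs, inv_mul_cancel_left₀ (omega_ne_zero M)]⟩
  rintro rfl
  rw [zero_pow two_ne_zero] at hs
  exact mul_ne_zero (omega_ne_zero M) ht hs.symm

theorem continuous_tauL (M m : ℕ) (i j : Fin 2) : Continuous fun t => tauL M m t i j := by
  fin_cases i <;> fin_cases j <;> simp [tauL] <;> fun_prop

theorem continuous_tauMon (M L m : ℕ) (i j : Fin 2) : Continuous fun t => tauMon M L m t i j := by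
  induction L generalizing i with
  | zero => simp only [tauMon, monodromy_zero]; exact continuous_const
  | succ L ih =>
    simp only [tauMon_succ_apply]
    have hk : ∀ {a : ℂ → LocOp M} {T : ℂ → ChainOp M L}, Continuous a → Continuous T →
        Continuous fun t => kron (a t) (T t) := fun ha hT =>
      continuous_matrix fun σ τ => (ha.matrix_elem _ _).mul (hT.matrix_elem _ _)
    exact (hk (continuous_tauL M m i 0) (ih 0)).add (hk (continuous_tauL M m i 1) (ih 1))

theorem continuous_tau2 (M L m : ℕ) (r : ℤ) : Continuous (tau2 M L m r) :=
  ((continuous_tauMon M L m 0 0).comp (continuous_const_mul _)).add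
    (((continuous_tauMon M L m 1 1).comp (continuous_const_mul _)).fun_const_smul _)

theorem continuous_tau2_mulVec (M L m : ℕ) (r : ℤ) (v : Conf M L → ℂ) :
    Continuous fun t => (tau2 M L m r t).mulVec v :=
  (continuous_tau2 M L m r).matrix_mulVec continuous_const

theorem kHalfTot_inv_mul_of_weight {w : ℤ} {B : ChainOp M L}
    (h : kHalfTot M L m * B = q M ^ w • (B * kHalfTot M L m)) :
    (kHalfTot M L m)⁻¹ * B = q M ^ (-w) • (B * (kHalfTot M L m)⁻¹) :=
  inv_mul_eq_of_mul_eq (zpow_ne_zero _ (q_ne_zero M)) (kHalfTot_mul_inv M L m)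
    (kHalfTot_inv_mul M L m) (by rw [h, zpow_neg, inv_inv])

theorem commute_kHalfTot_tau2 (hM : 1 ≤ M) (L m : ℕ) (r : ℤ) (t : ℂ) :
    Commute (kHalfTot M L m) (tau2 M L m r t) := by
  have h : (fun t => kHalfTot M L m * tau2 M L m r t) = fun t => tau2 M L m r t * kHalfTot M L m := by
    -- The XXZ chain only reaches t = ω⁻¹ s² ≠ 0; both sides are continuous in t and the nonzero t
    -- are dense.
    refine Continuous.ext_on (dense_compl_singleton (0 : ℂ))
      (continuous_const.mul (continuous_tau2 M L m r))
      ((continuous_tau2 M L m r).mul continuous_const) fun t ht => ?_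
    obtain ⟨s, hs, rfl⟩ := exists_omega_inv_mul_sq (M := M) (t := t) ht
    simp only [tau2_eq' hM L m r hs]
    have hc : Commute (kHalfTot M L m) (kHalfTot M L m)⁻¹ :=
      (kHalfTot_mul_inv M L m).trans (kHalfTot_inv_mul M L m).symm
    exact ((hc.mul_right (commute_kHalfTot_xxzT r s)).smul_right _).eq
  exact congrFun h t

theorem tau2_mulVec_mem (hM : 1 ≤ M) (m : ℕ) (r : ℤ) (t : ℂ) {Q : ℤ} {v : Conf M L → ℂ}
    (hv : v ∈ chargeSpace M L Q) : (tau2 M L m r t).mulVec v ∈ chargeSpace M L Q := by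
  have := mulVec_mem_chargeSpace m (n := 0) (T := tau2 M L m r t)
    (by rw [zpow_zero, one_smul, (commute_kHalfTot_tau2 hM L m r t).eq]) hv
  rwa [add_zero] at this

/-! ### Operators commuting with the transfer matrices -/

/-- The two transfer matrices differ by a scalar and K^(-1/2), and moving K^(-1/2) through an
operator of weight w costs q^(-w). -/
theorem mixedCommute_of_xxz (hM : 1 ≤ M) {r Q Q' w : ℤ} {B : ChainOp M L}
    (hB : kHalfTot M L m * B = q M ^ w • (B * kHalfTot M L m))
    (hQ' : Q + w ≡ Q' [ZMOD (2 * M + 1 : ℕ)])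
    (hT : ∀ s : ℂ, s ≠ 0 → ∀ v ∈ chargeSpace M L Q,
      (xxzT M L m r s).mulVec (B.mulVec v) = B.mulVec ((xxzT M L m r s).mulVec v)) :
    MixedCommute M L m r Q Q' (q M ^ (-w)) B := by
  refine ⟨fun v hv => chargeSpace_congr hQ' ▸ mulVec_mem_chargeSpace m hB hv, hT,
    fun t v hv => ?_⟩
  have h : (fun t => (tau2 M L m r t).mulVec (B.mulVec v)) =
      fun t => q M ^ (-w) • B.mulVec ((tau2 M L m r t).mulVec v) := by
    refine Continuous.ext_on (dense_compl_singleton (0 : ℂ)) (continuous_tau2_mulVec M L m r _)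
      ((continuous_const.matrix_mulVec (continuous_tau2_mulVec M L m r v)).fun_const_smul _)
      fun t ht => ?_
    obtain ⟨s, hs, rfl⟩ := exists_omega_inv_mul_sq (M := M) (t := t) ht
    simp only [tau2_eq' hM L m r hs, Matrix.smul_mulVec, Matrix.mulVec_smul]
    rw [← Matrix.mulVec_mulVec, hT s hs v hv, Matrix.mulVec_mulVec, kHalfTot_inv_mul_of_weight hB,
      Matrix.smul_mulVec, smul_comm, ← Matrix.mulVec_mulVec, Matrix.mulVec_mulVec _ _ (xxzT M L m r s)]
  exact congrFun h t

theorem MixedCommute.modelsCommute (hM : 1 ≤ M) {r Q Q' : ℤ} {c : ℂ} {B : ChainOp M L}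
    (h : MixedCommute M L m r Q Q' c B) (hQ : Q' ≡ Q [ZMOD (2 * M + 1 : ℕ)]) (hc : c = 1) :
    ModelsCommute M L m r Q B := by
  obtain ⟨h1, h2, h3⟩ := h
  rw [chargeSpace_congr hQ] at h1
  subst hc
  exact ⟨fun t => ⟨fun v hv => tau2_mulVec_mem hM m r t hv, h1, fun v hv => by
    rw [h3 t v hv, one_smul]⟩, fun s hs => ⟨fun v hv => xxzT_mulVec_mem r s hv, h1, h2 s hs⟩⟩

/-- On the charge-`Q` subspace, moving `B` through the transfer matrix shifts the boundary condition
by `a`. -/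
def ShiftsBoundary (M L m : ℕ) (r Q a : ℤ) (B : ChainOp M L) : Prop :=
  ∀ s : ℂ, s ≠ 0 → ∀ v ∈ chargeSpace M L Q, (xxzT M L m r s).mulVec (B.mulVec v) =
    q M ^ a • B.mulVec ((xxzT M L m (r + a) s).mulVec v)

/-- The transfer matrix passes C on the charge Q + w produced by B, changing r to r + a, and then
passes B on charge Q, changing r + a to r + a + b ≡ r. The scalars multiply to q^(a+b) = 1. -/
theorem ShiftsBoundary.mixedCommute_mul (hM : 1 ≤ M) {r Q Q' a b w w' : ℤ} {B C : ChainOp M L}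
    (hC : ShiftsBoundary M L m r (Q + w) a C) (hB : ShiftsBoundary M L m (r + a) Q b B)
    (hwC : kHalfTot M L m * C = q M ^ w' • (C * kHalfTot M L m))
    (hwB : kHalfTot M L m * B = q M ^ w • (B * kHalfTot M L m))
    (hab : a + b ≡ 0 [ZMOD (2 * M + 1 : ℕ)]) (hQ' : Q + (w' + w) ≡ Q' [ZMOD (2 * M + 1 : ℕ)]) :
    MixedCommute M L m r Q Q' (q M ^ (-(w' + w))) (C * B) := by
  refine mixedCommute_of_xxz hM ?_ hQ' fun s hs v hv => ?_
  · rw [← mul_assoc, hwC, smul_mul_assoc, mul_assoc, hwB, mul_smul_comm, smul_smul,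
      ← zpow_add₀ (q_ne_zero M), mul_assoc]
  · have hr : r + a + b ≡ r [ZMOD (2 * M + 1 : ℕ)] := by
      have := hab.add_left r
      rwa [← add_assoc, add_zero] at this
    rw [← Matrix.mulVec_mulVec, hC s hs _ (mulVec_mem_chargeSpace m hwB hv), hB s hs v hv,
      Matrix.mulVec_smul, smul_smul, ← zpow_add₀ (q_ne_zero M), q_zpow_congr hab, zpow_zero,
      one_smul, xxzT_congr hr, Matrix.mulVec_mulVec]

/-! ### The products of the operators `𝓑` and `𝓒` -/

theorem modEq_of_zmod {a b : ℤ} (h : (a : Spin M) = b) : a ≡ b [ZMOD (2 * M + 1 : ℕ)] :=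
  (ZMod.intCast_eq_intCast_iff _ _ _).1 h

theorem zmod_of_modEq {a b : ℤ} (h : a ≡ b [ZMOD (2 * M + 1 : ℕ)]) : (a : Spin M) = b :=
  (ZMod.intCast_eq_intCast_iff _ _ _).2 h

theorem shiftsBoundary_bPlus (hM : 1 ≤ M) (n : ℕ) {r Q : ℤ} (h : (Q : Spin M) = r) :
    ShiftsBoundary M L m r Q (-n) (bPlus M L m n) := fun s hs v hv => by
  rw [(bPlus_transfer hM m L n).2 r Q s hs (modEq_of_zmod h) v hv, sub_eq_add_neg]

theorem shiftsBoundary_cPlus (hM : 1 ≤ M) (n : ℕ) {r Q : ℤ} (h : (Q : Spin M) = r) :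
    ShiftsBoundary M L m r Q n (cPlus M L m n) := fun s hs v hv =>
  (cPlus_transfer hM m L n).2 r Q s hs (modEq_of_zmod h) v hv

theorem shiftsBoundary_bMinus (hM : 1 ≤ M) (n : ℕ) {r Q : ℤ}
    (h : ((1 + 2 * m) * L + Q + r : Spin M) = 0) :
    ShiftsBoundary M L m r Q n (bMinus M L m n) := fun s hs v hv =>
  (bMinus_transfer hM m L n).2 r Q s hs (modEq_of_zmod (by push_cast; exact h)) v hv

theorem shiftsBoundary_cMinus (hM : 1 ≤ M) (n : ℕ) {r Q : ℤ}
    (h : ((1 + 2 * m) * L + Q + r : Spin M) = 0) :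
    ShiftsBoundary M L m r Q (-n) (cMinus M L m n) := fun s hs v hv => by
  rw [(cMinus_transfer hM m L n).2 r Q s hs (modEq_of_zmod (by push_cast; exact h)) v hv,
    sub_eq_add_neg]

theorem mixedCommute_cPlus_mul_bPlus (hM : 1 ≤ M) {r Q : ℤ} {n n' : ℕ}
    (h : (n : Spin M) = Q - r) (h' : (n' : Spin M) = Q - r) :
    MixedCommute M L m r Q Q (q M ^ (-(n' + -n : ℤ))) (cPlus M L m n' * bPlus M L m n) :=
  (shiftsBoundary_cPlus hM n' (by push_cast; rw [h]; ring)).mixedCommute_mul hM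
    (shiftsBoundary_bPlus hM n (by push_cast; rw [h']; ring)) (cPlus_transfer hM m L n').1
    (bPlus_transfer hM m L n).1 (modEq_of_zmod (by push_cast; rw [h, h']; ring))
    (modEq_of_zmod (by push_cast; rw [h, h']; ring))

theorem modelsCommute_cPlus_mul_bPlus (hM : 1 ≤ M) {r Q : ℤ} {n n' : ℕ}
    (h : (n : Spin M) = Q - r) (h' : (n' : Spin M) = Q - r) :
    ModelsCommute M L m r Q (cPlus M L m n' * bPlus M L m n) :=
  (mixedCommute_cPlus_mul_bPlus hM h h').modelsCommute hM (Int.ModEq.refl _) <|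
    (q_zpow_congr (modEq_of_zmod (by push_cast; rw [h, h']; ring))).trans (zpow_zero _)

theorem modelsCommute_bPlus_mul_cPlus (hM : 1 ≤ M) {r Q : ℤ} {n n' : ℕ}
    (h : -(n : Spin M) = Q - r) (h' : -(n' : Spin M) = Q - r) :
    ModelsCommute M L m r Q (bPlus M L m n' * cPlus M L m n) :=
  ((shiftsBoundary_bPlus hM n' (by push_cast; linear_combination -h)).mixedCommute_mul hM
    (Q' := Q) (shiftsBoundary_cPlus hM n (by push_cast; linear_combination -h'))
    (bPlus_transfer hM m L n').1
    (cPlus_transfer hM m L n).1 (modEq_of_zmod (by push_cast; linear_combination h' - h))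
    (modEq_of_zmod (by push_cast; linear_combination h' - h))).modelsCommute hM
    (Int.ModEq.refl _) <|
    (q_zpow_congr (modEq_of_zmod (by push_cast; linear_combination h - h'))).trans (zpow_zero _)

theorem modelsCommute_cMinus_mul_bMinus (hM : 1 ≤ M) {r Q : ℤ} {n n' : ℕ}
    (h : (n : Spin M) = (1 + 2 * m) * L + Q + r) (h' : (n' : Spin M) = (1 + 2 * m) * L + Q + r) :
    ModelsCommute M L m r Q (cMinus M L m n' * bMinus M L m n) :=
  ((shiftsBoundary_cMinus hM n' (by push_cast; linear_combination -h)).mixedCommute_mul hM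
    (Q' := Q) (shiftsBoundary_bMinus hM n (by push_cast; linear_combination -h'))
    (cMinus_transfer hM m L n').1
    (bMinus_transfer hM m L n).1 (modEq_of_zmod (by push_cast; linear_combination h - h'))
    (modEq_of_zmod (by push_cast; linear_combination h' - h))).modelsCommute hM
    (Int.ModEq.refl _) <|
    (q_zpow_congr (modEq_of_zmod (by push_cast; linear_combination h - h'))).trans (zpow_zero _)

theorem modelsCommute_bMinus_mul_cMinus (hM : 1 ≤ M) {r Q : ℤ} {n n' : ℕ}
    (h : -(n : Spin M) = (1 + 2 * m) * L + Q + r)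
    (h' : -(n' : Spin M) = (1 + 2 * m) * L + Q + r) :
    ModelsCommute M L m r Q (bMinus M L m n' * cMinus M L m n) :=
  ((shiftsBoundary_bMinus hM n' (by push_cast; linear_combination -h)).mixedCommute_mul hM
    (Q' := Q) (shiftsBoundary_cMinus hM n (by push_cast; linear_combination -h'))
    (bMinus_transfer hM m L n').1
    (cMinus_transfer hM m L n).1 (modEq_of_zmod (by push_cast; linear_combination h - h'))
    (modEq_of_zmod (by push_cast; linear_combination h' - h))).modelsCommute hM
    (Int.ModEq.refl _) <|
    (q_zpow_congr (modEq_of_zmod (by push_cast; linear_combination h - h'))).trans (zpow_zero _)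

/-- By `h0`, (1+2m)L + Q + r ≡ Q - r, so plus and minus operators require the same residues. The
total weight n'' - n is ≡ -2(Q - r), which takes charge Q to 2r - Q. -/
theorem mixedCommute_of_mem (hM : 1 ≤ M) {r Q : ℤ} {n n'' : ℕ}
    (h0 : (2 * r + (2 * m + 1) * L : Spin M) = 0) (h : (n : Spin M) = Q - r)
    (h' : -(n'' : Spin M) = Q - r) {B : ChainOp M L}
    (hB : B ∈ ({cPlus M L m n'' * bMinus M L m n, cMinus M L m n'' * bPlus M L m n,
              bMinus M L m n * cPlus M L m n'', bPlus M L m n * cMinus M L m n''} :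
              Set (ChainOp M L))) :
    MixedCommute M L m r Q (2 * r - Q) (q M ^ (2 * n)) B := by
  have hc : ∀ w : ℤ, (w : Spin M) = n'' - n → q M ^ (2 * n) = q M ^ (-w) := fun w hw => by
    rw [← zpow_natCast]
    exact q_zpow_congr (modEq_of_zmod (by push_cast; rw [hw]; linear_combination h - h'))
  have hQ : ∀ w : ℤ, (w : Spin M) = n'' - n → Q + w ≡ 2 * r - Q [ZMOD (2 * M + 1 : ℕ)] :=
    fun w hw => modEq_of_zmod (by push_cast; rw [hw]; linear_combination - h - h')
  rcases hB with rfl | rfl | rfl | rfl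
  · have hw : ((n'' + -n : ℤ) : Spin M) = n'' - n := by push_cast; ring
    rw [hc _ hw]
    exact (shiftsBoundary_cPlus hM n'' (by push_cast; linear_combination -h)).mixedCommute_mul hM
      (shiftsBoundary_bMinus hM n (by push_cast; linear_combination h0 - h'))
      (cPlus_transfer hM m L n'').1 (bMinus_transfer hM m L n).1
      (modEq_of_zmod (by push_cast; linear_combination h - h')) (hQ _ hw)
  · have hw : ((n'' + -n : ℤ) : Spin M) = n'' - n := by push_cast; ring
    rw [hc _ hw]
    exact (shiftsBoundary_cMinus hM n'' (by push_cast; linear_combination h0 - h)).mixedCommute_mul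
      hM (shiftsBoundary_bPlus hM n (by push_cast; linear_combination -h'))
      (cMinus_transfer hM m L n'').1 (bPlus_transfer hM m L n).1
      (modEq_of_zmod (by push_cast; linear_combination h' - h)) (hQ _ hw)
  · have hw : ((-n + n'' : ℤ) : Spin M) = n'' - n := by push_cast; ring
    rw [hc _ hw]
    exact (shiftsBoundary_bMinus hM n (by push_cast; linear_combination h0 - h')).mixedCommute_mul
      hM (shiftsBoundary_cPlus hM n'' (by push_cast; linear_combination -h))
      (bMinus_transfer hM m L n).1 (cPlus_transfer hM m L n'').1
      (modEq_of_zmod (by push_cast; linear_combination h - h')) (hQ _ hw)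
  · have hw : ((-n + n'' : ℤ) : Spin M) = n'' - n := by push_cast; ring
    rw [hc _ hw]
    exact (shiftsBoundary_bPlus hM n (by push_cast; linear_combination -h')).mixedCommute_mul
      hM (shiftsBoundary_cMinus hM n'' (by push_cast; linear_combination h0 - h))
      (bPlus_transfer hM m L n).1 (cMinus_transfer hM m L n'').1
      (modEq_of_zmod (by push_cast; linear_combination h' - h)) (hQ _ hw)

theorem two_mul_add_one_eq_zero (M : ℕ) : (2 * M + 1 : Spin M) = 0 := by
  exact_mod_cast ZMod.natCast_self (2 * M + 1)

theorem mixed_products (hM : 1 ≤ M) {r : ℤ}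
    (h0 : 2 * r + (2 * m + 1) * L ≡ 0 [ZMOD (2 * M + 1 : ℕ)]) (Q : ℤ) (n n'' : ℕ)
    (hn : (n : ℤ) ≡ Q + L * ((m : ℤ) - M) [ZMOD (2 * M + 1 : ℕ)])
    (hn' : -(n'' : ℤ) ≡ Q + L * ((m : ℤ) - M) [ZMOD (2 * M + 1 : ℕ)]) :
    (∀ v ∈ chargeSpace M L Q, (kHalfTot M L m ^ 2).mulVec v = q M ^ (2 * n) • v) ∧
    (∀ B ∈ ({cPlus M L m n'' * bMinus M L m n, cMinus M L m n'' * bPlus M L m n,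
          bMinus M L m n * cPlus M L m n'', bPlus M L m n * cMinus M L m n''} :
          Set (ChainOp M L)),
      MixedCommute M L m r Q (2 * r - Q) (q M ^ (2 * n)) B ∧
      (Q ≡ r [ZMOD (2 * M + 1 : ℕ)] → ModelsCommute M L m r Q B)) := by
  have hN := two_mul_add_one_eq_zero M
  have e0 := zmod_of_modEq h0
  have e1 := zmod_of_modEq hn
  have e2 := zmod_of_modEq hn'
  push_cast at e0 e1 e2
  -- M + 1 is the inverse of 2 modulo N, so `e0` amounts to r + L(m - M) ≡ 0.
  have f1 : (n : Spin M) = Q - r := by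
    linear_combination e1 + (M + 1 : Spin M) * e0 - (r + L * (m + 1) : Spin M) * hN
  have f2 : -(n'' : Spin M) = Q - r := by
    linear_combination e2 + (M + 1 : Spin M) * e0 - (r + L * (m + 1) : Spin M) * hN
  refine ⟨fun v hv => ?_, fun B hB => ?_⟩
  · rw [(mem_chargeSpace_iff m).1 hv, ← zpow_natCast]
    congr 1
    exact q_zpow_congr (modEq_of_zmod (by push_cast; linear_combination e0 - 2 * f1))
  · have h := mixedCommute_of_mem hM e0 f1 f2 hB
    refine ⟨h, fun hQ => h.modelsCommute hM ?_ ?_⟩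
    · exact modEq_of_zmod (by push_cast; linear_combination -2 * zmod_of_modEq hQ)
    · rw [← zpow_natCast, ← zpow_zero (q M)]
      exact q_zpow_congr (modEq_of_zmod (by
        push_cast; linear_combination 2 * f1 + 2 * zmod_of_modEq hQ))

/-! ### The local representation and the monodromy entries -/

theorem localRepresentation (hM : 1 ≤ M) (m : ℕ) :
    kHalf M m * ePlus M m * (kHalf M m)⁻¹ = q M • ePlus M m ∧
      kHalf M m * eMinus M m * (kHalf M m)⁻¹ = (q M)⁻¹ • eMinus M m ∧
      ePlus M m * eMinus M m - eMinus M m * ePlus M m =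
        (q M - (q M)⁻¹)⁻¹ • (kHalf M m ^ 2 - (kHalf M m)⁻¹ ^ 2) := by
  refine ⟨?_, ?_, ?_⟩
  · rw [kHalf_mul_ePlus, smul_mul_assoc, mul_assoc, kHalf_mul_inv, mul_one]
  · rw [kHalf_mul_eMinus, smul_mul_assoc, mul_assoc, kHalf_mul_inv, mul_one]
  · rw [ePlus_mul_eMinus hM, add_sub_cancel_left, sq, sq]

theorem tauMon_entries (hM : 1 ≤ M) (hL : 1 ≤ L) (m : ℕ) {s : ℂ} (hs : s ≠ 0) :
    tauMon M L m (s ^ 2) 0 0 = (-s) ^ L • ((kHalfTot M L m)⁻¹ * xxzMon M L m s 0 0) ∧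
      tauMon M L m (s ^ 2) 1 1 = (-s) ^ L • ((kHalfTot M L m)⁻¹ * xxzMon M L m s 1 1) ∧
      tauMon M L m (s ^ 2) 0 1 =
        ((-s) ^ (L - 1) * (q M)⁻¹) • ((kHalfTot M L m)⁻¹ * xxzMon M L m s 0 1) ∧
      tauMon M L m (s ^ 2) 1 0 =
        ((-s) ^ (L + 1) * q M) • ((kHalfTot M L m)⁻¹ * xxzMon M L m s 1 0) := by
  have hq := q_ne_zero M
  have h2 : s * q M ≠ 0 := mul_ne_zero hs hq
  simp only [tauMon_eq hM L m hs]
  -- The natural-number exponent L - 1 is a true difference because L ≥ 1.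
  obtain ⟨l, rfl⟩ := Nat.exists_eq_succ_of_ne_zero (Nat.one_le_iff_ne_zero.1 hL)
  refine ⟨?_, ?_, ?_, ?_⟩ <;> congr 1 <;>
    simp only [Matrix.cons_val_zero, Matrix.cons_val_one, Matrix.cons_val_fin_one,
      Nat.succ_sub_one, Nat.succ_eq_add_one]
  · simp
  · rw [div_self (neg_ne_zero.2 h2), mul_one]
  · field_simp
    ring
  · ring

/-! ### The eigenvalue relations -/

section Bethe

variable {J : ℕ} {v x : Fin J → ℂ}

theorem ne_zero_of_sq_eq (hv : ∀ j, v j ≠ 0) (hx : ∀ j, x j ^ 2 = -(omega M * v j)⁻¹) (j : Fin J) :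
    x j ≠ 0 := by
  intro h
  have := hx j
  rw [h, zero_pow two_ne_zero, eq_comm, neg_eq_zero, inv_eq_zero] at this
  exact mul_ne_zero (omega_ne_zero M) (hv j) this

theorem omega_mul_eq (hx : ∀ j, x j ^ 2 = -(omega M * v j)⁻¹) (j : Fin J) :
    omega M * v j = -(x j ^ 2)⁻¹ := by
  rw [hx, inv_neg, neg_neg, inv_inv]

theorem betheF_eq (hv : ∀ j, v j ≠ 0) (hx : ∀ j, x j ^ 2 = -(omega M * v j)⁻¹) (t : ℂ) :
    betheF M v t = ∏ j, (x j ^ 2 - t) / x j ^ 2 := by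
  refine Finset.prod_congr rfl fun j _ => ?_
  have := ne_zero_of_sq_eq hv hx j
  rw [omega_mul_eq hx]
  field_simp
  ring

theorem betheF_ne_zero_iff (hv : ∀ j, v j ≠ 0) (hx : ∀ j, x j ^ 2 = -(omega M * v j)⁻¹) (s : ℂ) :
    betheF M v (s ^ 2) ≠ 0 ↔ ∀ j, s ^ 2 ≠ x j ^ 2 := by
  rw [betheF_eq hv hx, Finset.prod_ne_zero_iff]
  refine forall_congr' fun j => ?_
  have := ne_zero_of_sq_eq hv hx j
  rw [Ne, div_eq_zero_iff, or_iff_left (pow_ne_zero 2 this), sub_eq_zero, eq_comm,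
    forall_prop_of_true (Finset.mem_univ j)]

theorem betheF_div_left (hv : ∀ j, v j ≠ 0) (hx : ∀ j, x j ^ 2 = -(omega M * v j)⁻¹) {s : ℂ}
    (hs : ∀ j, s ^ 2 ≠ x j ^ 2) :
    betheF M v (q M ^ 2 * s ^ 2) / betheF M v (s ^ 2) = q M ^ J * ∏ i, fFun M s (x i) := by
  have hq := q_ne_zero M
  rw [betheF_eq hv hx, betheF_eq hv hx, ← Finset.prod_div_distrib]
  conv_rhs => rw [show q M ^ J = ∏ _i : Fin J, q M by simp, ← Finset.prod_mul_distrib]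
  refine Finset.prod_congr rfl fun j _ => ?_
  have h0 := ne_zero_of_sq_eq hv hx j
  have h1 := sub_ne_zero.2 (hs j)
  have h2 := sub_ne_zero.2 (hs j).symm
  rw [fFun]
  field_simp
  ring

theorem betheF_div_right (hv : ∀ j, v j ≠ 0) (hx : ∀ j, x j ^ 2 = -(omega M * v j)⁻¹) {s : ℂ}
    (hs : ∀ j, s ^ 2 ≠ x j ^ 2) :
    betheF M v (omega M * s ^ 2) / betheF M v (s ^ 2) = (q M)⁻¹ ^ J * ∏ i, fFun M (x i) s := by
  have hq := q_ne_zero M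
  rw [betheF_eq hv hx, betheF_eq hv hx, ← Finset.prod_div_distrib]
  conv_rhs => rw [show (q M)⁻¹ ^ J = ∏ _i : Fin J, (q M)⁻¹ by simp, ← Finset.prod_mul_distrib]
  refine Finset.prod_congr rfl fun j _ => ?_
  have h0 := ne_zero_of_sq_eq hv hx j
  have h2 := sub_ne_zero.2 (hs j).symm
  rw [fFun, omega_eq_inv_sq]
  field_simp

theorem eigenvalue_eq (m L : ℕ) (hv : ∀ j, v j ≠ 0) (hx : ∀ j, x j ^ 2 = -(omega M * v j)⁻¹)
    (Pa Pb : ℤ) {s : ℂ} (hs : ∀ j, s ^ 2 ≠ x j ^ 2) {t : ℂ} (ht : (omega M)⁻¹ * s ^ 2 = t) :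
    omega M ^ (-Pa) * (1 - omega M ^ (-(m : ℤ)) * t) ^ L *
          (betheF M v t / betheF M v (omega M * t)) +
        omega M ^ Pb * (1 - omega M ^ (1 - (m : ℤ)) * t) ^ L *
          (betheF M v (omega M ^ 2 * t) / betheF M v (omega M * t)) =
      q M ^ (2 * Pa + J) * (1 - q M ^ (2 * m + 2) * s ^ 2) ^ L * ∏ i, fFun M s (x i) +
        q M ^ (-2 * Pb - J) * (1 - q M ^ (2 * m) * s ^ 2) ^ L * ∏ i, fFun M (x i) s := by
  subst ht
  have hq := q_ne_zero M
  have hω := omega_ne_zero M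
  have e1 : (omega M)⁻¹ = q M ^ 2 := by rw [omega_eq_inv_sq, inv_inv]
  have e2 : omega M ^ (-(m : ℤ)) * ((omega M)⁻¹ * s ^ 2) = q M ^ (2 * m + 2) * s ^ 2 := by
    rw [zpow_neg, zpow_natCast, ← inv_pow, e1, ← pow_mul]; ring
  have e3 : omega M ^ (1 - (m : ℤ)) * ((omega M)⁻¹ * s ^ 2) = q M ^ (2 * m) * s ^ 2 := by
    rw [zpow_sub₀ hω, zpow_one, div_eq_mul_inv, zpow_natCast, ← inv_pow, e1, ← pow_mul, ← e1]
    field_simp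
  have e4 : omega M ^ 2 * ((omega M)⁻¹ * s ^ 2) = omega M * s ^ 2 := by field_simp
  rw [e2, e3, e4, mul_inv_cancel_left₀ hω, betheF_div_right hv hx hs, e1, betheF_div_left hv hx hs,
    omega_zpow, omega_zpow, zpow_add₀ hq, zpow_sub₀ hq, zpow_natCast, inv_pow,
    show (-2 : ℤ) * -Pa = 2 * Pa by ring]
  ring

theorem tauRelation_iff (hM : 1 ≤ M) (r : ℤ) (hv : ∀ j, v j ≠ 0)
    (hx : ∀ j, x j ^ 2 = -(omega M * v j)⁻¹) (Pa Pb : ℤ) (ψ : Conf M L → ℂ) :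
    TauRelation M L m r v Pa Pb ψ ↔ XXZRelation M L m r x Pa Pb ψ := by
  have hω := omega_ne_zero M
  constructor
  · intro h s hs hsx
    rw [← tau2_eq' hM L m r hs, ← eigenvalue_eq m L hv hx Pa Pb hsx rfl]
    exact h _ (by rwa [mul_inv_cancel_left₀ hω, betheF_ne_zero_iff hv hx])
  · intro h
    have hne : ∀ t : ℂ, t ≠ 0 → betheF M v (omega M * t) ≠ 0 →
        (tau2 M L m r t).mulVec ψ =
          (omega M ^ (-Pa) * (1 - omega M ^ (-(m : ℤ)) * t) ^ L *
              (betheF M v t / betheF M v (omega M * t)) +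
            omega M ^ Pb * (1 - omega M ^ (1 - (m : ℤ)) * t) ^ L *
              (betheF M v (omega M ^ 2 * t) / betheF M v (omega M * t))) • ψ := by
      intro t ht hF
      obtain ⟨s, hs, hst⟩ := exists_omega_inv_mul_sq (M := M) ht
      have hsx : ∀ j, s ^ 2 ≠ x j ^ 2 := by
        rwa [← betheF_ne_zero_iff hv hx, ← mul_inv_cancel_left₀ hω (s ^ 2), hst]
      rw [eigenvalue_eq m L hv hx Pa Pb hsx hst, ← hst, tau2_eq' hM L m r hs]
      exact h s hs hsx
    intro t hF
    -- The point t = 0 is reached as a limit: F(0) ≠ 0, so the right side is continuous there, and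
    -- the relation holds at nearby t ≠ 0.
    rcases eq_or_ne t 0 with rfl | ht
    · have hcF : Continuous (betheF M v) :=
        continuous_finsetProd _ fun j _ => by fun_prop
      have hev : ∀ᶠ t in nhds (0 : ℂ), betheF M v (omega M * t) ≠ 0 :=
        (hcF.comp (continuous_const_mul _)).continuousAt.eventually_ne hF
      have hcR : ContinuousAt (fun t => (omega M ^ (-Pa) * (1 - omega M ^ (-(m : ℤ)) * t) ^ L *
          (betheF M v t / betheF M v (omega M * t)) +
            omega M ^ Pb * (1 - omega M ^ (1 - (m : ℤ)) * t) ^ L *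
          (betheF M v (omega M ^ 2 * t) / betheF M v (omega M * t))) • ψ) 0 := by
        have h1 : ∀ c : ℂ, ContinuousAt (fun t => betheF M v (c * t)) 0 := fun c =>
          (hcF.comp (continuous_const_mul c)).continuousAt
        have h2 := (hcF.continuousAt (x := 0)).div (h1 (omega M)) hF
        have h3 := (h1 (omega M ^ 2)).div (h1 (omega M)) hF
        have h4 : ∀ a c : ℂ, ContinuousAt (fun t => a * (1 - c * t) ^ L) 0 := fun a c => by fun_prop
        exact (((h4 _ _).mul h2).add ((h4 _ _).mul h3)).smul continuousAt_const
      refine tendsto_nhds_unique_of_eventuallyEq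
        ((continuous_tau2_mulVec M L m r ψ).continuousAt.tendsto.mono_left nhdsWithin_le_nhds)
        (hcR.tendsto.mono_left (nhdsWithin_le_nhds (s := {0}ᶜ))) ?_
      filter_upwards [self_mem_nhdsWithin, hev.filter_mono nhdsWithin_le_nhds] with t ht hFt
      exact hne t ht hFt
    · exact hne t ht hF

/-! ### The Bethe equations -/

/-- The two equations with the same index are reciprocals of each other. Their denominators still
match: v_i - ω⁻¹ v_j is a nonzero multiple of v_j - ω v_i, so the conditions on differences agree
when taken over all pairs, and the denominator on the left side of either equation is, up to a
nonzero factor, a numerator in the other. -/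
theorem bethe_iff (hL : 1 ≤ L) (hv : ∀ j, v j ≠ 0) (hx : ∀ j, x j ^ 2 = -(omega M * v j)⁻¹)
    (Pa Pb : ℤ) : TauBethe M L m v Pa Pb ↔ XXZBethe M L m x Pa Pb := by
  have hq := q_ne_zero M
  have hω := omega_ne_zero M
  have hL0 : L ≠ 0 := Nat.one_le_iff_ne_zero.1 hL
  have hqω : ∀ n : ℕ, q M ^ (2 * n) = omega M ^ (-(n : ℤ)) := fun n => by
    rw [omega_zpow, ← zpow_natCast]; congr 1; push_cast; ring
  have eA : ∀ j, 1 - q M ^ (2 * m) * x j ^ 2 = (v j + omega M ^ (-1 - (m : ℤ))) / v j := fun j => by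
    have := hv j
    rw [hx, hqω, sub_eq_add_neg (-1 : ℤ), zpow_add₀ hω (-1), zpow_neg_one]
    field_simp
    ring
  have eB : ∀ j, 1 - q M ^ (2 * m + 2) * x j ^ 2 = (v j + omega M ^ (-2 - (m : ℤ))) / v j := by
    intro j
    have := hv j
    rw [hx, show 2 * m + 2 = 2 * (m + 1) by ring, hqω,
      show (-2 - (m : ℤ)) = -1 + -((m + 1 : ℕ) : ℤ) by push_cast; ring, zpow_add₀ hω (-1),
      zpow_neg_one]
    field_simp
    ring
  have eD : ∀ i j, x i ^ 2 - q M ^ 2 * x j ^ 2 =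
      (v i - omega M * v j) * (omega M ^ 2)⁻¹ / (v i * v j) := fun i j => by
    have := hv j
    have := hv i
    rw [hx, hx, ← inv_inv (q M ^ 2), ← omega_eq_inv_sq]
    field_simp
    ring
  have eN : ∀ i j, q M ^ 2 * x i ^ 2 - x j ^ 2 =
      (v i - (omega M)⁻¹ * v j) * (omega M)⁻¹ / (v i * v j) := fun i j => by
    have := hv j
    have := hv i
    rw [hx, hx, ← inv_inv (q M ^ 2), ← omega_eq_inv_sq]
    field_simp
    ring
  have eV : ∀ i j, v i - (omega M)⁻¹ * v j = -(omega M)⁻¹ * (v j - omega M * v i) := fun i j => by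
    field_simp
    ring
  have hD : ∀ i j, x i ^ 2 - q M ^ 2 * x j ^ 2 ≠ 0 ↔ v i - omega M * v j ≠ 0 := fun i j => by
    simp [eD, hv, hω]
  have hprod : ∀ j, (-q M ^ (-2 * (Pa + Pb + J)) *
        ∏ i, (q M ^ 2 * x i ^ 2 - x j ^ 2) / (x i ^ 2 - q M ^ 2 * x j ^ 2)) =
      (-omega M ^ (-Pa - Pb) * ∏ i, (v j - (omega M)⁻¹ * v i) / (v j - omega M * v i))⁻¹ := by
    intro j
    rw [mul_inv, inv_neg, ← zpow_neg, ← Finset.prod_inv_distrib, ← omega_zpow,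
      show -(-Pa - Pb) = Pa + Pb by ring, zpow_add₀ hω _ (J : ℤ), zpow_natCast, neg_mul, neg_mul,
      mul_assoc, show omega M ^ J = ∏ _i : Fin J, omega M by simp, ← Finset.prod_mul_distrib]
    congr 2
    refine Finset.prod_congr rfl fun i _ => ?_
    have := hv j
    have := hv i
    rw [eN, eD, eV i j, eV j i]
    -- The identity needs no condition on denominators: if one of the two differences vanishes, both
    -- sides are 0 because division by 0 gives 0.
    by_cases h : v i - omega M * v j = 0
    · simp [h]
    by_cases h' : v j - omega M * v i = 0
    · simp [h']
    field_simp
  have hrhs : ∀ j, (∀ i, v i - omega M * v j ≠ 0) → (∀ i, v j - omega M * v i ≠ 0) →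
      (-omega M ^ (-Pa - Pb) * ∏ i, (v j - (omega M)⁻¹ * v i) / (v j - omega M * v i)) ≠ 0 := by
    intro j h h'
    refine mul_ne_zero (neg_ne_zero.2 (zpow_ne_zero _ hω)) (Finset.prod_ne_zero_iff.2 fun i _ =>
      div_ne_zero ?_ (h' i))
    rw [eV]
    exact mul_ne_zero (neg_ne_zero.2 (inv_ne_zero hω)) (h i)
  have hlhs : ∀ j, ((1 - q M ^ (2 * m + 2) * x j ^ 2) / (1 - q M ^ (2 * m) * x j ^ 2)) ^ L =
      (((v j + omega M ^ (-1 - (m : ℤ))) / (v j + omega M ^ (-2 - (m : ℤ)))) ^ L)⁻¹ := fun j => by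
    rw [eA, eB, div_div_div_cancel_right₀ (hv j), ← inv_pow, inv_div]
  constructor
  · intro h j
    obtain ⟨-, h2, h3⟩ := h j
    refine ⟨?_, fun i => (hD i j).2 ((h i).2.1 j), by rw [hlhs, hprod, h3]⟩
    rw [eA]
    refine div_ne_zero (fun h0 => ?_) (hv j)
    -- A zero numerator would make the left side 0, as L ≥ 1, but the right side is a product of
    -- nonzero factors.
    rw [h0, zero_div, zero_pow hL0] at h3
    exact hrhs j (fun i => (h i).2.1 j) h2 h3.symm
  · intro h j
    have h1 := fun i j => (hD i j).1 ((h j).2.1 i)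
    have h3 := (h j).2.2
    rw [hlhs, hprod, inv_inj] at h3
    refine ⟨fun h0 => ?_, h1 j, h3⟩
    rw [h0, div_zero, zero_pow hL0] at h3
    exact hrhs j (fun i => h1 i j) (h1 j) h3.symm

end Bethe

/-! ### The quantum numbers -/

/-- At t = 0 the L-operator is upper triangular in the auxiliary space, so the diagonal entries of
the monodromy are products of local diagonal entries. -/
theorem tauMon_zero_apply (M L m : ℕ) : tauMon M L m 0 0 0 = 1 ∧ tauMon M L m 0 1 0 = 0 ∧
    tauMon M L m 0 1 1 = (omega M ^ (1 + 2 * m)) ^ L • tensor fun _ => weylX M := by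
  induction L with
  | zero =>
    simp only [tauMon, monodromy_zero]
    refine ⟨rfl, rfl, ?_⟩
    rw [tensor_zero, pow_zero, one_smul]; rfl
  | succ L ih =>
    obtain ⟨h0, h1, h2⟩ := ih
    have e0 : tauL M m 0 0 0 = 1 := by simp [tauL]
    have e1 : tauL M m 0 1 0 = 0 := by simp [tauL]
    have e2 : tauL M m 0 1 1 = omega M ^ (1 + 2 * m) • weylX M := by simp [tauL]
    refine ⟨?_, ?_, ?_⟩
    · rw [tauMon_succ_apply, h0, h1, e0, kron_one_one, kron_zero_right, add_zero]
    · rw [tauMon_succ_apply, h0, h1, e1, kron_zero_left, kron_zero_right, add_zero]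
    · rw [tauMon_succ_apply, h2, e1, e2, kron_zero_left, zero_add, kron_smul_left, kron_smul_right,
        smul_smul, tensor_succ, pow_succ']

theorem tau2_zero_mulVec {r Q : ℤ} {ψ : Conf M L → ℂ} (hψ : ψ ∈ chargeSpace M L Q) :
    (tau2 M L m r 0).mulVec ψ = (1 + omega M ^ ((1 + 2 * m) * L + Q + r : ℤ)) • ψ := by
  have hω := omega_ne_zero M
  obtain ⟨h0, -, h2⟩ := tauMon_zero_apply M L m
  rw [tau2, mul_zero, h0, h2, Matrix.add_mulVec, Matrix.one_mulVec, Matrix.smul_mulVec,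
    Matrix.smul_mulVec, mem_chargeSpace.1 hψ, smul_smul, smul_smul, add_smul, one_smul]
  congr 2
  rw [zpow_add₀ hω _ r, zpow_add₀ hω, ← pow_mul, mul_comm (omega M ^ r), mul_right_comm]
  norm_cast

theorem norm_omega (M : ℕ) : ‖omega M‖ = 1 :=
  (omega_primitive M).norm'_eq_one (by omega)

/-- If `1 + u = a + b` with `u, a, b` on the unit circle and `u ≠ -1`, then `u = a b`. -/
theorem eq_mul_of_one_add_eq_add {u a b : ℂ} (hu : ‖u‖ = 1) (ha : ‖a‖ = 1) (hb : ‖b‖ = 1)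
    (hu1 : 1 + u ≠ 0) (h : 1 + u = a + b) : u = a * b := by
  -- Conjugation is inversion on the unit circle, so (1 + u)/u = (a + b)/(ab), and the equal nonzero
  -- numerators cancel.
  have hc := congrArg (starRingEnd ℂ) h
  simp only [map_add, map_one, ← Complex.inv_eq_conj hu, ← Complex.inv_eq_conj ha,
    ← Complex.inv_eq_conj hb] at hc
  have h0 : u ≠ 0 := fun h => by simp [h] at hu
  have h1 : a ≠ 0 := fun h => by simp [h] at ha
  have h2 : b ≠ 0 := fun h => by simp [h] at hb
  field_simp at hc
  refine mul_left_cancel₀ hu1 ?_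
  linear_combination u * h - hc

/-- At t = 0 all factors with F equal 1 and the relation reads 1 + ω^w = ω^(-P_a) + ω^(P_b) with w =
(1+2m)L + Q + r. The previous lemma then gives ω^w = ω^(P_b-P_a). -/
theorem quantumNumbers_modEq {J : ℕ} {v : Fin J → ℂ} {r Pa Pb Q : ℤ} {ψ : Conf M L → ℂ}
    (hψ : ψ ∈ chargeSpace M L Q) (h0 : ψ ≠ 0) (h : TauRelation M L m r v Pa Pb ψ) :
    (1 + 2 * m) * L + Q + r ≡ Pb - Pa [ZMOD (2 * M + 1 : ℕ)] := by
  have hω := omega_ne_zero M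
  have hF : betheF M v 0 = 1 := by simp [betheF]
  have h1 := h 0 (by rw [mul_zero, hF]; exact one_ne_zero)
  simp only [mul_zero, hF, sub_zero, one_pow, mul_one, div_one] at h1
  rw [tau2_zero_mulVec hψ] at h1
  have h2 := smul_left_injective ℂ h0 h1
  have hn : ∀ n : ℤ, ‖omega M ^ n‖ = 1 := fun n => by rw [norm_zpow, norm_omega, one_zpow]
  -- -1 is not an N-th root of unity, since N is odd.
  have hne : 1 + omega M ^ ((1 + 2 * m) * L + Q + r : ℤ) ≠ 0 := by
    intro h
    have h3 := congrArg (· ^ (2 * M + 1)) (eq_neg_of_add_eq_zero_right h)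
    simp only [← zpow_natCast, ← zpow_mul] at h3
    rw [mul_comm, zpow_mul, zpow_natCast, omega_pow_period, one_zpow, zpow_natCast,
      Odd.neg_one_pow ⟨M, rfl⟩] at h3
    norm_num at h3
  have h3 := eq_mul_of_one_add_eq_add (hn _) (hn _) (hn _) hne h2
  rw [← zpow_add₀ hω, omega_zpow, omega_zpow, q_zpow_eq_iff] at h3
  have e := zmod_of_modEq h3
  refine modEq_of_zmod ?_
  push_cast at e ⊢
  -- `e` carries a factor -2 from ω = q⁻², and M is the inverse of -2 modulo N.
  linear_combination (M : Spin M) * e +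
    (((1 + 2 * m) * L + Q + r) - (Pb - Pa) : Spin M) * two_mul_add_one_eq_zero M

end

end TauXXZ

theorem lemma2 (M L : ℕ) (hM : 1 ≤ M) (hL : 1 ≤ L) (m : ℕ) (r : ℤ) :
    -- the local operators form a `U_q(sl₂)`-representation
    (kHalf M m * ePlus M m * (kHalf M m)⁻¹ = q M • ePlus M m ∧
      kHalf M m * eMinus M m * (kHalf M m)⁻¹ = (q M)⁻¹ • eMinus M m ∧
      ePlus M m * eMinus M m - eMinus M m * ePlus M m =
        (q M - (q M)⁻¹)⁻¹ • (kHalf M m ^ 2 - (kHalf M m)⁻¹ ^ 2)) ∧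
    -- of spin `(N - 1) / 2`, in the basis `|(k - m)^⟩`, `0 ≤ k < N`
    (∀ k : ℕ, k < 2 * M + 1 →
      (kHalf M m).mulVec (fourierKet M ((k : Spin M) - (m : Spin M))) =
          q M ^ ((k : ℤ) - M) • fourierKet M ((k : Spin M) - (m : Spin M)) ∧
        (ePlus M m).mulVec (fourierKet M ((k : Spin M) - (m : Spin M))) =
          ((qHalf M)⁻¹ * qInt M (2 * M - k)) • fourierKet M ((k : Spin M) + 1 - (m : Spin M)) ∧
        (eMinus M m).mulVec (fourierKet M ((k : Spin M) - (m : Spin M))) =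
          (qHalf M * qInt M k) • fourierKet M ((k : Spin M) - 1 - (m : Spin M))) ∧
    -- the transfer matrices
    (∀ s : ℂ, s ≠ 0 → tau2 M L m r (s ^ 2) =
      (-(q M)⁻¹ * s) ^ L • ((kHalfTot M L m)⁻¹ * xxzT M L m r ((q M)⁻¹ * s))) ∧
    -- the monodromy entries
    (∀ s : ℂ, s ≠ 0 →
      tauMon M L m (s ^ 2) 0 0 = (-s) ^ L • ((kHalfTot M L m)⁻¹ * xxzMon M L m s 0 0) ∧
      tauMon M L m (s ^ 2) 1 1 = (-s) ^ L • ((kHalfTot M L m)⁻¹ * xxzMon M L m s 1 1) ∧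
      tauMon M L m (s ^ 2) 0 1 =
        ((-s) ^ (L - 1) * (q M)⁻¹) • ((kHalfTot M L m)⁻¹ * xxzMon M L m s 0 1) ∧
      tauMon M L m (s ^ 2) 1 0 =
        ((-s) ^ (L + 1) * q M) • ((kHalfTot M L m)⁻¹ * xxzMon M L m s 1 0)) ∧
    -- the eigenvalue relations and the Bethe equations
    (∀ (J : ℕ) (v x : Fin J → ℂ), (∀ j, v j ≠ 0) → (∀ j, x j ^ 2 = -(omega M * v j)⁻¹) →
      ∀ Pa Pb : ℤ,
        (∀ ψ : Conf M L → ℂ,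
          TauRelation M L m r v Pa Pb ψ ↔ XXZRelation M L m r x Pa Pb ψ) ∧
        (TauBethe M L m v Pa Pb ↔ XXZBethe M L m x Pa Pb)) ∧
    -- `P_b - P_a` is determined modulo `N` by the charge and the boundary condition
    (∀ (J : ℕ) (v : Fin J → ℂ) (Pa Pb Q : ℤ), (∀ j, v j ≠ 0) → ∀ ψ ∈ chargeSpace M L Q, ψ ≠ 0 →
      TauRelation M L m r v Pa Pb ψ →
        (1 + 2 * m) * L + Q + r ≡ Pb - Pa [ZMOD (2 * M + 1 : ℕ)]) ∧
    -- products of charge-preserving type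
    (∀ (Q : ℤ) (n n' : ℕ),
      ((n : ℤ) ≡ Q - r [ZMOD (2 * M + 1 : ℕ)] → (n' : ℤ) ≡ Q - r [ZMOD (2 * M + 1 : ℕ)] →
        ModelsCommute M L m r Q (cPlus M L m n' * bPlus M L m n)) ∧
      (-(n : ℤ) ≡ Q - r [ZMOD (2 * M + 1 : ℕ)] → -(n' : ℤ) ≡ Q - r [ZMOD (2 * M + 1 : ℕ)] →
        ModelsCommute M L m r Q (bPlus M L m n' * cPlus M L m n)) ∧
      ((n : ℤ) ≡ (1 + 2 * m) * L + Q + r [ZMOD (2 * M + 1 : ℕ)] →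
        (n' : ℤ) ≡ (1 + 2 * m) * L + Q + r [ZMOD (2 * M + 1 : ℕ)] →
        ModelsCommute M L m r Q (cMinus M L m n' * bMinus M L m n)) ∧
      (-(n : ℤ) ≡ (1 + 2 * m) * L + Q + r [ZMOD (2 * M + 1 : ℕ)] →
        -(n' : ℤ) ≡ (1 + 2 * m) * L + Q + r [ZMOD (2 * M + 1 : ℕ)] →
        ModelsCommute M L m r Q (bMinus M L m n' * cMinus M L m n))) ∧
    -- mixed products
    (2 * r + (2 * m + 1) * L ≡ 0 [ZMOD (2 * M + 1 : ℕ)] →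
      ∀ (Q : ℤ) (n n'' : ℕ),
        (n : ℤ) ≡ Q + L * ((m : ℤ) - M) [ZMOD (2 * M + 1 : ℕ)] →
        -(n'' : ℤ) ≡ Q + L * ((m : ℤ) - M) [ZMOD (2 * M + 1 : ℕ)] →
        (∀ v ∈ chargeSpace M L Q,
          (kHalfTot M L m ^ 2).mulVec v = q M ^ (2 * n) • v) ∧
        (∀ B ∈ ({cPlus M L m n'' * bMinus M L m n, cMinus M L m n'' * bPlus M L m n,
              bMinus M L m n * cPlus M L m n'', bPlus M L m n * cMinus M L m n''} :
              Set (ChainOp M L)),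
          MixedCommute M L m r Q (2 * r - Q) (q M ^ (2 * n)) B ∧
          (Q ≡ r [ZMOD (2 * M + 1 : ℕ)] → ModelsCommute M L m r Q B))) := by
  have hv : ∀ k : ℕ, (k : Spin M) = ((k : ℤ) : Spin M) := fun k => (Int.cast_natCast k).symm
  refine ⟨localRepresentation hM m, fun k _ => ?_, fun s hs => tau2_eq hM L m r hs,
    fun s hs => tauMon_entries hM hL m hs, fun J v x hv hx Pa Pb =>
      ⟨fun ψ => tauRelation_iff hM r hv hx Pa Pb ψ, bethe_iff hL hv hx Pa Pb⟩,
    fun J v Pa Pb Q _ ψ hψ h0 h => quantumNumbers_modEq hψ h0 h, fun Q n n' => ?_,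
    fun h0 Q n n'' hn hn' => mixed_products hM h0 Q n n'' hn hn'⟩
  · rw [hv k]
    exact ⟨kHalf_mulVec_fourierKet M m k, ePlus_mulVec_fourierKet m k, eMinus_mulVec_fourierKet m k⟩
  · refine ⟨fun h h' => ?_, fun h h' => ?_, fun h h' => ?_, fun h h' => ?_⟩ <;>
      have e := zmod_of_modEq h <;> have e' := zmod_of_modEq h' <;> push_cast at e e'
    · exact modelsCommute_cPlus_mul_bPlus hM e e'
    · exact modelsCommute_bPlus_mul_cPlus hM e e'
    · exact modelsCommute_cMinus_mul_bMinus hM e e'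
    · exact modelsCommute_bMinus_mul_cMinus hM e e'
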